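/- **Setting.** Let $q=e^{\eta}\in\mathbf C^*$ not be a root of unity, $q^x:=e^{\eta x}$, $[x]_q=\frac{q^x-q^{-x}}{q-q^{-1}}$; let $k\in\mathbf C$, $k\ne0,-1$, $p=q^{2(k+1)}$ with $|p|<1$, and $s=e^{t}\ne0$. Let $(a_{ij})_{i,j=1,2}=\begin{pmatrix}2&-1\\-1&0\end{pmatrix}$. Bosons $a^i_n,b^{12}_n,b^{13}_n,b^{23}_n,c_n$ ($n\in\mathbf Z$) and $Q_{a^i},Q_{b^{12}},Q_{b^{13}},Q_{b^{23}},Q_c$ satisfy $$[a^i_m,a^j_n]=\delta_{m+n,0}\tfrac{[a_{ij}m]_q[(k+1)m]_q}{m},\quad [a^i_0,Q_{a^j}]=(k+1)a_{ij},\quad [b_m,b_n]=\epsilon_b\,\delta_{m+n,0}\tfrac{[m]_q^2}{m},\quad [b_0,Q_b]=\epsilon_b$$ for $b\in\{b^{12},b^{13},b^{23},c\}$ with $\epsilon_{b^{12}}=-1$ and $\epsilon_{b^{13}}=\epsilon_{b^{23}}=\epsilon_c=1$; other commutators vanish (modes with $m\neq 0$ in the quotients). For $\lambda\in\mathbf C^6$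 with $\lambda_{b^{13}},\lambda_{b^{23}},\lambda_c-\lambda_{b^{12}}\in\mathbf Z$ let $F_\lambda$ be the Fock space generated by the creation operators ($n<0$) from the vectors $e^{\sum_r\chi_rQ_r}|0\rangle$ with charges $\chi=(\frac{\lambda_{a^1}}{k+1},\frac{2\lambda_{a^2}}{k+1},\lambda_{b^{12}}+i+j,\lambda_{b^{13}}+j,\lambda_{b^{23}}+l,\lambda_c+i+j)$, $i,j,l\in\mathbf Z$. For a boson $r$ put $$r(z;\kappa)=-\sum_{n\ne0}\tfrac{r_n}{[n]_q}q^{-\kappa|n|}z^{-n}+Q_r+r_0\ln z,\qquad r_\pm(z)=\pm(q-q^{-1})\sum_{n>0}r_{\pm n}z^{\mp n}\pm r_0\ln q,$$ $a^{*,i}_n=\frac{[n]_q}{[(k+1)n]_q}a^i_n$ (with $a^{*,i}_0=\frac{a^i_0}{k+1}$), $Q_{a^{*,i}}=\frac{Q_{a^i}}{k+1}$. Put $\sigma_{T}=e^{\sqrt{-1}\pi\sum_{r\in T}r_0}$, $\sigma=\sigma_{\{c,b^{12}\}}$, $\tau=\sigma_{\{c,b^{12},b^{13},b^{23}\}}$,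 $\rho=\sigma_{\{b^{13},b^{23}\}}$. **Generators.** The Drinfeld generators $X^{\pm,i}_n,h^i_n$ ($i=1,2$, $n\in\mathbf Z$), $q^{\pm h^i_0}$ and $c$ of $U_q[\widehat{sl(2|1)}]$ act at level $c=k$ by $$h^1_m=a^1_mq^{-|m|/2}+b^{12}_mq^{-(\frac k2+1)|m|}(q^{|m|}+q^{-|m|})+b^{13}_mq^{-(\frac k2+2)|m|}-b^{23}_mq^{-(\frac k2+1)|m|},$$ $$h^2_m=a^2_mq^{-|m|/2}-(b^{12}_m+b^{13}_m)q^{-(\frac k2+1)|m|},$$ and by the modes of $X^{\pm,i}(z)=\sum_nX^{\pm,i}_nz^{-n-1}$, where $$X^{+,1}(z)=-\tfrac{1}{(q-q^{-1})z}:e^{-b^{12}(z;-1)}(e^{-c(qz;0)}-e^{-c(q^{-1}z;0)}):\sigma,$$ $$X^{+,2}(z)=-:e^{-b^{12}_+(qz)-b^{13}_+(qz)+b^{23}(qz;0)}:\tau+:e^{b^{12}(z;0)+b^{13}(z;0)+c(z;0)}:,$$ $$X^{-,1}(z)=\tfrac1{(q-q^{-1})z}:\Big(e^{a^1_+(q^{\frac{k+1}2}z)+b^{12}(q^{k+2}z;1)+b^{13}_+(q^{k+2}z)-b^{23}_+(q^{k+1}z)+c(q^{k+1}z;0)}-e^{a^1_-(q^{-\frac{k+1}2}z)+b^{12}(q^{-k-2}z;1)+b^{13}_-(q^{-k-2}z)-b^{23}_-(q^{-k-1}z)+c(q^{-k-1}z;0)}\Big):\sigma^{-1}$$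 $$\qquad+q^{k+1}:e^{a^1_+(q^{\frac{k+1}2}z)-b^{13}(q^{k+1}z;0)+b^{23}(q^{k+1}z;-1)}:\rho,$$ $$X^{-,2}(z)=\tfrac1{(q-q^{-1})z}\Big(q:(e^{a^2_+(q^{\frac{k+1}2}z)-b^{23}(q^{k+1}z;0)}-e^{a^2_-(q^{-\frac{k+1}2}z)-b^{23}(q^{-k-1}z;0)}):\tau^{-1}-:e^{a^2_-(q^{-\frac{k+1}2}z)-b^{12}(q^{-k-1}z;1)-b^{13}(q^{-k-1}z;1)}(e^{-c(q^{-k}z;0)}-e^{-c(q^{-k-2}z;0)}):\Big).$$ **Screen currents and charges.** $$S^1(z)=:e^{-a^{*,1}(z;\frac{k+1}2)}:\Big(\tfrac{1}{(q-q^{-1})z}:e^{-b^{12}(z;0)-b^{12}_-(q^{-1}z)-b^{13}_-(q^{-1}z)+b^{23}_-(z)}\big(e^{-c(z;0)}-e^{-c(q^{-2}z;0)}\big):\sigma+q:e^{b^{13}(z;0)-b^{23}(qz;0)+b^{23}_+(z)}:\rho^{-1}\Big),$$ $$S^2(z)=-q^{-1}:e^{-a^{*,2}(z;\frac{k+1}2)+b^{23}(z;0)}:\tau^{-1},\qquad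 Q^i=\int_0^{s\infty}S^i(z)\,d_pz,$$ where $\int_0^{s\infty}f(z)d_pz=s(1-p)\sum_{m\in\mathbf Z}f(sp^m)p^m$; at $z=sp^m$ one takes $\ln z=t+2m(k+1)\eta$. **Statement.** Let $v$ be a (possibly infinite) formal linear combination of monomial Fock states of $F_\lambda$, $u$ any linear functional on Fock states, $i\in\{1,2\}$, and let $g$ be one of the generators above. Here $\langle u|gQ^i|v\rangle$ is the Jackson integral of $\langle u|g\,S^i(z)|v\rangle$, the matrix elements at the points $sp^m$ being absolutely convergent sums over initial, intermediate and final monomial states; $\langle u|Q^ig|v\rangle$ is defined likewise. Assume that these matrix elements and Jackson integrals converge, for $g$ and for the other modes of the current to which $g$ belongs. Then $$\langle u|\,g\,Q^i\,|v\rangle=(-1)^{[i][g]}\,\langle u|\,Q^i\,g\,|v\rangle ,$$ where $[X^{\pm,2}_n]=1$ and $[g]=0$ for all other generators, and $[i]=1$ for $i=2$, $[i]=0$ for $i=1$: the screen charges $Q^i$ (anti-)commute with all these generators of $U_q[\widehat{sl(2|1)}]$. -/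

import Mathlib

open Complex Filter Topology

noncomputable section

namespace SL21

/-- The six families of free bosons. `a 0`, `a 1` are the bosons `a¹`, `a²`. -/
inductive Osc
  | a (i : Fin 2)
  | b12
  | b13
  | b23
  | c
  deriving DecidableEq, Fintype

/-! Throughout, `η` is a logarithm of `q`, so that `q ^ x = exp (η * x)` for complex `x`; `k` is the
level. A point `z ≠ 0` is given by a logarithm `ζ`, since the screen currents contain non-integral
powers of `z`; then `q ^ x * z` corresponds to `ζ + x * η`. -/

/-- `q ^ x`. -/
def qpow (η x : ℂ) : ℂ := exp (η * x)

/-- The `q`-number `[x]_q`. -/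
def qnum (η x : ℂ) : ℂ := (qpow η x - qpow η (-x)) / (qpow η 1 - qpow η (-1))

/-- The symmetric Cartan matrix of `sl(2|1)`. -/
def cartan : Matrix (Fin 2) (Fin 2) ℤ := !![2, -1; -1, 0]

/-- `[r_n, s_{-n}]` for `n ≠ 0`. All other commutators of non-zero modes vanish. -/
def comm (η k : ℂ) (n : ℤ) : Osc → Osc → ℂ
  | .a i, .a j => qnum η (cartan i j * n) * qnum η ((k + 1) * n) / n
  | .b12, .b12 => -(qnum η n ^ 2 / n)
  | .b13, .b13 => qnum η n ^ 2 / n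
  | .b23, .b23 => qnum η n ^ 2 / n
  | .c, .c => qnum η n ^ 2 / n
  | _, _ => 0

/-- `[r_0, Q_s]`. -/
def comm₀ (k : ℂ) : Osc → Osc → ℂ
  | .a i, .a j => (k + 1) * cartan i j
  | .b12, .b12 => -1
  | .b13, .b13 => 1
  | .b23, .b23 => 1
  | .c, .c => 1
  | _, _ => 0

/-- Occupation numbers of the creation operators `r_{-n}`, `n > 0`. -/
abbrev Occ : Type := (Osc × ℕ+) →₀ ℕ

/-- Monomial Fock states: `(χ, ν)` is `∏ (r_{-n}) ^ ν (r, n)` applied to `exp (∑ χ_r Q_r) |0⟩`. -/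
abbrev FockState : Type := (Osc → ℂ) × Occ

/-- Operators given by their matrix elements `A out inn` between monomial Fock states: `A inn` has
coefficient `A out inn` at `out` (possibly for infinitely many `out`). -/
abbrev FockOp : Type := FockState → FockState → ℂ

/-- The eigenvalue of `r_0` on states of charge `χ`. -/
def zeroEig (k : ℂ) (χ : Osc → ℂ) (r : Osc) : ℂ := ∑ s, comm₀ k r s * χ s

/-- The Fock space `F_λ = ⨁_{i,j,l}` with charges
`λ_{a¹}/(k+1), 2 λ_{a²}/(k+1), λ_{b¹²}+i+j, λ_{b¹³}+j, λ_{b²³}+l, λ_c+i+j`, through its basis. -/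
def fockSpace (k : ℂ) (lam : Osc → ℂ) : Set FockState :=
  {x | ∃ i j l : ℤ,
    x.1 (.a 0) = lam (.a 0) / (k + 1) ∧ x.1 (.a 1) = 2 * lam (.a 1) / (k + 1) ∧
    x.1 .b12 = lam .b12 + i + j ∧ x.1 .b13 = lam .b13 + j ∧
    x.1 .b23 = lam .b23 + l ∧ x.1 .c = lam .c + i + j}

/-- Formal linear combinations `∑_{r,n} osc r n · r_n + ∑_r chg r · Q_r`, `n` running over all
integers. -/
@[ext] structure Lin where
  osc : Osc → ℤ → ℂ
  chg : Osc → ℂ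

instance : Add Lin := ⟨fun A B => ⟨A.osc + B.osc, A.chg + B.chg⟩⟩
instance : Neg Lin := ⟨fun A => ⟨-A.osc, -A.chg⟩⟩
instance : Sub Lin := ⟨fun A B => ⟨A.osc - B.osc, A.chg - B.chg⟩⟩

/-- `exp (∑_{r, n > 0} c (r, n) x_{r, n})` as a power series in the creation operators. -/
def creationExp (c : Osc × ℕ+ → ℂ) : MvPowerSeries (Osc × ℕ+) ℂ :=
  fun μ => μ.prod fun x m => c x ^ m / (m.factorial : ℂ)

/-- `exp (∑_{r, n > 0} L.osc r n · r_n)` acting on polynomials in the creation operators: as `r_n`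
acts by the constant-coefficient derivation `∑_s [r_n, s_{-n}] ∂/∂x_{s, n}`, its exponential is a
translation of the variables. -/
def annihilationExp (η k : ℂ) (L : Lin) :
    MvPolynomial (Osc × ℕ+) ℂ →ₐ[ℂ] MvPolynomial (Osc × ℕ+) ℂ :=
  MvPolynomial.aeval fun x : Osc × ℕ+ =>
    MvPolynomial.X x + MvPolynomial.C (∑ r, L.osc r (x.2 : ℤ) * comm η k (x.2 : ℤ) r x.1)

/-- The normal ordered exponential `:exp L:`, that is
`exp (creation part) exp (annihilation part) exp (∑ chg r · Q_r) exp (∑ osc r 0 · r_0)`. -/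
def vertex (η k : ℂ) (L : Lin) : FockOp :=
  open Classical in
  fun out inn =>
    if out.1 = inn.1 + L.chg then
      exp (∑ r, L.osc r 0 * zeroEig k inn.1 r) *
        MvPowerSeries.coeff out.2
          (creationExp (fun x => L.osc x.1 (-(x.2 : ℤ))) *
            (annihilationExp η k L (MvPolynomial.monomial inn.2 1) :
              MvPowerSeries (Osc × ℕ+) ℂ))
    else 0

/-- `r(z; κ) = -∑_{n ≠ 0} r_n / [n]_q · q^{-κ|n|} z^{-n} + Q_r + r_0 ln z`. -/
def fld (η : ℂ) (r : Osc) (κ ζ : ℂ) : Lin where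
  osc s n := if s = r then
      if n = 0 then ζ else -(qpow η (-κ * (|n| : ℤ)) * exp (-n * ζ) / qnum η n)
    else 0
  chg s := if s = r then 1 else 0

/-- `r_+(z) = (q - q⁻¹) ∑_{n > 0} r_n z^{-n} + r_0 ln q`. -/
def plus (η : ℂ) (r : Osc) (ζ : ℂ) : Lin where
  osc s n := if s = r then
      if n = 0 then η else if 0 < n then (qpow η 1 - qpow η (-1)) * exp (-n * ζ) else 0
    else 0
  chg _ := 0

/-- `r_-(z) = -(q - q⁻¹) ∑_{n > 0} r_{-n} z^{n} - r_0 ln q`. -/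
def minus (η : ℂ) (r : Osc) (ζ : ℂ) : Lin where
  osc s n := if s = r then
      if n = 0 then -η else if n < 0 then -((qpow η 1 - qpow η (-1)) * exp (-n * ζ)) else 0
    else 0
  chg _ := 0

/-- `a^{*,i}(z; κ)`, built from `a^{*,i}_n = [n]_q / [(k+1) n]_q · a^i_n` (with limit
`1 / (k+1)` of the factor at `n = 0`) and `Q_{a^{*,i}} = Q_{a^i} / (k+1)`. -/
def starFld (η k : ℂ) (i : Fin 2) (κ ζ : ℂ) : Lin where
  osc s n := (if n = 0 then 1 / (k + 1) else qnum η n / qnum η ((k + 1) * n)) *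
    (fld η (.a i) κ ζ).osc s n
  chg s := (fld η (.a i) κ ζ).chg s / (k + 1)

/-- `ε · √-1 π ∑_{r ∈ T} r_0`. Placed to the right of a normal ordered exponential, the exponential
of this is the same as adding it to the exponent. -/
def phase (ε : ℂ) (T : Finset Osc) : Lin where
  osc r n := if n = 0 ∧ r ∈ T then ε * (I * Real.pi) else 0
  chg _ := 0

/-- `1 / ((q - q⁻¹) z)`. -/
def diffFactor (η ζ : ℂ) : ℂ := 1 / ((qpow η 1 - qpow η (-1)) * exp ζ)

/-- The currents `X^{+,1}(z)`, `X^{+,2}(z)`. -/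
def XPlus (η k : ℂ) (i : Fin 2) (ζ : ℂ) : FockOp :=
  match i with
  | 0 => -diffFactor η ζ •
      (vertex η k (-fld η .b12 (-1) ζ - fld η .c 0 (ζ + η) + phase 1 {.c, .b12})
        - vertex η k (-fld η .b12 (-1) ζ - fld η .c 0 (ζ - η) + phase 1 {.c, .b12}))
  | 1 =>
      -vertex η k (-plus η .b12 (ζ + η) - plus η .b13 (ζ + η) + fld η .b23 0 (ζ + η)
          + phase 1 {.c, .b12, .b13, .b23})
        + vertex η k (fld η .b12 0 ζ + fld η .b13 0 ζ + fld η .c 0 ζ)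

/-- The currents `X^{-,1}(z)`, `X^{-,2}(z)`. -/
def XMinus (η k : ℂ) (i : Fin 2) (ζ : ℂ) : FockOp :=
  match i with
  | 0 => diffFactor η ζ •
        (vertex η k (plus η (.a 0) (ζ + (k + 1) / 2 * η) + fld η .b12 1 (ζ + (k + 2) * η)
            + plus η .b13 (ζ + (k + 2) * η) - plus η .b23 (ζ + (k + 1) * η)
            + fld η .c 0 (ζ + (k + 1) * η) + phase (-1) {.c, .b12})
          - vertex η k (minus η (.a 0) (ζ - (k + 1) / 2 * η) + fld η .b12 1 (ζ - (k + 2) * η)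
            + minus η .b13 (ζ - (k + 2) * η) - minus η .b23 (ζ - (k + 1) * η)
            + fld η .c 0 (ζ - (k + 1) * η) + phase (-1) {.c, .b12}))
      + qpow η (k + 1) •
        vertex η k (plus η (.a 0) (ζ + (k + 1) / 2 * η) - fld η .b13 0 (ζ + (k + 1) * η)
          + fld η .b23 (-1) (ζ + (k + 1) * η) + phase 1 {.b13, .b23})
  | 1 => diffFactor η ζ •
      (qpow η 1 •
          (vertex η k (plus η (.a 1) (ζ + (k + 1) / 2 * η) - fld η .b23 0 (ζ + (k + 1) * η)
              + phase (-1) {.c, .b12, .b13, .b23})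
            - vertex η k (minus η (.a 1) (ζ - (k + 1) / 2 * η) - fld η .b23 0 (ζ - (k + 1) * η)
              + phase (-1) {.c, .b12, .b13, .b23}))
        - (vertex η k (minus η (.a 1) (ζ - (k + 1) / 2 * η) - fld η .b12 1 (ζ - (k + 1) * η)
              - fld η .b13 1 (ζ - (k + 1) * η) - fld η .c 0 (ζ - k * η))
            - vertex η k (minus η (.a 1) (ζ - (k + 1) / 2 * η) - fld η .b12 1 (ζ - (k + 1) * η)
              - fld η .b13 1 (ζ - (k + 1) * η) - fld η .c 0 (ζ - (k + 2) * η))))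

/-- The mode `X_n` of a current `X(z) = ∑ X_n z^{-n-1}`, as the contour integral
`(2π√-1)⁻¹ ∮ z^n X(z) dz` over the unit circle. -/
def mode (X : ℂ → FockOp) (n : ℤ) : FockOp := fun out inn =>
  ∫ θ in (0 : ℝ)..1, exp ((n + 1) * (2 * Real.pi * I * θ)) * X (2 * Real.pi * I * θ) out inn

/-- The operator `∑_r L r · r_n`: for `n < 0` multiplication by creation operators, for `n > 0`
differentiation, for `n = 0` the eigenvalue on the charge. -/
def oscMode (η k : ℂ) (L : Osc → ℂ) (n : ℤ) : FockOp :=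
  open Classical in
  fun out inn =>
    if out.1 = inn.1 then
      match n with
      | .ofNat 0 => if out.2 = inn.2 then ∑ r, L r * zeroEig k inn.1 r else 0
      | .ofNat (m + 1) => MvPolynomial.coeff out.2 (∑ r, ∑ s, MvPolynomial.C
          (L r * comm η k (m + 1) r s) *
            MvPolynomial.pderiv (s, m.succPNat) (MvPolynomial.monomial inn.2 (1 : ℂ)))
      | .negSucc m => MvPolynomial.coeff out.2 (∑ r, MvPolynomial.C (L r) *
          (MvPolynomial.X (r, m.succPNat) * MvPolynomial.monomial inn.2 (1 : ℂ)))
    else 0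

/-- The coefficients of `h^i_n` in the oscillators `r_n`. -/
def hCoeff (η k : ℂ) (i : Fin 2) (n : ℤ) (r : Osc) : ℂ :=
  match i, r with
  | 0, .a 0 => qpow η (-((|n| : ℤ) / 2))
  | 0, .b12 => qpow η (-((k / 2 + 1) * (|n| : ℤ))) * (qpow η (|n| : ℤ) + qpow η (-(|n| : ℤ)))
  | 0, .b13 => qpow η (-((k / 2 + 2) * (|n| : ℤ)))
  | 0, .b23 => -qpow η (-((k / 2 + 1) * (|n| : ℤ)))
  | 1, .a 1 => qpow η (-((|n| : ℤ) / 2))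
  | 1, .b12 => -qpow η (-((k / 2 + 1) * (|n| : ℤ)))
  | 1, .b13 => -qpow η (-((k / 2 + 1) * (|n| : ℤ)))
  | _, _ => 0

/-- A diagonal operator depending on the charge. -/
def diagOp (f : (Osc → ℂ) → ℂ) : FockOp :=
  open Classical in fun out inn => if out = inn then f inn.1 else 0

/-- The Drinfeld generators: `X^{+,i}_n`, `X^{-,i}_n`, `h^i_n` (with `h^i_0` included),
`q^{h^i_0}`, `q^{-h^i_0}` and `c`. -/
inductive Gen
  | xPlus (i : Fin 2) (n : ℤ)
  | xMinus (i : Fin 2) (n : ℤ)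
  | h (i : Fin 2) (n : ℤ)
  | qh (i : Fin 2)
  | qhInv (i : Fin 2)
  | c

/-- The free boson realization of the Drinfeld generators at level `k`. -/
def Gen.op (η k : ℂ) : Gen → FockOp
  | .xPlus i n => mode (XPlus η k i) n
  | .xMinus i n => mode (XMinus η k i) n
  | .h i n => oscMode η k (hCoeff η k i n) n
  | .qh i => diagOp fun χ => qpow η (∑ r, hCoeff η k i 0 r * zeroEig k χ r)
  | .qhInv i => diagOp fun χ => qpow η (-∑ r, hCoeff η k i 0 r * zeroEig k χ r)
  | .c => diagOp fun _ => k

/-- The generators that are modes of the same current as the given one, indexed by the difference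
of the mode numbers. -/
def Gen.shift : Gen → ℤ → Gen
  | .xPlus i n, m => .xPlus i (n + m)
  | .xMinus i n, m => .xMinus i (n + m)
  | .h i n, m => .h i (n + m)
  | g, _ => g

/-- The sign `(-1)^{[Q^i][g]}`: `X^{±,2}_n` and the second screen current are odd, everything else
is even. -/
def sign (i : Fin 2) : Gen → ℂ
  | .xPlus j _ => if i = 1 ∧ j = 1 then -1 else 1
  | .xMinus j _ => if i = 1 ∧ j = 1 then -1 else 1
  | _ => 1

/-- The screen currents `S^1(z)`, `S^2(z)`. In the first one,
`₁∂_z e^{-c(q⁻¹z;0)} = (e^{-c(z;0)} - e^{-c(q⁻²z;0)}) / ((q - q⁻¹) z)`. -/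
def screen (η k : ℂ) (i : Fin 2) (ζ : ℂ) : FockOp :=
  match i with
  | 0 => diffFactor η ζ •
        (vertex η k (-starFld η k 0 ((k + 1) / 2) ζ - fld η .b12 0 ζ - minus η .b12 (ζ - η)
            - minus η .b13 (ζ - η) + minus η .b23 ζ - fld η .c 0 ζ + phase 1 {.c, .b12})
          - vertex η k (-starFld η k 0 ((k + 1) / 2) ζ - fld η .b12 0 ζ - minus η .b12 (ζ - η)
            - minus η .b13 (ζ - η) + minus η .b23 ζ - fld η .c 0 (ζ - 2 * η)
            + phase 1 {.c, .b12}))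
      + qpow η 1 •
        vertex η k (-starFld η k 0 ((k + 1) / 2) ζ + fld η .b13 0 ζ - fld η .b23 0 (ζ + η)
          + plus η .b23 ζ + phase (-1) {.b13, .b23})
  | 1 => -qpow η (-1) •
      vertex η k (-starFld η k 1 ((k + 1) / 2) ζ + fld η .b23 0 ζ
        + phase (-1) {.c, .b12, .b13, .b23})

/-- `I` is the Jackson integral `∫_0^{s∞} f(z) d_p z = s (1 - p) ∑_{m ∈ ℤ} f(s p^m) p^m`, the series
being convergent at both ends. Here `t`, `P` are logarithms of `s`, `p`, and `f` is given as a
function of a logarithm of `z`. -/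
def HasJacksonIntegral (P t : ℂ) (f : ℂ → ℂ) (J : ℂ) : Prop :=
  Tendsto (fun N : ℕ × ℕ => exp t * (1 - exp P) *
    ∑ m ∈ Finset.Ico (-(N.1 : ℤ)) (N.2 : ℤ), f (t + m * P) * exp (m * P)) atTop (𝓝 J)

/-- The terms of `⟨u| A B |v⟩`, written as a sum over initial, intermediate and final states. -/
def elemTerm (u : FockState → ℂ) (A B : FockOp) (v : FockState → ℂ) :
    FockState × FockState × FockState → ℂ :=
  fun x => u x.1 * A x.1 x.2.1 * B x.2.1 x.2.2 * v x.2.2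

/-- `⟨u| A Q^i |v⟩ = J`, where `Q^i = ∫_0^{s∞} S^i(z) d_p z` with `p = q^{2(k+1)}`: the matrix
elements `⟨u| A S^i(z) |v⟩` at the points `z = s p^m` converge absolutely, and their Jackson
integral converges to `J`. -/
def HasOpCharge (η k t : ℂ) (i : Fin 2) (u : FockState → ℂ) (A : FockOp) (v : FockState → ℂ)
    (J : ℂ) : Prop :=
  (∀ m : ℤ, Summable (elemTerm u A (screen η k i (t + m * (2 * (k + 1) * η))) v)) ∧
    HasJacksonIntegral (2 * (k + 1) * η) t (fun ζ => ∑' x, elemTerm u A (screen η k i ζ) v x) J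

/-- `⟨u| Q^i A |v⟩ = J`, in the same sense. -/
def HasChargeOp (η k t : ℂ) (i : Fin 2) (u : FockState → ℂ) (A : FockOp) (v : FockState → ℂ)
    (J : ℂ) : Prop :=
  (∀ m : ℤ, Summable (elemTerm u (screen η k i (t + m * (2 * (k + 1) * η))) A v)) ∧
    HasJacksonIntegral (2 * (k + 1) * η) t (fun ζ => ∑' x, elemTerm u (screen η k i ζ) A v x) J

end SL21

end

/-!
The proof reduces the commutation of the screen charges to operator products of vertex operators
and a telescoping sum.

All currents are combinations of vertex operators, given by their exponents (`Lin`). In terms of the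
power series in the creation operators, the annihilation part of a vertex operator is a translation
and the creation part is a multiplication by an exponential. Moving a translation past an
exponential of creation operators produces a scalar contraction factor, characterized as the
solution of `x g' = A g` (`IsExp`); this is Wick's theorem, `sum_levelSet_matElem_mul`. In the
representation at hand each contraction factor is a rational function of `x = z / w` with at most
two poles, and the two orderings of a product are its expansions at `x = 0` and at `x = ∞`
(`HasOPE`). The difference of the expansions is a sum of delta functions, so that the
(anti-)commutator of a mode of one vertex operator with another vertex operator is a combination of
vertex operators with fused exponents, one for each pole (`matElem_commutator`,
`HasOPE.commutator`).

Multiplying a field by `r_±` moves its annihilation or creation part (`fld_add_plus`,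
`fld_add_minus`), whence fused exponents of different pairs of terms coincide, and almost all
residues cancel. Only the commutators of `X^{-,i}_n` with `S^i(z)` survive. They are total
differences `(Ψ (q^{-(k+1)} z) - Ψ (q^{k+1} z)) / ((q - q⁻¹) z)`, where `Ψ` is `z ^ n` times the
vertex operator of `-a^{*,i}(z; -(k+1)/2)` (`hasComm_op`). The Cartan generators commute with the
screen currents, because their contractions with the exponents of the latter vanish
(`CartanInvariant`).

Since `p = q^{2(k+1)}`, the Jackson integral of the total difference telescopes to the difference of
the boundary values of `⟨u|Ψ|v⟩` at `0` and `∞` along the lattice `s p^m`. These vanish: for the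
mode `n + 1` the values are those for the mode `n` times `z`, and for all modes they stay bounded,
by the convergence of the Jackson integrals (`tendsto_sub_zero`). That the matrix elements of `Ψ`
converge at all follows in the same way from two consecutive modes (`summable_defectTerm`).
-/

noncomputable section

namespace SL21

/-! ### Occupation numbers and their level -/

/-- Index set of the creation operators. -/
abbrev CrIdx : Type := Osc × ℕ+

/-- The level `∑ n ν(r, n)` of an occupation number. -/
def level : Occ →+ ℕ := Finsupp.weight fun x : CrIdx => (x.2 : ℕ)

lemma level_single (x : CrIdx) (m : ℕ) : level (Finsupp.single x m) = m * x.2 := by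
  simp [level, Finsupp.weight_single]

lemma level_eq_sum (ν : Occ) : level ν = ∑ x ∈ ν.support, ν x * (x.2 : ℕ) := by
  simp [level, Finsupp.weight_apply, Finsupp.sum]

lemma level_mono {μ ν : Occ} (h : μ ≤ ν) : level μ ≤ level ν := by
  obtain ⟨ρ, rfl⟩ := exists_add_of_le h
  simp

lemma finite_level_eq (N : ℕ) : {ν : Occ | level ν = N}.Finite := by
  classical
  -- An occupation number of level `N` has modes at most `N`, with multiplicities at most `N`.
  let B : Occ := ∑ x ∈ (Finset.univ : Finset Osc) ×ˢ ((Finset.Icc 1 (N + 1)).image Nat.toPNat'),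
    Finsupp.single x N
  refine (Set.finite_Iic B).subset fun ν hν x => ?_
  have hν : level ν = N := hν
  by_cases hx : ν x = 0
  · simp [hx]
  have h1 : (x.2 : ℕ) ≤ N := hν ▸ Finsupp.le_weight_of_ne_zero' (fun x : CrIdx => (x.2 : ℕ)) hx
  have h2 : ν x ≤ N := hν ▸ Finsupp.le_weight (fun x : CrIdx => (x.2 : ℕ)) x.2.pos.ne' ν
  have hmem : x ∈ (Finset.univ : Finset Osc) ×ˢ
      ((Finset.Icc 1 (N + 1)).image Nat.toPNat') := by
    simp only [Finset.mem_product, Finset.mem_univ, true_and, Finset.mem_image, Finset.mem_Icc]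
    exact ⟨x.2, ⟨x.2.pos, by omega⟩, by simp⟩
  have : B x = N := by
    simp only [B, Finsupp.finsetSum_apply]
    rw [Finset.sum_eq_single x (fun y _ hy => by simp [hy]) (fun h => absurd hmem h)]
    simp
  omega

/-- The occupation numbers of level `N`. -/
def levelSet (N : ℕ) : Finset Occ := (finite_level_eq N).toFinset

@[simp] lemma mem_levelSet {N : ℕ} {ν : Occ} : ν ∈ levelSet N ↔ level ν = N := by
  simp [levelSet]

/-! ### Exponentials as solutions of a differential equation -/

/-- `F` is the exponential of the power series `∑ A_n x^n / n`: it solves `x F' = A F` and has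
constant term `1`. -/
structure IsExp {R : Type*} [CommRing R] (A F : PowerSeries R) : Prop where
  deriv : PowerSeries.X * PowerSeries.derivative R F = A * F
  const : PowerSeries.constantCoeff F = 1

lemma coeff_X_mul_derivative {R : Type*} [CommRing R] (F : PowerSeries R) (n : ℕ) :
    PowerSeries.coeff n (PowerSeries.X * PowerSeries.derivative R F) =
      n * PowerSeries.coeff n F := by
  cases n with
  | zero => simp
  | succ n => rw [PowerSeries.coeff_succ_X_mul, PowerSeries.coeff_derivative]; push_cast; ring

lemma IsExp.unique {R : Type*} [CommRing R] [IsDomain R] [CharZero R] {A F G : PowerSeries R}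
    (hF : IsExp A F) (hG : IsExp A G) (hA : PowerSeries.constantCoeff A = 0) : F = G := by
  ext n
  induction n using Nat.strong_induction_on with
  | _ n ih =>
    rcases Nat.eq_zero_or_pos n with rfl | hn
    · simpa using hF.const.trans hG.const.symm
    have h1 := congrArg (PowerSeries.coeff n) hF.deriv
    have h2 := congrArg (PowerSeries.coeff n) hG.deriv
    rw [coeff_X_mul_derivative, PowerSeries.coeff_mul] at h1 h2
    have hn0 : (n : R) ≠ 0 := Nat.cast_ne_zero.2 hn.ne'
    refine mul_left_cancel₀ hn0 (h1.trans (Eq.trans ?_ h2.symm))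
    refine Finset.sum_congr rfl fun p hp => ?_
    rw [Finset.HasAntidiagonal.mem_antidiagonal] at hp
    by_cases h0 : p.1 = 0
    · simp [h0, hA]
    · rw [ih p.2 (by omega)]

lemma IsExp.mul {R : Type*} [CommRing R] {A B F G : PowerSeries R}
    (hF : IsExp A F) (hG : IsExp B G) : IsExp (A + B) (F * G) where
  deriv := by
    rw [Derivation.leibniz]
    simp only [smul_eq_mul]
    linear_combination G * hF.deriv + F * hG.deriv
  const := by simp [hF.const, hG.const]

lemma IsExp.map {R S : Type*} [CommRing R] [CommRing S] (φ : R →+* S) {A F : PowerSeries R}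
    (hF : IsExp A F) : IsExp (PowerSeries.map φ A) (PowerSeries.map φ F) where
  deriv := by
    rw [← map_mul, ← hF.deriv]
    ext n
    rw [PowerSeries.coeff_map, coeff_X_mul_derivative, coeff_X_mul_derivative]
    simp
  const := by
    have := congrArg φ hF.const
    rw [← PowerSeries.coeff_zero_eq_constantCoeff_apply] at this ⊢
    simpa using this

/-! ### Grading by the level -/

/-- A power series in the creation operators, with its part of level `N` as coefficient of `x ^ N`;
this part is a polynomial, since there are finitely many occupation numbers of level `N`. -/
def graded (f : MvPowerSeries CrIdx ℂ) : PowerSeries (MvPolynomial CrIdx ℂ) :=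
  PowerSeries.mk fun N => ∑ ν ∈ levelSet N, MvPolynomial.monomial ν (MvPowerSeries.coeff ν f)

lemma coeff_coeff_graded (f : MvPowerSeries CrIdx ℂ) (N : ℕ) (ν : Occ) :
    MvPolynomial.coeff ν (PowerSeries.coeff N (graded f)) =
      if level ν = N then MvPowerSeries.coeff ν f else 0 := by
  classical
  simp only [graded, PowerSeries.coeff_mk, MvPolynomial.coeff_sum, MvPolynomial.coeff_monomial]
  simp [Finset.sum_ite_eq']

lemma graded_mul (f g : MvPowerSeries CrIdx ℂ) : graded (f * g) = graded f * graded g := by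
  classical
  ext N ν
  rw [coeff_coeff_graded, PowerSeries.coeff_mul, MvPolynomial.coeff_sum]
  simp only [MvPolynomial.coeff_mul, coeff_coeff_graded]
  rw [Finset.sum_comm, MvPowerSeries.coeff_mul]
  split_ifs with h
  · refine Finset.sum_congr rfl fun p hp => ?_
    rw [Finset.HasAntidiagonal.mem_antidiagonal] at hp
    rw [Finset.sum_eq_single (level p.1, level p.2)]
    · simp
    · rintro ⟨i, j⟩ _ hij
      simp only [ne_eq, Prod.mk.injEq, not_and_or] at hij
      rcases hij with h | h <;> simp [Ne.symm h]
    · intro hn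
      exact absurd (by rw [Finset.HasAntidiagonal.mem_antidiagonal, ← map_add, hp, h]) hn
  · symm
    refine Finset.sum_eq_zero fun p hp => Finset.sum_eq_zero fun q hq => ?_
    rw [Finset.HasAntidiagonal.mem_antidiagonal] at hp hq
    have : level p.1 + level p.2 = level ν := by rw [← map_add, hp]
    split_ifs <;> simp_all

lemma graded_C (b : ℂ) :
    graded (MvPowerSeries.C b) = PowerSeries.C (MvPolynomial.C b) := by
  classical
  ext N ν
  rw [coeff_coeff_graded, PowerSeries.coeff_C, MvPowerSeries.coeff_C]
  by_cases hν : ν = 0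
  · subst hν
    by_cases hN : N = 0
    · simp [hN]
    · simp [hN, Ne.symm hN]
  · by_cases hN : N = 0 <;> simp [hN, hν, MvPolynomial.coeff_C, Ne.symm hν]

lemma graded_X (x : CrIdx) :
    graded (MvPowerSeries.X x) = PowerSeries.monomial (x.2 : ℕ) (MvPolynomial.X x) := by
  classical
  ext N ν
  rw [coeff_coeff_graded, PowerSeries.coeff_monomial, MvPowerSeries.coeff_X]
  by_cases hν : ν = Finsupp.single x 1
  · subst hν
    by_cases hN : N = x.2
    · simp [hN, level_single]
    · simp [hN, level_single, Ne.symm hN]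
  · by_cases hN : N = x.2 <;> simp [hN, hν, MvPolynomial.coeff_X, Ne.symm hν]

lemma graded_add (f g : MvPowerSeries CrIdx ℂ) : graded (f + g) = graded f + graded g := by
  ext N ν
  simp only [map_add, MvPolynomial.coeff_add, coeff_coeff_graded]
  split_ifs <;> simp

/-- `graded` as a ring homomorphism. -/
def gradedHom : MvPowerSeries CrIdx ℂ →+* PowerSeries (MvPolynomial CrIdx ℂ) where
  toFun := graded
  map_one' := by simpa using graded_C 1
  map_mul' := graded_mul
  map_zero' := by simpa using graded_C 0
  map_add' := graded_add

lemma gradedHom_apply (f : MvPowerSeries CrIdx ℂ) : gradedHom f = graded f := rfl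

lemma gradedHom_injective : Function.Injective gradedHom := by
  intro f g h
  ext ν
  have := congrArg (fun F => MvPolynomial.coeff ν (PowerSeries.coeff (level ν) F)) h
  simpa [gradedHom_apply, coeff_coeff_graded] using this

/-! ### Exponentials of creation operators -/

lemma coeff_creationExp (c : CrIdx → ℂ) (ν : Occ) :
    MvPowerSeries.coeff ν (creationExp c) = ν.prod fun x m => c x ^ m / (m.factorial : ℂ) := rfl

lemma creationExp_zero_coeff (c : CrIdx → ℂ) : MvPowerSeries.coeff 0 (creationExp c) = 1 := by
  simp [coeff_creationExp]

/-- The equation `∂_x E = c x · E` for the exponential `E` of `∑ c x · x`, in coefficients. -/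
lemma pderiv_creationExp (c : CrIdx → ℂ) (x : CrIdx) (ν : Occ) :
    (ν x + 1) * MvPowerSeries.coeff (ν + Finsupp.single x 1) (creationExp c) =
      c x * MvPowerSeries.coeff ν (creationExp c) := by
  classical
  rw [coeff_creationExp, coeff_creationExp]
  rw [← Finsupp.mul_prod_erase' ν x _ (fun _ => by simp),
    ← Finsupp.mul_prod_erase' (ν + Finsupp.single x 1) x _ (fun _ => by simp)]
  have : (ν + Finsupp.single x 1).erase x = ν.erase x := by
    ext y
    by_cases hy : y = x
    · subst hy; simp
    · simp [hy, Finsupp.erase_ne]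
  rw [this]
  simp only [Finsupp.coe_add, Pi.add_apply, Finsupp.single_eq_same, Nat.factorial_succ]
  have h1 : ((ν x).factorial : ℂ) ≠ 0 := Nat.cast_ne_zero.2 (Nat.factorial_ne_zero _)
  have h2 : ((ν x : ℂ) + 1) ≠ 0 := by exact_mod_cast Nat.succ_ne_zero (ν x)
  push_cast
  field_simp
  ring

/-- The logarithmic derivative `∑ n c(r, n) x^n y_{r, n}` of the graded exponential of the creation
operators `c`. -/
def creationLog (c : CrIdx → ℂ) : PowerSeries (MvPolynomial CrIdx ℂ) :=
  PowerSeries.mk fun N => if h : 0 < N then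
    ∑ r : Osc, MvPolynomial.C (N * c (r, ⟨N, h⟩)) * MvPolynomial.X (r, ⟨N, h⟩) else 0

lemma creationLog_add (c c' : CrIdx → ℂ) :
    creationLog (c + c') = creationLog c + creationLog c' := by
  ext1 N
  simp only [creationLog, PowerSeries.coeff_mk, map_add]
  split_ifs
  · rw [← Finset.sum_add_distrib]
    refine Finset.sum_congr rfl fun r _ => ?_
    rw [Pi.add_apply, mul_add, map_add, add_mul]
  · simp

lemma creationLog_const (c : CrIdx → ℂ) : PowerSeries.constantCoeff (creationLog c) = 0 := by
  simp [creationLog, ← PowerSeries.coeff_zero_eq_constantCoeff_apply]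

lemma level_eq_zero {ν : Occ} : level ν = 0 ↔ ν = 0 := by
  constructor
  · intro h
    ext x
    have := Finsupp.le_weight (fun x : CrIdx => (x.2 : ℕ)) x.2.pos.ne' ν
    have h' : Finsupp.weight (fun x : CrIdx => (x.2 : ℕ)) ν = 0 := h
    simpa [h'] using this
  · rintro rfl; simp

/-- The level as a sum over the mode numbers, in the range of the sums over products of power
series. -/
lemma sum_eq_level (ν : Occ) (N : ℕ) (h : level ν ≤ N) :
    level ν = ∑ i ∈ Finset.range (N + 1),
      if h : 0 < i then ∑ r : Osc, i * ν (r, ⟨i, h⟩) else 0 := by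
  classical
  induction ν using Finsupp.induction_linear with
  | zero => simp
  | add f g hf hg =>
    rw [map_add] at h ⊢
    rw [hf (by omega), hg (by omega), ← Finset.sum_add_distrib]
    refine Finset.sum_congr rfl fun i _ => ?_
    split_ifs
    · simp [mul_add, Finset.sum_add_distrib]
    · rfl
  | single x m =>
    rw [level_single] at h ⊢
    rcases Nat.eq_zero_or_pos m with rfl | hm
    · simp
    have hx : (x.2 : ℕ) ≤ N := (Nat.le_mul_of_pos_left _ hm).trans h
    rw [Finset.sum_eq_single (x.2 : ℕ)]
    · rw [dif_pos x.2.pos, Finset.sum_eq_single x.1]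
      · have : Finsupp.single x m (x.1, ⟨x.2, x.2.pos⟩) = m := Finsupp.single_eq_same
        rw [this, mul_comm]
      · intro r _ hr
        rw [Finsupp.single_eq_of_ne (by intro h; exact hr (by rw [← h])), mul_zero]
      · simp
    · intro i _ hi
      split_ifs with h0
      · refine Finset.sum_eq_zero fun r _ => ?_
        rw [Finsupp.single_eq_of_ne (by intro h; exact hi (by rw [← h]; rfl)), mul_zero]
      · rfl
    · intro h
      exact absurd (Finset.mem_range.2 (by omega)) h

lemma isExp_graded_creationExp (c : CrIdx → ℂ) :
    IsExp (creationLog c) (graded (creationExp c)) where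
  const := by
    classical
    rw [← PowerSeries.coeff_zero_eq_constantCoeff_apply]
    ext ν
    rw [coeff_coeff_graded, MvPolynomial.coeff_one]
    by_cases h : ν = 0
    · subst h; simp [creationExp_zero_coeff]
    · rw [if_neg, if_neg (Ne.symm h)]
      exact fun h' => h (level_eq_zero.1 h')
  deriv := by
    classical
    ext N ν
    have key : ∀ (i : ℕ) (hi : 0 < i) (r : Osc) (j : ℕ), i + j = N →
        MvPolynomial.coeff ν (MvPolynomial.C ((i : ℂ) * c (r, ⟨i, hi⟩)) *
          MvPolynomial.X (r, ⟨i, hi⟩) * PowerSeries.coeff j (graded (creationExp c))) =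
        if level ν = N then (i * ν (r, ⟨i, hi⟩) : ℕ) * MvPowerSeries.coeff ν (creationExp c)
          else 0 := by
      intro i hi r j hij
      rw [mul_assoc, MvPolynomial.coeff_C_mul, MvPolynomial.coeff_X_mul', coeff_coeff_graded]
      by_cases h0 : ν (r, ⟨i, hi⟩) = 0
      · simp [h0]
      · obtain ⟨μ, rfl⟩ : ∃ μ, ν = μ + Finsupp.single (r, ⟨i, hi⟩) 1 :=
          ⟨ν - Finsupp.single (r, ⟨i, hi⟩) 1, (Finsupp.sub_add_single_one_cancel h0).symm⟩
        rw [if_pos (Finsupp.mem_support_iff.2 h0), add_tsub_cancel_right]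
        have hl : level (μ + Finsupp.single (r, ⟨i, hi⟩) 1) = level μ + i := by
          rw [map_add, level_single]; simp
        rw [hl]
        by_cases hj : level μ = j
        · rw [if_pos hj, if_pos (by omega), mul_assoc, ← pderiv_creationExp]
          simp
          ring
        · rw [if_neg hj, if_neg (by omega), mul_zero]
    rw [coeff_X_mul_derivative, PowerSeries.coeff_mul, MvPolynomial.coeff_sum,
      ← map_natCast (MvPolynomial.C (σ := CrIdx) (R := ℂ)), MvPolynomial.coeff_C_mul,
      coeff_coeff_graded]
    have : ∀ p ∈ Finset.HasAntidiagonal.antidiagonal N,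
        MvPolynomial.coeff ν (PowerSeries.coeff p.1 (creationLog c) *
          PowerSeries.coeff p.2 (graded (creationExp c))) =
        if level ν = N then ((if h : 0 < p.1 then ∑ r, p.1 * ν (r, ⟨p.1, h⟩) else 0 : ℕ) : ℂ) *
          MvPowerSeries.coeff ν (creationExp c) else 0 := by
      rintro ⟨i, j⟩ hp
      rw [Finset.HasAntidiagonal.mem_antidiagonal] at hp
      dsimp only at hp ⊢
      rw [creationLog, PowerSeries.coeff_mk]
      split_ifs with hi hl
      · rw [Finset.sum_mul, MvPolynomial.coeff_sum, Nat.cast_sum, Finset.sum_mul]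
        exact Finset.sum_congr rfl fun r _ => by rw [key i hi r j hp, if_pos hl]
      · rw [Finset.sum_mul, MvPolynomial.coeff_sum]
        exact Finset.sum_eq_zero fun r _ => by rw [key i hi r j hp, if_neg hl]
      · simp
      · simp
    rw [Finset.sum_congr rfl this]
    split_ifs with hl
    · rw [← Finset.sum_mul, ← Nat.cast_sum]
      congr 2
      rw [Finset.Nat.sum_antidiagonal_eq_sum_range_succ_mk]
      exact hl.symm.trans (sum_eq_level ν N hl.le)
    · simp

lemma creationExp_add (c c' : CrIdx → ℂ) :
    creationExp (c + c') = creationExp c * creationExp c' := by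
  apply gradedHom_injective
  rw [map_mul]
  refine (isExp_graded_creationExp _).unique ?_ (creationLog_const _)
  rw [creationLog_add]
  exact (isExp_graded_creationExp c).mul (isExp_graded_creationExp c')

/-! ### Products of matrix elements -/

/-- The coefficient at `out` of `exp (∑ c x) ∏ (x + β) ^ inn`: the matrix element of
`exp (creation part c) · (translation by β)` between occupation numbers. -/
def matElem (c β : CrIdx → ℂ) (out inn : Occ) : ℂ :=
  MvPowerSeries.coeff out (creationExp c *
    (inn.prod fun x m => (MvPolynomial.X x + MvPolynomial.C (β x)) ^ m : MvPolynomial CrIdx ℂ))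

/-- The translation `x ↦ x + β` of the creation operators. -/
def translate (β : CrIdx → ℂ) : MvPolynomial CrIdx ℂ →ₐ[ℂ] MvPolynomial CrIdx ℂ :=
  MvPolynomial.aeval fun x => MvPolynomial.X x + MvPolynomial.C (β x)

lemma translate_monomial (β : CrIdx → ℂ) (inn : Occ) :
    translate β (MvPolynomial.monomial inn 1) =
      inn.prod fun x m => (MvPolynomial.X x + MvPolynomial.C (β x)) ^ m := by
  rw [translate, MvPolynomial.aeval_monomial, map_one, one_mul]

lemma matElem_eq_translate (c β : CrIdx → ℂ) (out inn : Occ) :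
    matElem c β out inn = MvPowerSeries.coeff out
      (creationExp c * (translate β (MvPolynomial.monomial inn 1) : MvPowerSeries CrIdx ℂ)) := by
  rw [matElem, translate_monomial]

/-- The linear functional `p ↦ coeff out (exp (∑ c x) p)`. -/
def outFunctional (c : CrIdx → ℂ) (out : Occ) : MvPolynomial CrIdx ℂ →ₗ[ℂ] ℂ where
  toFun p := MvPowerSeries.coeff out (creationExp c * (p : MvPowerSeries CrIdx ℂ))
  map_add' p q := by simp [mul_add]
  map_smul' a p := by simp [MvPolynomial.smul_eq_C_mul, mul_left_comm _ (MvPowerSeries.C a)]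

lemma outFunctional_apply (c : CrIdx → ℂ) (out : Occ) (p : MvPolynomial CrIdx ℂ) :
    outFunctional c out p = MvPowerSeries.coeff out (creationExp c * (p : MvPowerSeries CrIdx ℂ)) :=
  rfl

/-- `∏ (t ^ n (x + β) + β') ^ inn` as a polynomial in `t`, where `n` is the mode number of `x`: two
successive translations of a monomial, the second one scaled by the level. -/
def scaledState (β β' : CrIdx → ℂ) (inn : Occ) : Polynomial (MvPolynomial CrIdx ℂ) :=
  inn.prod fun x m => (Polynomial.monomial (x.2 : ℕ) (MvPolynomial.X x + MvPolynomial.C (β x)) +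
    Polynomial.C (MvPolynomial.C (β' x))) ^ m

/-- The part of level at most `B` of `exp (∑ t ^ n c x · x)`, as a polynomial in `t`. -/
def truncExp (c : CrIdx → ℂ) (B : ℕ) : Polynomial (MvPolynomial CrIdx ℂ) :=
  ∑ i ∈ Finset.range (B + 1), Polynomial.monomial i (PowerSeries.coeff i (graded (creationExp c)))

/-- The matrix element of the normal ordered product of two exponentials, as a polynomial in the
ratio `t` of their arguments. The second exponential is truncated at the level of `out`, which does
not change this matrix element and makes it a polynomial. -/
def normalOrdered (c β c' β' : CrIdx → ℂ) (out inn : Occ) : Polynomial ℂ :=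
  ∑ j ∈ Finset.range (level out + level inn + 1), Polynomial.monomial j
    (outFunctional c out ((truncExp c' (level out) * scaledState β β' inn).coeff j))

lemma natDegree_truncExp (c : CrIdx → ℂ) (B : ℕ) : (truncExp c B).natDegree ≤ B := by
  refine Polynomial.natDegree_sum_le_of_forall_le _ _ fun i hi => ?_
  exact (Polynomial.natDegree_monomial_le _).trans (by simpa [Nat.lt_succ_iff] using hi)

lemma natDegree_scaledState (β β' : CrIdx → ℂ) (inn : Occ) :
    (scaledState β β' inn).natDegree ≤ level inn := by
  rw [level_eq_sum, scaledState, Finsupp.prod]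
  refine (Polynomial.natDegree_prod_le _ _).trans (Finset.sum_le_sum fun x _ => ?_)
  refine Polynomial.natDegree_pow_le.trans (Nat.mul_le_mul_left _ ?_)
  refine (Polynomial.natDegree_add_le _ _).trans (max_le (Polynomial.natDegree_monomial_le _) ?_)
  simp

lemma coeff_truncExp (c : CrIdx → ℂ) (B i : ℕ) :
    (truncExp c B).coeff i =
      if i ≤ B then PowerSeries.coeff i (graded (creationExp c)) else 0 := by
  simp [truncExp, Polynomial.finsetSum_coeff, Polynomial.coeff_monomial]

lemma coeff_mul_congr (f g g' : MvPowerSeries CrIdx ℂ) (out : Occ)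
    (h : ∀ μ ≤ out, MvPowerSeries.coeff μ g = MvPowerSeries.coeff μ g') :
    MvPowerSeries.coeff out (f * g) = MvPowerSeries.coeff out (f * g') := by
  classical
  rw [MvPowerSeries.coeff_mul, MvPowerSeries.coeff_mul]
  refine Finset.sum_congr rfl fun p hp => ?_
  rw [Finset.HasAntidiagonal.mem_antidiagonal] at hp
  rw [h p.2 (hp ▸ le_add_self)]

lemma coeff_normalOrdered (c β c' β' : CrIdx → ℂ) (out inn : Occ) (j : ℕ) :
    (normalOrdered c β c' β' out inn).coeff j =
      outFunctional c out (PowerSeries.coeff j (graded (creationExp c') *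
        (scaledState β β' inn : PowerSeries (MvPolynomial CrIdx ℂ)))) := by
  have h1 : (normalOrdered c β c' β' out inn).coeff j =
      outFunctional c out ((truncExp c' (level out) * scaledState β β' inn).coeff j) := by
    simp only [normalOrdered, Polynomial.finsetSum_coeff, Polynomial.coeff_monomial]
    rw [Finset.sum_ite_eq' (Finset.range _) j]
    split_ifs with h
    · rfl
    · rw [Polynomial.coeff_eq_zero_of_natDegree_lt, map_zero]
      refine lt_of_le_of_lt (Polynomial.natDegree_mul_le) ?_
      have := natDegree_truncExp c' (level out)
      have := natDegree_scaledState β β' inn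
      rw [Finset.mem_range] at h
      omega
  rw [h1, Polynomial.coeff_mul, PowerSeries.coeff_mul, map_sum, map_sum]
  refine Finset.sum_congr rfl fun p _ => ?_
  rw [coeff_truncExp, Polynomial.coeff_coe]
  split_ifs with h
  · rfl
  rw [zero_mul, map_zero, outFunctional_apply, MvPolynomial.coe_mul, ← mul_assoc,
    mul_comm (creationExp c), mul_assoc, mul_comm, coeff_mul_congr _ _ 0]
  · simp
  · intro μ hμ
    rw [MvPolynomial.coeff_coe, coeff_coeff_graded, if_neg, map_zero]
    have := level_mono hμ
    omega

lemma coeff_eval_truncExp (c : CrIdx → ℂ) (B : ℕ) (b : ℂ) (μ : Occ) (h : level μ ≤ B) :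
    MvPolynomial.coeff μ ((truncExp c B).eval (MvPolynomial.C b)) =
      MvPowerSeries.coeff μ (creationExp fun x => b ^ (x.2 : ℕ) * c x) := by
  simp only [truncExp, Polynomial.eval_finsetSum, Polynomial.eval_monomial, MvPolynomial.coeff_sum]
  simp only [← map_pow, mul_comm _ (MvPolynomial.C _), MvPolynomial.coeff_C_mul,
    coeff_coeff_graded, mul_ite, mul_zero]
  rw [Finset.sum_ite_eq (Finset.range _), if_pos (Finset.mem_range.2 (by omega)),
    coeff_creationExp, coeff_creationExp, level_eq_sum, ← Finset.prod_pow_eq_pow_sum, Finsupp.prod,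
    Finsupp.prod, ← Finset.prod_mul_distrib]
  refine Finset.prod_congr rfl fun x _ => ?_
  rw [mul_pow, ← pow_mul, mul_comm (x.2 : ℕ)]
  ring

lemma coeff_rescale_level (f : MvPowerSeries CrIdx ℂ) (b : ℂ) (ν : Occ) :
    MvPowerSeries.coeff ν (MvPowerSeries.rescale (fun x => b ^ (x.2 : ℕ)) f) =
      b ^ level ν * MvPowerSeries.coeff ν f := by
  rw [MvPowerSeries.coeff_rescale, level_eq_sum, ← Finset.prod_pow_eq_pow_sum, Finsupp.prod]
  congr 1
  exact Finset.prod_congr rfl fun x _ => by rw [← pow_mul, mul_comm]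

lemma rescale_creationExp (c : CrIdx → ℂ) (b : ℂ) :
    MvPowerSeries.rescale (fun x : CrIdx => b ^ (x.2 : ℕ)) (creationExp c) =
      creationExp fun x => b ^ (x.2 : ℕ) * c x := by
  ext ν
  rw [MvPowerSeries.coeff_rescale, coeff_creationExp, coeff_creationExp, Finsupp.prod,
    Finsupp.prod, Finsupp.prod, ← Finset.prod_mul_distrib]
  refine Finset.prod_congr rfl fun x _ => ?_
  rw [mul_pow]
  ring

lemma rescale_X (a : CrIdx → ℂ) (x : CrIdx) :
    MvPowerSeries.rescale a (MvPowerSeries.X x) = MvPowerSeries.C (a x) * MvPowerSeries.X x := by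
  classical
  ext ν
  rw [MvPowerSeries.coeff_rescale, MvPowerSeries.coeff_C_mul, MvPowerSeries.coeff_X]
  split_ifs with h
  · subst h; simp
  · simp

lemma rescale_C (a : CrIdx → ℂ) (b : ℂ) :
    MvPowerSeries.rescale a (MvPowerSeries.C b) = MvPowerSeries.C b := by
  classical
  ext ν
  rw [MvPowerSeries.coeff_rescale, MvPowerSeries.coeff_C]
  split_ifs with h
  · subst h; simp
  · simp

/-- The value of the normal ordered product at `t = b`. -/
lemma eval_normalOrdered (c β c' β' : CrIdx → ℂ) (out inn : Occ) {b : ℂ} (hb : b ≠ 0) :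
    (normalOrdered c β c' β' out inn).eval b = b ^ level out *
      matElem (fun x => b⁻¹ ^ (x.2 : ℕ) * c x + c' x) (fun x => b ^ (x.2 : ℕ) * β x + β' x)
        out inn := by
  have h1 : (normalOrdered c β c' β' out inn).eval b = outFunctional c out
      ((truncExp c' (level out) * scaledState β β' inn).eval (MvPolynomial.C b)) := by
    rw [Polynomial.eval_eq_sum_range' (n := level out + level inn + 1)
      (p := truncExp c' (level out) * scaledState β β' inn), map_sum]
    · simp only [normalOrdered, Polynomial.eval_finsetSum, Polynomial.eval_monomial]
      refine Finset.sum_congr rfl fun j _ => ?_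
      rw [← map_pow, mul_comm _ (MvPolynomial.C _), ← MvPolynomial.smul_eq_C_mul, map_smul,
        smul_eq_mul, mul_comm]
    · refine lt_of_le_of_lt (Polynomial.natDegree_mul_le) ?_
      have := natDegree_truncExp c' (level out)
      have := natDegree_scaledState β β' inn
      omega
  rw [h1, Polynomial.eval_mul, outFunctional_apply, matElem, ← coeff_rescale_level,
    map_mul (MvPowerSeries.rescale _),
    rescale_creationExp, MvPolynomial.coe_mul]
  have h2 : (fun x : CrIdx => b ^ (x.2 : ℕ) * (b⁻¹ ^ (x.2 : ℕ) * c x + c' x)) =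
      c + fun x => b ^ (x.2 : ℕ) * c' x := by
    ext x
    rw [mul_add, ← mul_assoc, ← mul_pow, mul_inv_cancel₀ hb, one_pow, one_mul, Pi.add_apply]
  rw [h2, creationExp_add, mul_comm _ ((Polynomial.eval _ (scaledState β β' inn) :
    MvPolynomial CrIdx ℂ) : MvPowerSeries CrIdx ℂ), ← mul_assoc,
    coeff_mul_congr _ _ (creationExp fun x => b ^ (x.2 : ℕ) * c' x), mul_right_comm]
  · congr 2
    rw [scaledState, Finsupp.prod, Finsupp.prod, Polynomial.eval_prod,
      ← MvPolynomial.coeToMvPowerSeries.ringHom_apply,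
      ← MvPolynomial.coeToMvPowerSeries.ringHom_apply, map_prod, map_prod, map_prod]
    refine Finset.prod_congr rfl fun x _ => ?_
    simp only [Polynomial.eval_pow, Polynomial.eval_add, Polynomial.eval_monomial,
      Polynomial.eval_C, map_pow, map_add, map_mul, MvPolynomial.coeToMvPowerSeries.ringHom_apply,
      MvPolynomial.coe_C, MvPolynomial.coe_X, rescale_X, rescale_C]
    ring
  · intro μ hμ
    rw [MvPolynomial.coeff_coe, coeff_eval_truncExp _ _ _ _ (level_mono hμ)]

/-! ### Wick's theorem and commutators of exponentials -/

/-- The logarithmic derivative of `exp (∑ t^n c(r, n) β(r, n))`, the factor by which the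
translation by `β` multiplies the exponential of the creation operators `t^n c`. -/
def contractionLog (c β : CrIdx → ℂ) : PowerSeries ℂ :=
  PowerSeries.mk fun N => if h : 0 < N then
    ∑ r : Osc, N * (c (r, ⟨N, h⟩) * β (r, ⟨N, h⟩)) else 0

/-- Moving a translation past an exponential of creation operators costs the contraction factor
`g`: both sides solve the same differential equation. -/
lemma map_translate_graded_creationExp (c β : CrIdx → ℂ) {g : PowerSeries ℂ}
    (hg : IsExp (contractionLog c β) g) :
    PowerSeries.map (translate β : MvPolynomial CrIdx ℂ →+* MvPolynomial CrIdx ℂ)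
      (graded (creationExp c)) = PowerSeries.map MvPolynomial.C g * graded (creationExp c) := by
  have h1 := (isExp_graded_creationExp c).map
    (translate β : MvPolynomial CrIdx ℂ →+* MvPolynomial CrIdx ℂ)
  have h2 := (hg.map (MvPolynomial.C (σ := CrIdx))).mul (isExp_graded_creationExp c)
  have h3 : PowerSeries.map (translate β : MvPolynomial CrIdx ℂ →+* MvPolynomial CrIdx ℂ)
      (creationLog c) = PowerSeries.map MvPolynomial.C (contractionLog c β) + creationLog c := by
    ext1 N
    simp only [creationLog, contractionLog, PowerSeries.coeff_map, PowerSeries.coeff_mk, map_add]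
    split_ifs with h
    · rw [map_sum, map_sum, ← Finset.sum_add_distrib]
      refine Finset.sum_congr rfl fun r _ => ?_
      simp only [translate, RingHom.coe_coe, map_mul, MvPolynomial.aeval_X, map_natCast,
        MvPolynomial.algHom_C, MvPolynomial.algebraMap_eq]
      ring
    · simp
  rw [h3] at h1
  refine h1.unique h2 ?_
  rw [map_add, creationLog_const, ← PowerSeries.coeff_zero_eq_constantCoeff_apply]
  simp [contractionLog]

/-- Wick's theorem: the product of two normal ordered exponentials, restricted to intermediate
states of a given level, is the contraction factor times the normal ordered product. -/
lemma sum_levelSet_matElem_mul (c β c' β' : CrIdx → ℂ) {g : PowerSeries ℂ}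
    (hg : IsExp (contractionLog c' β) g) (out inn : Occ) (N : ℕ) :
    ∑ mid ∈ levelSet N, matElem c β out mid * matElem c' β' mid inn =
      PowerSeries.coeff N (g * (normalOrdered c β c' β' out inn : PowerSeries ℂ)) := by
  have h1 : ∑ mid ∈ levelSet N, matElem c β out mid * matElem c' β' mid inn =
      outFunctional c out (translate β (PowerSeries.coeff N (graded (creationExp c' *
        (inn.prod fun x m => (MvPolynomial.X x + MvPolynomial.C (β' x)) ^ m :
          MvPolynomial CrIdx ℂ))))) := by
    rw [graded, PowerSeries.coeff_mk, map_sum, map_sum]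
    refine Finset.sum_congr rfl fun mid _ => ?_
    have h : ∀ a : ℂ, MvPolynomial.monomial mid a = a • MvPolynomial.monomial mid (1 : ℂ) := by
      intro a; rw [MvPolynomial.smul_monomial, smul_eq_mul, mul_one]
    rw [h, map_smul, map_smul, smul_eq_mul, matElem_eq_translate, outFunctional_apply, mul_comm]
    rfl
  have h2 : PowerSeries.map (translate β : MvPolynomial CrIdx ℂ →+* MvPolynomial CrIdx ℂ)
      (graded ((inn.prod fun x m => (MvPolynomial.X x + MvPolynomial.C (β' x)) ^ m :
          MvPolynomial CrIdx ℂ) : MvPowerSeries CrIdx ℂ)) =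
      (scaledState β β' inn : PowerSeries (MvPolynomial CrIdx ℂ)) := by
    rw [scaledState, ← gradedHom_apply, Finsupp.prod, Finsupp.prod,
      ← MvPolynomial.coeToMvPowerSeries.ringHom_apply,
      ← Polynomial.coeToPowerSeries.ringHom_apply, map_prod, map_prod, map_prod, map_prod]
    refine Finset.prod_congr rfl fun x _ => ?_
    simp only [map_pow, map_add, MvPolynomial.coeToMvPowerSeries.ringHom_apply,
      MvPolynomial.coe_C, MvPolynomial.coe_X, gradedHom_apply, graded_X, graded_C,
      Polynomial.coeToPowerSeries.ringHom_apply, Polynomial.coe_monomial, Polynomial.coe_C,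
      PowerSeries.map_C]
    congr 2
    · ext1 n
      rw [PowerSeries.coeff_map, ← map_add, PowerSeries.coeff_monomial, PowerSeries.coeff_monomial]
      split_ifs <;> simp [translate]
    · simp [translate]
  have h3 : translate β (PowerSeries.coeff N (graded (creationExp c' *
        (inn.prod fun x m => (MvPolynomial.X x + MvPolynomial.C (β' x)) ^ m :
          MvPolynomial CrIdx ℂ)))) = PowerSeries.coeff N (PowerSeries.map MvPolynomial.C g *
        (graded (creationExp c') *
          (scaledState β β' inn : PowerSeries (MvPolynomial CrIdx ℂ)))) := by
    rw [← mul_assoc, ← map_translate_graded_creationExp c' β hg, ← h2, ← map_mul, ← graded_mul,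
      PowerSeries.coeff_map]
    rfl
  rw [h1, h3, PowerSeries.coeff_mul, PowerSeries.coeff_mul, map_sum]
  refine Finset.sum_congr rfl fun p _ => ?_
  rw [PowerSeries.coeff_map, ← MvPolynomial.smul_eq_C_mul, map_smul, smul_eq_mul,
    Polynomial.coeff_coe, coeff_normalOrdered]

lemma natDegree_normalOrdered (c β c' β' : CrIdx → ℂ) (out inn : Occ) :
    (normalOrdered c β c' β' out inn).natDegree ≤ level out + level inn := by
  refine Polynomial.natDegree_sum_le_of_forall_le _ _ fun i hi => ?_
  exact (Polynomial.natDegree_monomial_le _).trans (by simpa [Nat.lt_succ_iff] using hi)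

/-- Covariance of the matrix elements under rescaling of the argument of the exponential. -/
lemma matElem_rescale (c β : CrIdx → ℂ) (out inn : Occ) {b : ℂ} (hb : b ≠ 0) :
    b ^ level inn * matElem (fun x => b ^ (x.2 : ℕ) * c x) (fun x => b⁻¹ ^ (x.2 : ℕ) * β x) out inn
      = b ^ level out * matElem c β out inn := by
  rw [matElem, matElem, ← coeff_rescale_level, map_mul (MvPowerSeries.rescale _),
    rescale_creationExp, ← MvPowerSeries.coeff_C_mul, mul_left_comm]
  congr 2
  rw [level_eq_sum, ← Finset.prod_pow_eq_pow_sum, Finsupp.prod, Finsupp.prod,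
    ← MvPolynomial.coeToMvPowerSeries.ringHom_apply,
    ← MvPolynomial.coeToMvPowerSeries.ringHom_apply, map_prod, map_prod, map_prod, map_prod,
    ← Finset.prod_mul_distrib]
  refine Finset.prod_congr rfl fun x _ => ?_
  simp only [map_pow, map_add, MvPolynomial.coeToMvPowerSeries.ringHom_apply,
      MvPolynomial.coe_C, MvPolynomial.coe_X, rescale_X, rescale_C]
  rw [mul_comm (inn x), pow_mul, ← mul_pow, mul_add, map_mul, ← mul_assoc, ← map_pow, ← map_mul,
    ← mul_pow, mul_inv_cancel₀ hb]
  simp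

/-- The normal ordered products of the two orderings agree, one being a polynomial in `t` and the
other in `1 / t`. -/
lemma normalOrdered_swap (c β c' β' : CrIdx → ℂ) (out inn : Occ) :
    normalOrdered c' β' c β out inn =
      (normalOrdered c β c' β' out inn).reflect (level out + level inn) := by
  -- Both values at `t = b` are the same matrix element, for every `b ≠ 0`.
  refine Polynomial.eq_of_infinite_eval_eq _ _ ((Set.infinite_of_injective_forall_mem
    (f := fun n : ℕ => (n + 1 : ℂ)) (fun a b h => by simpa using h)) fun n => ?_)
  have hb : (n + 1 : ℂ) ≠ 0 := by exact_mod_cast Nat.succ_ne_zero n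
  generalize (n + 1 : ℂ) = b at hb
  change Polynomial.eval b _ = Polynomial.eval b _
  let _ : Invertible b⁻¹ := invertibleOfNonzero (inv_ne_zero hb)
  have h := Polynomial.eval₂_reflect_mul_pow (RingHom.id ℂ) b⁻¹ (level out + level inn)
    (normalOrdered c β c' β' out inn) (natDegree_normalOrdered _ _ _ _ _ _)
  rw [invOf_eq_inv, inv_inv, Polynomial.eval₂_id, Polynomial.eval₂_id, inv_pow,
    ← div_eq_mul_inv, div_eq_iff (pow_ne_zero _ hb)] at h
  rw [h, eval_normalOrdered _ _ _ _ _ _ hb, eval_normalOrdered _ _ _ _ _ _ (inv_ne_zero hb)]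
  have h2 := matElem_rescale (fun x => b⁻¹ ^ (x.2 : ℕ) * c' x + c x)
    (fun x => b ^ (x.2 : ℕ) * β' x + β x) out inn hb
  have h3 : (fun x : CrIdx => b ^ (x.2 : ℕ) * (b⁻¹ ^ (x.2 : ℕ) * c' x + c x)) =
      fun x => b⁻¹⁻¹ ^ (x.2 : ℕ) * c x + c' x := by
    ext x
    rw [mul_add, ← mul_assoc, ← mul_pow, mul_inv_cancel₀ hb, inv_inv]
    ring
  have h4 : (fun x : CrIdx => b⁻¹ ^ (x.2 : ℕ) * (b ^ (x.2 : ℕ) * β' x + β x)) =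
      fun x => b⁻¹ ^ (x.2 : ℕ) * β x + β' x := by
    ext x
    rw [mul_add, ← mul_assoc, ← mul_pow, inv_mul_cancel₀ hb]
    ring
  rw [h3, h4] at h2
  rw [← h2, pow_add, inv_pow]
  field_simp

/-- The coefficients of a power series, extended by zero to negative indices. -/
def coeffZ (g : PowerSeries ℂ) (j : ℤ) : ℂ := if 0 ≤ j then PowerSeries.coeff j.toNat g else 0

/-- The occupation numbers of level `N`; none if `N < 0`. -/
def levelSetZ (N : ℤ) : Finset Occ := if 0 ≤ N then levelSet N.toNat else ∅

lemma mem_levelSetZ {N : ℤ} {ν : Occ} : ν ∈ levelSetZ N ↔ (level ν : ℤ) = N := by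
  unfold levelSetZ
  split_ifs with h
  · rw [mem_levelSet]; omega
  · simp only [Finset.notMem_empty, false_iff]; omega

/-- `sum_levelSet_matElem_mul` for integral levels, with the Cauchy product cut off at the degree of
the normal ordered product. -/
lemma sum_levelSetZ_matElem_mul (c β c' β' : CrIdx → ℂ) {g : PowerSeries ℂ}
    (hg : IsExp (contractionLog c' β) g) (out inn : Occ) (N : ℤ) :
    ∑ mid ∈ levelSetZ N, matElem c β out mid * matElem c' β' mid inn =
      ∑ j ∈ Finset.range (level out + level inn + 1),
        (normalOrdered c β c' β' out inn).coeff j * coeffZ g (N - j) := by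
  unfold levelSetZ
  split_ifs with h
  · rw [sum_levelSet_matElem_mul c β c' β' hg]
    conv_lhs => rw [Polynomial.as_sum_range' (normalOrdered c β c' β' out inn)
      (level out + level inn + 1) (Nat.lt_succ_of_le (natDegree_normalOrdered _ _ _ _ _ _))]
    rw [← Polynomial.coeToPowerSeries.ringHom_apply, map_sum, Finset.mul_sum, map_sum]
    refine Finset.sum_congr rfl fun j _ => ?_
    rw [Polynomial.coeToPowerSeries.ringHom_apply, Polynomial.coe_monomial,
      PowerSeries.monomial_eq_C_mul_X_pow, mul_left_comm, PowerSeries.coeff_C_mul,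
      PowerSeries.coeff_mul_X_pow', coeffZ]
    congr 1
    by_cases hj : j ≤ N.toNat
    · have : N.toNat - j = (N - j).toNat := by omega
      rw [if_pos hj, if_pos (by omega), this]
    · rw [if_neg hj, if_neg (by omega)]
  · symm
    refine Finset.sum_eq_zero fun j _ => ?_
    rw [coeffZ, if_neg (by omega), mul_zero]

lemma sum_listSum_map {ι κ : Type*} (s : Finset ι) (l : List κ) (f : κ → ι → ℂ) :
    ∑ i ∈ s, (l.map fun p => f p i).sum = (l.map fun p => ∑ i ∈ s, f p i).sum := by
  induction l with
  | nil => simp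
  | cons p l ih => simp [Finset.sum_add_distrib, ih]

/-- The (anti-)commutator of two exponentials is a combination of delta functions, one for each pole
`exp A` of the contraction factor. The hypothesis `h` says that the two contraction factors are the
expansions of one rational function in the two regions, so that their difference is
`∑ ρ exp (A j)`, summed over the poles `(ρ, A)`. -/
lemma matElem_commutator (c β c' β' : CrIdx → ℂ) {g g' : PowerSeries ℂ}
    (hg : IsExp (contractionLog c' β) g) (hg' : IsExp (contractionLog c β') g')
    {a b : ℂ} {κ : ℤ} {poles : List (ℂ × ℂ)}
    (h : ∀ j : ℤ, a * coeffZ g j - b * coeffZ g' (κ - j) =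
      (poles.map fun p => p.1 * exp (p.2 * j)).sum)
    (out inn : Occ) {N N' : ℤ} (hN : N + N' = level out + level inn + κ) :
    a * ∑ mid ∈ levelSetZ N, matElem c β out mid * matElem c' β' mid inn -
      b * ∑ mid ∈ levelSetZ N', matElem c' β' out mid * matElem c β mid inn =
    (poles.map fun p => p.1 * exp (p.2 * (N - level out)) *
      matElem (fun x => exp (p.2 * (x.2 : ℕ)) * c x + c' x)
        (fun x => exp (-(p.2 * (x.2 : ℕ))) * β x + β' x) out inn).sum := by
  rw [sum_levelSetZ_matElem_mul c β c' β' hg, sum_levelSetZ_matElem_mul c' β' c β hg',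
    -- The second sum is reversed, so that equal coefficients of the normal ordered products meet.
    ← Finset.sum_range_reflect (fun j => (normalOrdered c' β' c β out inn).coeff j * _),
    Finset.mul_sum, Finset.mul_sum, ← Finset.sum_sub_distrib]
  have h1 : ∀ j ∈ Finset.range (level out + level inn + 1),
      a * ((normalOrdered c β c' β' out inn).coeff j * coeffZ g (N - j)) -
      b * ((normalOrdered c' β' c β out inn).coeff (level out + level inn + 1 - 1 - j) *
        coeffZ g' (N' - (level out + level inn + 1 - 1 - j : ℕ))) =
      (poles.map fun p => p.1 * exp (p.2 * N) *
        ((normalOrdered c β c' β' out inn).coeff j * exp (-p.2) ^ j)).sum := by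
    intro j hj
    rw [Finset.mem_range] at hj
    rw [normalOrdered_swap c β c' β', Polynomial.coeff_reflect, Polynomial.revAt_le (by omega)]
    have e1 : level out + level inn - (level out + level inn + 1 - 1 - j) = j := by omega
    have e2 : N' - (level out + level inn + 1 - 1 - j : ℕ) = κ - (N - j) := by omega
    rw [e1, e2]
    have h2 := congrArg (fun y => (normalOrdered c β c' β' out inn).coeff j * y) (h (N - j))
    rw [mul_sub, ← List.sum_map_mul_left] at h2
    rw [mul_left_comm, mul_left_comm b, h2]
    congr 1
    refine List.map_congr_left fun p _ => ?_
    rw [← exp_nat_mul]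
    push_cast
    rw [mul_sub, sub_eq_add_neg, exp_add]
    ring_nf
  rw [Finset.sum_congr rfl h1, sum_listSum_map]
  congr 1
  refine List.map_congr_left fun p _ => ?_
  rw [← Finset.mul_sum, ← Polynomial.eval_eq_sum_range' (Nat.lt_succ_of_le
    (natDegree_normalOrdered _ _ _ _ _ _)), eval_normalOrdered _ _ _ _ _ _ (exp_ne_zero _)]
  have e1 : exp (p.2 * (N - level out)) = exp (p.2 * N) * exp (-p.2) ^ level out := by
    rw [← exp_nat_mul, ← exp_add]; congr 1; ring
  rw [e1, ← mul_assoc, ← mul_assoc]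
  congr 2
  · ext x
    rw [← exp_neg, ← exp_nat_mul, neg_neg, mul_comm p.2]
  · ext x
    rw [← exp_nat_mul]
    congr 3
    ring

/-! ### Vertex operators and their modes -/

/-- The exponent `L` of a vertex operator at a point `z`, moved to the point `exp ω * z`. -/
def Lin.shift (ω : ℂ) (L : Lin) : Lin where
  osc r n := if n = 0 then L.osc r 0 + ω * L.chg r else exp (-n * ω) * L.osc r n
  chg := L.chg

/-- The coefficients of the creation operators. -/
def Lin.cre (L : Lin) : CrIdx → ℂ := fun x => L.osc x.1 (-(x.2 : ℤ))

/-- The translation of the creation operators by the annihilation part. -/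
def Lin.ann (η k : ℂ) (L : Lin) : CrIdx → ℂ :=
  fun x => ∑ r, L.osc r (x.2 : ℤ) * comm η k (x.2 : ℤ) r x.1

/-- The value of the zero modes `∑ L.osc r 0 · r_0` on the charge `χ`. -/
def zeroPair (k : ℂ) (L : Lin) (χ : Osc → ℂ) : ℂ := ∑ r, L.osc r 0 * zeroEig k χ r

/-- The value of `∑ L.chg r · r_0` on the charge `χ`, an exponent of the argument of the vertex
operator of `L`. -/
def chgPair (k : ℂ) (L : Lin) (χ : Osc → ℂ) : ℂ := ∑ r, L.chg r * zeroEig k χ r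

/-- `[∑_{n > 0} L.osc s n · s_n, ∑_{n > 0} M.osc r (-n) · r_{-n}]`, its part of mode number `n`. -/
def contraction (η k : ℂ) (L M : Lin) (n : ℤ) : ℂ :=
  ∑ r, ∑ s, L.osc s n * comm η k n s r * M.osc r (-n)

lemma zeroEig_add (k : ℂ) (χ χ' : Osc → ℂ) (r : Osc) :
    zeroEig k (χ + χ') r = zeroEig k χ r + zeroEig k χ' r := by
  simp [zeroEig, mul_add, Finset.sum_add_distrib]

lemma zeroPair_add_right (k : ℂ) (L : Lin) (χ χ' : Osc → ℂ) :
    zeroPair k L (χ + χ') = zeroPair k L χ + zeroPair k L χ' := by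
  simp [zeroPair, zeroEig_add, mul_add, Finset.sum_add_distrib]

lemma chgPair_add_right (k : ℂ) (L : Lin) (χ χ' : Osc → ℂ) :
    chgPair k L (χ + χ') = chgPair k L χ + chgPair k L χ' := by
  simp [chgPair, zeroEig_add, mul_add, Finset.sum_add_distrib]

@[simp] lemma Lin.add_osc (L M : Lin) (r : Osc) (n : ℤ) :
    (L + M).osc r n = L.osc r n + M.osc r n := rfl
@[simp] lemma Lin.add_chg (L M : Lin) (r : Osc) : (L + M).chg r = L.chg r + M.chg r := rfl
@[simp] lemma Lin.neg_osc (L : Lin) (r : Osc) (n : ℤ) : (-L).osc r n = -L.osc r n := rfl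
@[simp] lemma Lin.neg_chg (L : Lin) (r : Osc) : (-L).chg r = -L.chg r := rfl
@[simp] lemma Lin.sub_osc (L M : Lin) (r : Osc) (n : ℤ) :
    (L - M).osc r n = L.osc r n - M.osc r n := rfl
@[simp] lemma Lin.sub_chg (L M : Lin) (r : Osc) : (L - M).chg r = L.chg r - M.chg r := rfl

lemma chg_add (L M : Lin) : (L + M).chg = L.chg + M.chg := rfl

lemma zeroPair_add_left (k : ℂ) (L M : Lin) (χ : Osc → ℂ) :
    zeroPair k (L + M) χ = zeroPair k L χ + zeroPair k M χ := by
  simp [zeroPair, add_mul, Finset.sum_add_distrib]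

lemma zeroPair_shift (k ω : ℂ) (L : Lin) (χ : Osc → ℂ) :
    zeroPair k (L.shift ω) χ = zeroPair k L χ + ω * chgPair k L χ := by
  simp [zeroPair, chgPair, Lin.shift, add_mul, Finset.sum_add_distrib, Finset.mul_sum, mul_assoc]

lemma cre_shift (ω : ℂ) (L : Lin) :
    (L.shift ω).cre = fun x => exp (ω * (x.2 : ℕ)) * L.cre x := by
  ext x
  have : (-(x.2 : ℤ)) ≠ 0 := by have := x.2.pos; omega
  simp only [Lin.cre, Lin.shift, if_neg this]
  congr 2
  push_cast
  ring

lemma ann_shift (η k ω : ℂ) (L : Lin) :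
    (L.shift ω).ann η k = fun x => exp (-(ω * (x.2 : ℕ))) * L.ann η k x := by
  ext x
  have : (x.2 : ℤ) ≠ 0 := by have := x.2.pos; omega
  simp only [Lin.ann, Lin.shift, if_neg this, Finset.mul_sum]
  refine Finset.sum_congr rfl fun r _ => ?_
  rw [← mul_assoc]
  congr 3
  push_cast
  ring

lemma cre_add (L M : Lin) : (L + M).cre = fun x => L.cre x + M.cre x := rfl

lemma ann_add (η k : ℂ) (L M : Lin) :
    (L + M).ann η k = fun x => L.ann η k x + M.ann η k x := by
  ext x
  simp [Lin.ann, add_mul, Finset.sum_add_distrib]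

open Classical in
lemma vertex_apply (η k : ℂ) (L : Lin) (out inn : FockState) :
    vertex η k L out inn = if out.1 = inn.1 + L.chg then
      exp (zeroPair k L inn.1) * matElem L.cre (L.ann η k) out.2 inn.2 else 0 := by
  simp only [vertex, matElem_eq_translate]
  rfl

/-- Covariance of vertex operators under a change of their argument. -/
lemma vertex_shift (η k ω : ℂ) (L : Lin) (out inn : FockState) :
    vertex η k (L.shift ω) out inn =
      exp (ω * (level out.2 - level inn.2 + chgPair k L inn.1)) * vertex η k L out inn := by
  classical
  rw [vertex_apply, vertex_apply]
  have hc : (L.shift ω).chg = L.chg := rfl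
  rw [hc]
  split_ifs with h
  · have h1 := matElem_rescale L.cre (L.ann η k) out.2 inn.2 (exp_ne_zero ω)
    have h2 : matElem (L.shift ω).cre ((L.shift ω).ann η k) out.2 inn.2 =
        exp (ω * (level out.2 - level inn.2)) * matElem L.cre (L.ann η k) out.2 inn.2 := by
      rw [cre_shift, ann_shift]
      have e1 : (fun x : CrIdx => exp (ω * (x.2 : ℕ)) * L.cre x) =
          fun x => exp ω ^ (x.2 : ℕ) * L.cre x := by
        ext x; rw [← exp_nat_mul, mul_comm ω]
      have e2 : (fun x : CrIdx => exp (-(ω * (x.2 : ℕ))) * L.ann η k x) =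
          fun x => (exp ω)⁻¹ ^ (x.2 : ℕ) * L.ann η k x := by
        ext x; rw [← exp_neg, ← exp_nat_mul]; congr 2; ring
      rw [e1, e2]
      refine mul_left_cancel₀ (pow_ne_zero (level inn.2) (exp_ne_zero ω)) (h1.trans ?_)
      rw [← mul_assoc, ← exp_nat_mul, ← exp_nat_mul, ← exp_add]
      congr 2
      ring
    rw [h2, zeroPair_shift, mul_add, exp_add, exp_add]
    ring
  · simp

open Classical in
/-- The part of the vertex operator of `L` that multiplies `w ^ (-m)` when `L` is moved to `w`. -/
def vmode (η k : ℂ) (L : Lin) (m : ℤ) : FockOp := fun out inn =>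
  if (m : ℂ) + (level out.2 - level inn.2 + chgPair k L inn.1) = 0 then vertex η k L out inn else 0

lemma hasSum_of_charge {f : FockState → ℂ} (χ : Osc → ℂ) (S : Finset Occ)
    (h : ∀ x, f x ≠ 0 → x.1 = χ ∧ x.2 ∈ S) : HasSum f (∑ ν ∈ S, f (χ, ν)) := by
  have h1 : ∑ ν ∈ S, f (χ, ν) = ∑ x ∈ S.map ⟨fun ν => (χ, ν), Prod.mk_right_injective χ⟩, f x := by
    rw [Finset.sum_map]; rfl
  rw [h1]
  refine hasSum_sum_of_ne_finset_zero fun x hx => ?_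
  by_contra h0
  obtain ⟨rfl, hS⟩ := h x h0
  exact hx (Finset.mem_map.2 ⟨x.2, hS, rfl⟩)

open Classical in
/-- A mode has a fixed degree, so that only intermediate states of one charge and one level
contribute. -/
lemma hasSum_vmode_mul_vertex (η k : ℂ) (L M : Lin) (m ℓ : ℤ) (out inn : FockState)
    (hℓ : chgPair k L (inn.1 + M.chg) = ℓ) :
    HasSum (fun mid => vmode η k L m out mid * vertex η k M mid inn)
      (if out.1 = inn.1 + (L + M).chg then
        exp (zeroPair k L M.chg) * (exp (zeroPair k (L + M) inn.1) *
          ∑ mid ∈ levelSetZ (m + level out.2 + ℓ),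
            matElem L.cre (L.ann η k) out.2 mid * matElem M.cre (M.ann η k) mid inn.2) else 0) := by
  have hch : ∀ mid : FockState, mid.1 = inn.1 + M.chg →
      (out.1 = mid.1 + L.chg ↔ out.1 = inn.1 + (L + M).chg) := by
    intro mid h; rw [h, chg_add, add_assoc, add_comm M.chg]
  split_ifs with h
  · have h1 := hasSum_of_charge (f := fun mid => vmode η k L m out mid * vertex η k M mid inn)
      (inn.1 + M.chg) (levelSetZ (m + level out.2 + ℓ)) (fun x hx => by
        rw [vmode, vertex_apply _ _ M] at hx
        have hx1 : x.1 = inn.1 + M.chg := by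
          by_contra h'; rw [if_neg h', mul_zero] at hx; exact hx rfl
        refine ⟨hx1, ?_⟩
        rw [hx1, hℓ] at hx
        have hx2 : (m : ℂ) + (level out.2 - level x.2 + ℓ) = 0 := by
          by_contra h'; rw [if_neg h', zero_mul] at hx; exact hx rfl
        rw [mem_levelSetZ]
        have : ((level x.2 : ℤ) : ℂ) = ((m + level out.2 + ℓ : ℤ) : ℂ) := by
          push_cast; linear_combination -hx2
        exact_mod_cast this)
    convert h1 using 1
    rw [Finset.mul_sum, Finset.mul_sum]
    refine Finset.sum_congr rfl fun ν hν => ?_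
    rw [mem_levelSetZ] at hν
    have hν' : (level ν : ℂ) = m + level out.2 + ℓ := by
      exact_mod_cast congrArg (Int.cast (R := ℂ)) hν
    rw [vmode, if_pos (by dsimp only; rw [hℓ, hν']; ring), vertex_apply, vertex_apply,
      if_pos ((hch _ rfl).2 h), if_pos rfl]
    dsimp only
    rw [zeroPair_add_right, zeroPair_add_left, exp_add, exp_add]
    ring
  · convert hasSum_zero with mid
    rw [vmode]
    split_ifs
    · rw [vertex_apply, vertex_apply]
      by_cases h2 : mid.1 = inn.1 + M.chg
      · rw [if_neg (fun h' => h ((hch mid h2).1 h')), zero_mul]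
      · rw [if_neg h2, mul_zero]
    · rw [zero_mul]

open Classical in
lemma hasSum_vertex_mul_vmode (η k : ℂ) (L M : Lin) (m ℓ : ℤ) (out inn : FockState)
    (hℓ : chgPair k L inn.1 = ℓ) :
    HasSum (fun mid => vertex η k M out mid * vmode η k L m mid inn)
      (if out.1 = inn.1 + (L + M).chg then
        exp (zeroPair k M L.chg) * (exp (zeroPair k (L + M) inn.1) *
          ∑ mid ∈ levelSetZ (level inn.2 - m - ℓ),
            matElem M.cre (M.ann η k) out.2 mid * matElem L.cre (L.ann η k) mid inn.2) else 0) := by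
  have hch : ∀ mid : FockState, mid.1 = inn.1 + L.chg →
      (out.1 = mid.1 + M.chg ↔ out.1 = inn.1 + (L + M).chg) := by
    intro mid h; rw [h, chg_add, add_assoc]
  split_ifs with h
  · have h1 := hasSum_of_charge (f := fun mid => vertex η k M out mid * vmode η k L m mid inn)
      (inn.1 + L.chg) (levelSetZ (level inn.2 - m - ℓ)) (fun x hx => by
        rw [vmode, vertex_apply _ _ L] at hx
        rw [hℓ] at hx
        have hx2 : (m : ℂ) + (level x.2 - level inn.2 + ℓ) = 0 := by
          by_contra h'; rw [if_neg h', mul_zero] at hx; exact hx rfl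
        have hx1 : x.1 = inn.1 + L.chg := by
          by_contra h'; rw [if_neg h', ite_self, mul_zero] at hx; exact hx rfl
        refine ⟨hx1, ?_⟩
        rw [mem_levelSetZ]
        have : ((level x.2 : ℤ) : ℂ) = ((level inn.2 - m - ℓ : ℤ) : ℂ) := by
          push_cast; linear_combination hx2
        exact_mod_cast this)
    convert h1 using 1
    rw [Finset.mul_sum, Finset.mul_sum]
    refine Finset.sum_congr rfl fun ν hν => ?_
    rw [mem_levelSetZ] at hν
    have hν' : (level ν : ℂ) = level inn.2 - m - ℓ := by
      exact_mod_cast congrArg (Int.cast (R := ℂ)) hν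
    rw [vmode, if_pos (by dsimp only; rw [hℓ, hν']; ring), vertex_apply, vertex_apply,
      if_pos ((hch _ rfl).2 h), if_pos rfl]
    dsimp only
    rw [zeroPair_add_right, zeroPair_add_left, exp_add, exp_add]
    ring
  · convert hasSum_zero with mid
    rw [vmode]
    split_ifs
    · rw [vertex_apply, vertex_apply]
      by_cases h2 : mid.1 = inn.1 + L.chg
      · rw [if_neg (fun h' => h ((hch mid h2).1 h')), zero_mul]
      · rw [if_neg h2, mul_zero]
    · rw [mul_zero]

/-- `∑ n · contraction n · x ^ n`, the logarithmic derivative of the contraction factor. -/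
def contractionSeries (η k : ℂ) (L M : Lin) : PowerSeries ℂ :=
  PowerSeries.mk fun n => n * contraction η k L M n

lemma contractionLog_eq (η k : ℂ) (L M : Lin) :
    contractionLog M.cre (L.ann η k) = contractionSeries η k L M := by
  ext n
  rw [contractionLog, contractionSeries, PowerSeries.coeff_mk, PowerSeries.coeff_mk]
  split_ifs with h
  · rw [contraction, Finset.mul_sum]
    refine Finset.sum_congr rfl fun r _ => ?_
    congr 1
    rw [Lin.cre, Lin.ann, mul_comm, Finset.sum_mul]
    rfl
  · simp [Nat.eq_zero_of_not_pos h]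

/-- The operator product of the vertex operators of `L` (at `w`) and `M` (at `z`), `x = z / w`:
the contraction factors `g(x)` and `g'(1 / x)` of the two orderings, including the zero modes, are
expansions of the same function up to the sign `s`, so that their difference is a combination of
delta functions `∑ ρ exp (A j) x ^ j` over the `poles` `(ρ, A)`. The zero modes of `L` contribute
`w ^ κ`, whence the reflection `κ - j` of the exponents of the second factor. -/
structure HasOPE (η k s : ℂ) (L M : Lin) (κ : ℤ) (poles : List (ℂ × ℂ)) : Prop where
  chg : chgPair k L M.chg = κ
  exists_factor : ∃ g g' : PowerSeries ℂ, IsExp (contractionSeries η k L M) g ∧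
    IsExp (contractionSeries η k M L) g' ∧
    ∀ j : ℤ, exp (zeroPair k L M.chg) * coeffZ g j - s * exp (zeroPair k M L.chg) *
      coeffZ g' (κ - j) = (poles.map fun p => p.1 * exp (p.2 * j)).sum

/-- The product of two operators, through its matrix elements. -/
def opMul (A B : FockOp) : FockOp := fun out inn => ∑' mid, A out mid * B mid inn

/-- The commutation relation of a mode of one vertex operator with another vertex operator. -/
lemma HasOPE.commutator {η k s : ℂ} {L M : Lin} {κ : ℤ} {poles : List (ℂ × ℂ)}
    (h : HasOPE η k s L M κ poles) (m : ℤ) (out inn : FockState)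
    (hint : ∃ ℓ : ℤ, chgPair k L inn.1 = ℓ) :
    opMul (vmode η k L m) (vertex η k M) out inn -
      s * opMul (vertex η k M) (vmode η k L m) out inn =
    (poles.map fun p => p.1 * exp (p.2 * (m + κ)) *
      vertex η k (L.shift p.2 + M) out inn).sum := by
  classical
  obtain ⟨ℓ, hℓ⟩ := hint
  obtain ⟨hκ, g, g', hg, hg', hj⟩ := h
  rw [← contractionLog_eq] at hg hg'
  have h1 := hasSum_vmode_mul_vertex η k L M m (ℓ + κ) out inn
    (by rw [chgPair_add_right, hℓ, hκ]; push_cast; ring)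
  have h2 := hasSum_vertex_mul_vmode η k L M m ℓ out inn hℓ
  rw [opMul, opMul, h1.tsum_eq, h2.tsum_eq]
  have hv : ∀ A : ℂ, (L.shift A + M).chg = (L + M).chg := fun A => rfl
  simp only [vertex_apply, hv]
  split_ifs with hc
  · have h3 := matElem_commutator L.cre (L.ann η k) M.cre (M.ann η k) hg hg' hj out.2 inn.2
      (N := m + level out.2 + (ℓ + κ)) (N' := level inn.2 - m - ℓ) (by ring)
    have h4 := congrArg (fun y => exp (zeroPair k (L + M) inn.1) * y) h3
    rw [← List.sum_map_mul_left] at h4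
    refine Eq.trans ?_ (h4.trans ?_)
    · ring
    · congr 1
      refine List.map_congr_left fun p _ => ?_
      rw [cre_add, cre_shift, ann_add, ann_shift, zeroPair_add_left, zeroPair_add_left,
        zeroPair_shift, hℓ]
      have : exp (p.2 * ((m + level out.2 + (ℓ + κ) : ℤ) - level out.2)) =
          exp (p.2 * (m + κ)) * exp (p.2 * ℓ) := by
        rw [← exp_add]; congr 1; push_cast; ring
      rw [this, exp_add, exp_add, exp_add]
      ring
  · simp

/-! ### The contraction factors that occur -/

/-- `1 / (1 - exp A · x)`. -/
def geo (A : ℂ) : PowerSeries ℂ := PowerSeries.mk fun n => exp (n * A)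

/-- `1 - exp A · x`. -/
def lin (A : ℂ) : PowerSeries ℂ := 1 - PowerSeries.C (exp A) * PowerSeries.X

/-- The logarithmic derivative of `geo A`. -/
def geoLog (A : ℂ) : PowerSeries ℂ := PowerSeries.C (exp A) * PowerSeries.X * geo A

lemma geo_mul_lin (A : ℂ) : geo A * lin A = 1 := by
  ext n
  rw [lin, mul_sub, mul_one, mul_left_comm, map_sub, PowerSeries.coeff_C_mul, PowerSeries.coeff_one]
  cases n with
  | zero => simp [geo]
  | succ n =>
    rw [PowerSeries.coeff_succ_mul_X, geo, PowerSeries.coeff_mk, PowerSeries.coeff_mk, ← exp_add,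
      if_neg (Nat.succ_ne_zero n)]
    push_cast
    ring_nf

lemma coeff_geoLog (A : ℂ) {n : ℕ} (hn : 0 < n) :
    PowerSeries.coeff n (geoLog A) = exp (n * A) := by
  obtain ⟨n, rfl⟩ := Nat.exists_eq_succ_of_ne_zero hn.ne'
  rw [geoLog, mul_assoc, PowerSeries.coeff_C_mul, PowerSeries.coeff_succ_X_mul, geo,
    PowerSeries.coeff_mk, ← exp_add]
  push_cast
  ring_nf

lemma constantCoeff_geoLog (A : ℂ) : PowerSeries.constantCoeff (geoLog A) = 0 := by
  simp [geoLog]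

lemma isExp_lin (A : ℂ) : IsExp (-geoLog A) (lin A) where
  deriv := by
    have : PowerSeries.derivative ℂ (lin A) = -PowerSeries.C (exp A) := by
      rw [lin, map_sub, Derivation.leibniz]
      simp
    rw [this, geoLog]
    linear_combination PowerSeries.C (exp A) * PowerSeries.X * geo_mul_lin A
  const := by simp [lin]

lemma isExp_geo (A : ℂ) : IsExp (geoLog A) (geo A) where
  deriv := by
    have h1 := congrArg (PowerSeries.derivative ℂ) (geo_mul_lin A)
    rw [Derivation.leibniz] at h1
    simp only [smul_eq_mul] at h1
    have h0 : PowerSeries.derivative ℂ (1 : PowerSeries ℂ) = 0 := PowerSeries.derivative_one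
    rw [h0] at h1
    linear_combination PowerSeries.X * geo A * h1 - geo A * geo A * (isExp_lin A).deriv +
      (geoLog A * geo A - PowerSeries.X * PowerSeries.derivative ℂ (geo A)) * geo_mul_lin A
  const := by simp [geo, ← PowerSeries.coeff_zero_eq_constantCoeff_apply]

lemma isExp_one : IsExp (0 : PowerSeries ℂ) 1 := ⟨by simp, by simp⟩

lemma geo_mul_geo (A B : ℂ) : PowerSeries.C (exp A - exp B) * (geo A * geo B) =
    PowerSeries.C (exp A) * geo A - PowerSeries.C (exp B) * geo B := by
  have hA := geo_mul_lin A
  have hB := geo_mul_lin B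
  rw [lin] at hA hB
  rw [map_sub]
  linear_combination -PowerSeries.C (exp B) * geo B * hA + PowerSeries.C (exp A) * geo A * hB

lemma coeffZ_natCast (g : PowerSeries ℂ) (n : ℕ) : coeffZ g n = PowerSeries.coeff n g := by
  simp [coeffZ]

lemma coeffZ_of_neg (g : PowerSeries ℂ) {j : ℤ} (h : j < 0) : coeffZ g j = 0 := by
  rw [coeffZ, if_neg (by omega)]

lemma contractionSeries_eq {η k : ℂ} {L M : Lin} {F : PowerSeries ℂ}
    (h0 : PowerSeries.coeff 0 F = 0)
    (h : ∀ n : ℕ, 0 < n → n * contraction η k L M n = PowerSeries.coeff n F) :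
    contractionSeries η k L M = F := by
  ext n
  rw [contractionSeries, PowerSeries.coeff_mk]
  rcases Nat.eq_zero_or_pos n with rfl | hn
  · simp [h0]
  · exact h n hn

lemma coeff_geo_mul_lin_succ (A B : ℂ) (n : ℕ) :
    PowerSeries.coeff (n + 1) (geo A * lin B) = exp ((n + 1) * A) * (1 - exp (B - A)) := by
  rw [lin, mul_sub, mul_one, mul_left_comm, map_sub, PowerSeries.coeff_C_mul,
    PowerSeries.coeff_succ_mul_X, geo, PowerSeries.coeff_mk, PowerSeries.coeff_mk, mul_sub,
    ← exp_add, ← exp_add]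
  push_cast
  ring_nf

lemma coeff_zero_geo_mul_lin (A B : ℂ) : PowerSeries.coeff 0 (geo A * lin B) = 1 := by
  rw [PowerSeries.coeff_zero_eq_constantCoeff_apply, map_mul, (isExp_geo A).const,
    (isExp_lin B).const, one_mul]

/-- No contraction. -/
lemma HasOPE.of_trivial {η k s : ℂ} {L M : Lin} (z z' : ℂ)
    (h₁ : ∀ n : ℕ, 0 < n → n * contraction η k L M n = 0)
    (h₂ : ∀ n : ℕ, 0 < n → n * contraction η k M L n = 0)
    (hκ : chgPair k L M.chg = 0)
    (hL : zeroPair k L M.chg = z) (hM : zeroPair k M L.chg = z')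
    (hz : s * exp z' = exp z) :
    HasOPE η k s L M 0 [] where
  chg := by simpa using hκ
  exists_factor := by
    refine ⟨1, 1, ?_, ?_, ?_⟩
    · rw [contractionSeries_eq (F := 0) (by simp) (by simpa using h₁)]; exact isExp_one
    · rw [contractionSeries_eq (F := 0) (by simp) (by simpa using h₂)]; exact isExp_one
    · intro j
      rw [hL, hM, hz]
      have : coeffZ 1 (0 - j) = coeffZ 1 j := by
        rcases lt_trichotomy j 0 with h | rfl | h
        · rw [coeffZ_of_neg _ h, coeffZ, if_pos (by omega), PowerSeries.coeff_one,
            if_neg (by omega)]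
        · rfl
        · rw [coeffZ_of_neg _ (show 0 - j < 0 by omega), coeffZ, if_pos (by omega),
            PowerSeries.coeff_one, if_neg (by omega)]
      rw [this]
      simp

/-- Contraction factor `(1 - b x) / (1 - a x)`, where `a = exp A`, `b = exp B`. -/
lemma HasOPE.of_quotient {η k s : ℂ} {L M : Lin} (A B z z' : ℂ)
    (h₁ : ∀ n : ℕ, 0 < n → n * contraction η k L M n = exp (n * A) - exp (n * B))
    (h₂ : ∀ n : ℕ, 0 < n → n * contraction η k M L n = exp (n * -A) - exp (n * -B))
    (hκ : chgPair k L M.chg = 0)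
    (hL : zeroPair k L M.chg = z) (hM : zeroPair k M L.chg = z')
    (hz : s * exp z' = exp z * exp (B - A)) :
    HasOPE η k s L M 0 [(exp z * (1 - exp (B - A)), A)] where
  chg := by simpa using hκ
  exists_factor := by
    have key : ∀ (L M : Lin) (A B : ℂ),
        (∀ n : ℕ, 0 < n → n * contraction η k L M n = exp (n * A) - exp (n * B)) →
        IsExp (contractionSeries η k L M) (geo A * lin B) := by
      intro L M A B h
      rw [contractionSeries_eq (F := geoLog A + -geoLog B) (by simp [constantCoeff_geoLog])]
      · exact (isExp_geo A).mul (isExp_lin B)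
      · intro n hn
        rw [h n hn, map_add, map_neg, coeff_geoLog _ hn, coeff_geoLog _ hn, sub_eq_add_neg]
    refine ⟨_, _, key _ _ _ _ h₁, key _ _ _ _ h₂, fun j => ?_⟩
    rw [hL, hM, hz, List.map_singleton, List.sum_singleton]
    rcases lt_trichotomy j 0 with h | rfl | h
    · obtain ⟨n, rfl⟩ : ∃ n : ℕ, j = -(n + 1 : ℕ) := ⟨(-j - 1).toNat, by omega⟩
      have e : (0 : ℤ) - -(n + 1 : ℕ) = (n + 1 : ℕ) := by omega
      rw [coeffZ_of_neg _ h, e, coeffZ_natCast, coeff_geo_mul_lin_succ]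
      have e2 : exp (A * ((-(n + 1 : ℕ) : ℤ) : ℂ)) = exp ((n + 1) * -A) := by
        push_cast; ring_nf
      have e3 : exp (-B - -A) = (exp (B - A))⁻¹ := by rw [← exp_neg]; ring_nf
      rw [e2, e3]
      field_simp [exp_ne_zero]
      ring
    · rw [sub_zero, ← Nat.cast_zero (R := ℤ), coeffZ_natCast, coeffZ_natCast,
        coeff_zero_geo_mul_lin, coeff_zero_geo_mul_lin]
      simp
      ring
    · obtain ⟨n, rfl⟩ : ∃ n : ℕ, j = (n + 1 : ℕ) := ⟨(j - 1).toNat, by omega⟩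
      rw [coeffZ_of_neg _ (show (0 : ℤ) - (n + 1 : ℕ) < 0 by omega), coeffZ_natCast,
        coeff_geo_mul_lin_succ]
      push_cast
      ring_nf

/-- Contraction factor `1 / (1 - a x)`, where `a = exp A`. -/
lemma HasOPE.of_pole {η k s : ℂ} {L M : Lin} (A z z' : ℂ)
    (h₁ : ∀ n : ℕ, 0 < n → n * contraction η k L M n = exp (n * A))
    (h₂ : ∀ n : ℕ, 0 < n → n * contraction η k M L n = exp (n * -A))
    (hκ : chgPair k L M.chg = -1)
    (hL : zeroPair k L M.chg = z) (hM : zeroPair k M L.chg = z')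
    (hz : s * exp z' = -(exp z * exp (-A))) :
    HasOPE η k s L M (-1) [(exp z, A)] where
  chg := by simpa using hκ
  exists_factor := by
    have key : ∀ (L M : Lin) (A : ℂ),
        (∀ n : ℕ, 0 < n → n * contraction η k L M n = exp (n * A)) →
        IsExp (contractionSeries η k L M) (geo A) := by
      intro L M A h
      rw [contractionSeries_eq (F := geoLog A) (by simp [constantCoeff_geoLog])]
      · exact isExp_geo A
      · intro n hn
        rw [h n hn, coeff_geoLog _ hn]
    refine ⟨_, _, key _ _ _ h₁, key _ _ _ h₂, fun j => ?_⟩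
    rw [hL, hM, hz, List.map_singleton, List.sum_singleton]
    rcases lt_or_ge j 0 with h | h
    · obtain ⟨n, rfl⟩ : ∃ n : ℕ, j = -(n + 1 : ℕ) := ⟨(-j - 1).toNat, by omega⟩
      have e : (-1 : ℤ) - -(n + 1 : ℕ) = (n : ℕ) := by omega
      rw [coeffZ_of_neg _ h, e, coeffZ_natCast, geo, PowerSeries.coeff_mk, mul_zero, zero_sub,
        neg_mul, neg_neg, mul_assoc, ← exp_add]
      push_cast
      ring_nf
    · obtain ⟨n, rfl⟩ : ∃ n : ℕ, j = n := ⟨j.toNat, by omega⟩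
      rw [coeffZ_of_neg _ (show (-1 : ℤ) - n < 0 by omega), coeffZ_natCast, geo,
        PowerSeries.coeff_mk]
      push_cast
      ring_nf

/-- Contraction factor `1 - b x`, where `b = exp B`. -/
lemma HasOPE.of_zero {η k s : ℂ} {L M : Lin} (B z z' : ℂ)
    (h₁ : ∀ n : ℕ, 0 < n → n * contraction η k L M n = -exp (n * B))
    (h₂ : ∀ n : ℕ, 0 < n → n * contraction η k M L n = -exp (n * -B))
    (hκ : chgPair k L M.chg = 1)
    (hL : zeroPair k L M.chg = z) (hM : zeroPair k M L.chg = z')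
    (hz : s * exp z' = -(exp z * exp B)) :
    HasOPE η k s L M 1 [] where
  chg := by simpa using hκ
  exists_factor := by
    have key : ∀ (L M : Lin) (A : ℂ),
        (∀ n : ℕ, 0 < n → n * contraction η k L M n = -exp (n * A)) →
        IsExp (contractionSeries η k L M) (lin A) := by
      intro L M A h
      rw [contractionSeries_eq (F := -geoLog A) (by simp [constantCoeff_geoLog])]
      · exact isExp_lin A
      · intro n hn
        rw [h n hn, map_neg, coeff_geoLog _ hn]
    refine ⟨_, _, key _ _ _ h₁, key _ _ _ h₂, fun j => ?_⟩
    have hc : ∀ (A : ℂ) (j : ℤ), coeffZ (lin A) j =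
        if j = 0 then 1 else if j = 1 then -exp A else 0 := by
      intro A j
      rcases lt_or_ge j 0 with h | h
      · rw [coeffZ_of_neg _ h, if_neg (by omega), if_neg (by omega)]
      · obtain ⟨n, rfl⟩ : ∃ n : ℕ, j = n := ⟨j.toNat, by omega⟩
        rw [coeffZ_natCast, lin, map_sub, PowerSeries.coeff_C_mul, PowerSeries.coeff_one,
          PowerSeries.coeff_X]
        rcases n with _ | _ | n
        · simp
        · simp
        · rw [if_neg (by omega), if_neg (by omega), if_neg (by omega), if_neg (by omega)]
          simp
    rw [hL, hM, hz, hc, hc]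
    by_cases h0 : j = 0
    · subst h0
      simp only [if_true, sub_zero, one_ne_zero, if_false, List.map_nil, List.sum_nil]
      rw [exp_neg]
      field_simp [exp_ne_zero]
      ring
    by_cases h1 : j = 1
    · subst h1
      simp
    · rw [if_neg h0, if_neg h1, if_neg (by omega), if_neg (by omega)]
      simp

/-- Contraction factor `1 / ((1 - a x) (1 - b x))`, where `a = exp A`, `b = exp B`. -/
lemma HasOPE.of_two_poles {η k s : ℂ} {L M : Lin} (A B z z' : ℂ) (hAB : exp A ≠ exp B)
    (h₁ : ∀ n : ℕ, 0 < n → n * contraction η k L M n = exp (n * A) + exp (n * B))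
    (h₂ : ∀ n : ℕ, 0 < n → n * contraction η k M L n = exp (n * -A) + exp (n * -B))
    (hκ : chgPair k L M.chg = -2)
    (hL : zeroPair k L M.chg = z) (hM : zeroPair k M L.chg = z')
    (hz : s * exp z' = exp z * exp (-A - B)) :
    HasOPE η k s L M (-2)
      [(exp z * (exp A / (exp A - exp B)), A), (-(exp z * (exp B / (exp A - exp B))), B)] where
  chg := by simpa using hκ
  exists_factor := by
    have key : ∀ (L M : Lin) (A B : ℂ),
        (∀ n : ℕ, 0 < n → n * contraction η k L M n = exp (n * A) + exp (n * B)) →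
        IsExp (contractionSeries η k L M) (geo A * geo B) := by
      intro L M A B h
      rw [contractionSeries_eq (F := geoLog A + geoLog B) (by simp [constantCoeff_geoLog])]
      · exact (isExp_geo A).mul (isExp_geo B)
      · intro n hn
        rw [h n hn, map_add, coeff_geoLog _ hn, coeff_geoLog _ hn]
    have hc : ∀ (A B : ℂ), exp A ≠ exp B → ∀ n : ℕ, PowerSeries.coeff n (geo A * geo B) =
        (exp A * exp (n * A) - exp B * exp (n * B)) / (exp A - exp B) := by
      intro A B h n
      rw [eq_div_iff (sub_ne_zero.2 h), mul_comm, ← PowerSeries.coeff_C_mul, geo_mul_geo, map_sub,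
        PowerSeries.coeff_C_mul, PowerSeries.coeff_C_mul, geo, geo, PowerSeries.coeff_mk,
        PowerSeries.coeff_mk]
    have hBA : exp (-A) ≠ exp (-B) := by
      rw [exp_neg, exp_neg]; exact fun h => hAB (inv_injective h)
    have hd := sub_ne_zero.2 hAB
    have hd' : exp (-A) - exp (-B) = -(exp A - exp B) * exp (-A) * exp (-B) := by
      rw [exp_neg, exp_neg]; field_simp [exp_ne_zero]; ring
    refine ⟨_, _, key _ _ _ _ h₁, key _ _ _ _ h₂, fun j => ?_⟩
    rw [hL, hM, hz]
    simp only [List.map_cons, List.map_nil, List.sum_cons, List.sum_nil, add_zero]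
    rcases lt_trichotomy j (-1) with h | rfl | h
    · obtain ⟨n, rfl⟩ : ∃ n : ℕ, j = -(n + 2 : ℕ) := ⟨(-j - 2).toNat, by omega⟩
      have e : (-2 : ℤ) - -(n + 2 : ℕ) = (n : ℕ) := by omega
      have eA : exp (A * ((-(n + 2 : ℕ) : ℤ) : ℂ)) = exp (n * -A) * exp (-A) * exp (-A) := by
        rw [← exp_add, ← exp_add]; push_cast; ring_nf
      have eB : exp (B * ((-(n + 2 : ℕ) : ℤ) : ℂ)) = exp (n * -B) * exp (-B) * exp (-B) := by
        rw [← exp_add, ← exp_add]; push_cast; ring_nf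
      rw [coeffZ_of_neg _ (show -((n + 2 : ℕ) : ℤ) < 0 by omega), e, coeffZ_natCast, hc _ _ hBA,
        eA, eB, hd', sub_eq_add_neg (-A), exp_add, exp_neg A, exp_neg B]
      field_simp [exp_ne_zero]
      ring
    · rw [coeffZ_of_neg _ (show (-1 : ℤ) < 0 by omega),
        coeffZ_of_neg _ (show (-2 : ℤ) - -1 < 0 by omega)]
      have eA : exp (A * ((-1 : ℤ) : ℂ)) = (exp A)⁻¹ := by rw [← exp_neg]; push_cast; ring_nf
      have eB : exp (B * ((-1 : ℤ) : ℂ)) = (exp B)⁻¹ := by rw [← exp_neg]; push_cast; ring_nf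
      rw [eA, eB]
      field_simp [exp_ne_zero]
      ring
    · obtain ⟨n, rfl⟩ : ∃ n : ℕ, j = n := ⟨j.toNat, by omega⟩
      rw [coeffZ_of_neg _ (show (-2 : ℤ) - n < 0 by omega), coeffZ_natCast, hc _ _ hAB]
      rw [Int.cast_natCast, mul_comm A, mul_comm B]
      field_simp
      ring

/-! ### Contractions of the elementary fields -/

/-- The parameters are generic: no `q`-number that occurs in a denominator vanishes. -/
class Generic (η k : ℂ) : Prop where
  qnum_ne : ∀ n : ℤ, n ≠ 0 → qnum η n ≠ 0
  qnum_mul_ne : ∀ n : ℤ, n ≠ 0 → qnum η ((k + 1) * n) ≠ 0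
  level_ne : k + 1 ≠ 0

lemma qpow_sub_ne (η k : ℂ) [Generic η k] : qpow η 1 - qpow η (-1) ≠ 0 := by
  intro h
  exact Generic.qnum_ne (η := η) k 1 one_ne_zero (by simp [qnum, h])

lemma qnum_neg (η x : ℂ) : qnum η (-x) = -qnum η x := by
  rw [qnum, qnum, neg_neg, ← neg_sub, neg_div]

lemma sub_mul_qnum (η k x : ℂ) [Generic η k] :
    (qpow η 1 - qpow η (-1)) * qnum η x = exp (η * x) - exp (-(η * x)) := by
  rw [qnum, mul_div_cancel₀ _ (qpow_sub_ne η k), qpow, qpow, mul_neg]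

/-- The bosons other than `a¹`, `a²`. -/
def Osc.isB : Osc → Bool
  | .a _ => false
  | _ => true

@[simp] lemma isB_b12 : Osc.isB .b12 = true := by decide
@[simp] lemma isB_b13 : Osc.isB .b13 = true := by decide
@[simp] lemma isB_b23 : Osc.isB .b23 = true := by decide
@[simp] lemma isB_c : Osc.isB .c = true := by decide

lemma comm_eq_of_isB {η k : ℂ} {n : ℤ} {r s : Osc} (h : (r.isB || s.isB) = true) :
    comm η k n r s = comm₀ k r s * qnum η n ^ 2 / n := by
  rcases r with _ | _ | _ | _ | _ <;> rcases s with _ | _ | _ | _ | _ <;>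
    simp_all [comm, comm₀, Osc.isB, neg_div]

section bilinear
variable (η k : ℂ) (L L' M : Lin) (n : ℤ)

@[simp] lemma contraction_add_left :
    contraction η k (L + L') M n = contraction η k L M n + contraction η k L' M n := by
  simp [contraction, add_mul, Finset.sum_add_distrib]
@[simp] lemma contraction_add_right :
    contraction η k M (L + L') n = contraction η k M L n + contraction η k M L' n := by
  simp [contraction, mul_add, Finset.sum_add_distrib]
@[simp] lemma contraction_neg_left : contraction η k (-L) M n = -contraction η k L M n := by
  simp [contraction]
@[simp] lemma contraction_neg_right : contraction η k M (-L) n = -contraction η k M L n := by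
  simp [contraction]
@[simp] lemma contraction_sub_left :
    contraction η k (L - L') M n = contraction η k L M n - contraction η k L' M n := by
  simp [contraction, sub_mul, Finset.sum_sub_distrib]
@[simp] lemma contraction_sub_right :
    contraction η k M (L - L') n = contraction η k M L n - contraction η k M L' n := by
  simp [contraction, mul_sub, Finset.sum_sub_distrib]

end bilinear

lemma contraction_eq_single {η k : ℂ} {L M : Lin} {n : ℤ} (r s : Osc)
    (hL : ∀ r', r' ≠ r → L.osc r' n = 0) (hM : ∀ s', s' ≠ s → M.osc s' (-n) = 0) :
    contraction η k L M n = L.osc r n * comm η k n r s * M.osc s (-n) := by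
  rw [contraction, Finset.sum_eq_single s, Finset.sum_eq_single r]
  · intro r' _ h; rw [hL r' h]; ring
  · simp
  · intro s' _ h; exact Finset.sum_eq_zero fun r' _ => by rw [hM s' h]; ring
  · simp

section elementary
variable {η k : ℂ} (r s : Osc) (κ κ' ω ζ : ℂ) {n : ℕ}

lemma fld_osc (s : Osc) (n : ℤ) : (fld η r κ ω).osc s n = if s = r then
    if n = 0 then ω else -(qpow η (-κ * (|n| : ℤ)) * exp (-n * ω) / qnum η n) else 0 := rfl
lemma plus_osc (s : Osc) (n : ℤ) : (plus η r ω).osc s n = if s = r then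
    if n = 0 then η else if 0 < n then (qpow η 1 - qpow η (-1)) * exp (-n * ω) else 0 else 0 := rfl
lemma minus_osc (s : Osc) (n : ℤ) : (minus η r ω).osc s n = if s = r then
    if n = 0 then -η else if n < 0 then -((qpow η 1 - qpow η (-1)) * exp (-n * ω)) else 0
    else 0 := rfl
lemma starFld_osc (i : Fin 2) (s : Osc) (n : ℤ) : (starFld η k i κ ω).osc s n =
    (if n = 0 then 1 / (k + 1) else qnum η n / qnum η ((k + 1) * n)) *
      (fld η (.a i) κ ω).osc s n := rfl

lemma fld_osc_of_ne {n : ℤ} {r s : Osc} (h : s ≠ r) : (fld η r κ ω).osc s n = 0 := if_neg h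
lemma plus_osc_of_ne {n : ℤ} {r s : Osc} (h : s ≠ r) : (plus η r ω).osc s n = 0 := if_neg h
lemma minus_osc_of_ne {n : ℤ} {r s : Osc} (h : s ≠ r) : (minus η r ω).osc s n = 0 := if_neg h
lemma starFld_osc_of_ne {n : ℤ} {i : Fin 2} {s : Osc} (h : s ≠ .a i) :
    (starFld η k i κ ω).osc s n = 0 := by
  rw [starFld_osc, fld_osc_of_ne _ _ h, mul_zero]

lemma fld_osc_pos (hn : 0 < n) : (fld η r κ ω).osc r n =
    -(exp (n * (-ω - κ * η)) / qnum η n) := by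
  have : (n : ℤ) ≠ 0 := by omega
  rw [fld_osc, if_pos rfl, if_neg this, qpow, ← exp_add, Nat.abs_cast]
  push_cast
  ring_nf

lemma fld_osc_neg (hn : 0 < n) : (fld η r κ ω).osc r (-n) =
    exp (n * (ω - κ * η)) / qnum η n := by
  have : (-n : ℤ) ≠ 0 := by omega
  rw [fld_osc, if_pos rfl, if_neg this, qpow, ← exp_add, abs_neg, Nat.abs_cast]
  push_cast
  rw [qnum_neg, div_neg, neg_neg]
  ring_nf

lemma plus_osc_pos (hn : 0 < n) :
    (plus η r ω).osc r n = (qpow η 1 - qpow η (-1)) * exp (n * -ω) := by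
  have : (n : ℤ) ≠ 0 := by omega
  rw [plus_osc, if_pos rfl, if_neg this, if_pos (by omega)]
  push_cast
  ring_nf

lemma plus_osc_neg (hn : 0 < n) : (plus η r ω).osc s (-n) = 0 := by
  have : (-n : ℤ) ≠ 0 := by omega
  rw [plus_osc, if_neg this, if_neg (show ¬(0 : ℤ) < -n by omega), ite_self]

lemma minus_osc_neg (hn : 0 < n) :
    (minus η r ω).osc r (-n) = -((qpow η 1 - qpow η (-1)) * exp (n * ω)) := by
  have : (-n : ℤ) ≠ 0 := by omega
  rw [minus_osc, if_pos rfl, if_neg this, if_pos (by omega)]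
  push_cast
  ring_nf

lemma minus_osc_pos (hn : 0 < n) : (minus η r ω).osc s n = 0 := by
  have : (n : ℤ) ≠ 0 := by omega
  rw [minus_osc, if_neg this, if_neg (show ¬(n : ℤ) < 0 by omega), ite_self]

@[simp] lemma contraction_minus_left (M : Lin) (hn : 0 < n) :
    contraction η k (minus η r ω) M n = 0 := by
  simp [contraction, minus_osc_pos _ _ _ hn]

@[simp] lemma contraction_plus_right (M : Lin) (hn : 0 < n) :
    contraction η k M (plus η r ω) n = 0 := by
  simp [contraction, plus_osc_neg _ _ _ hn]

@[simp] lemma contraction_phase_left (ε : ℂ) (T : Finset Osc) (M : Lin) (hn : 0 < n) :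
    contraction η k (phase ε T) M n = 0 := by
  simp [contraction, phase, hn.ne']

@[simp] lemma contraction_phase_right (ε : ℂ) (T : Finset Osc) (M : Lin) (hn : 0 < n) :
    contraction η k M (phase ε T) n = 0 := by
  simp [contraction, phase, hn.ne']

lemma comm_a_of_isB {n : ℤ} {r : Osc} (i : Fin 2) (h : r.isB = true) :
    comm η k n (.a i) r = 0 ∧ comm η k n r (.a i) = 0 := by
  rcases r with _ | _ | _ | _ | _ <;> simp_all [comm, Osc.isB]

@[simp] lemma contraction_star_fld (i : Fin 2) (h : r.isB = true) :
    contraction η k (starFld η k i κ ω) (fld η r κ' ζ) n = 0 := by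
  rw [contraction_eq_single (.a i) r (fun _ => starFld_osc_of_ne _ _)
    (fun _ => fld_osc_of_ne _ _), (comm_a_of_isB i h).1]
  ring

@[simp] lemma contraction_fld_star (i : Fin 2) (h : r.isB = true) :
    contraction η k (fld η r κ' ζ) (starFld η k i κ ω) n = 0 := by
  rw [contraction_eq_single r (.a i) (fun _ => fld_osc_of_ne _ _)
    (fun _ => starFld_osc_of_ne _ _), (comm_a_of_isB i h).2]
  ring

@[simp] lemma contraction_star_minus_of_isB (i : Fin 2) (h : r.isB = true) :
    contraction η k (starFld η k i κ ω) (minus η r ζ) n = 0 := by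
  rw [contraction_eq_single (.a i) r (fun _ => starFld_osc_of_ne _ _)
    (fun _ => minus_osc_of_ne _), (comm_a_of_isB i h).1]
  ring

@[simp] lemma contraction_plus_star_of_isB (i : Fin 2) (h : r.isB = true) :
    contraction η k (plus η r ζ) (starFld η k i κ ω) n = 0 := by
  rw [contraction_eq_single r (.a i) (fun _ => plus_osc_of_ne _)
    (fun _ => starFld_osc_of_ne _ _), (comm_a_of_isB i h).2]
  ring

variable [Generic η k]

lemma starFld_osc_pos (i : Fin 2) (hn : 0 < n) : (starFld η k i κ ω).osc (.a i) n =
    -(exp (n * (-ω - κ * η)) / qnum η ((k + 1) * n)) := by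
  have h0 : (n : ℤ) ≠ 0 := by omega
  have h1 : qnum η n ≠ 0 := by exact_mod_cast Generic.qnum_ne (η := η) k n h0
  have h2 : qnum η ((k + 1) * n) ≠ 0 := by
    exact_mod_cast Generic.qnum_mul_ne (η := η) (k := k) n h0
  rw [starFld_osc, fld_osc_pos _ _ _ hn, if_neg h0]
  push_cast
  field_simp

lemma starFld_osc_neg (i : Fin 2) (hn : 0 < n) : (starFld η k i κ ω).osc (.a i) (-n) =
    exp (n * (ω - κ * η)) / qnum η ((k + 1) * n) := by
  have h0 : (n : ℤ) ≠ 0 := by omega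
  have h1 : qnum η n ≠ 0 := by exact_mod_cast Generic.qnum_ne (η := η) k n h0
  have h2 : qnum η ((k + 1) * n) ≠ 0 := by
    exact_mod_cast Generic.qnum_mul_ne (η := η) (k := k) n h0
  rw [starFld_osc, fld_osc_neg _ _ _ hn, if_neg (by omega)]
  push_cast
  rw [mul_neg, qnum_neg, qnum_neg]
  field_simp

/-- In the contractions of two fields the `q`-numbers cancel, and up to the factor `1 / n` a
combination of powers of exponentials remains. -/
@[simp] lemma mul_contraction_fld_fld (h : (r.isB || s.isB) = true) (hn : 0 < n) :
    n * contraction η k (fld η r κ ω) (fld η s κ' ζ) n =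
      -comm₀ k r s * exp (n * (ζ - ω - (κ + κ') * η)) := by
  have h0 : (n : ℤ) ≠ 0 := by omega
  have h1 : qnum η n ≠ 0 := by exact_mod_cast Generic.qnum_ne (η := η) k n h0
  have hn0 : (n : ℂ) ≠ 0 := by exact_mod_cast hn.ne'
  rw [contraction_eq_single r s (fun _ => fld_osc_of_ne _ _) (fun _ => fld_osc_of_ne _ _),
    comm_eq_of_isB h, fld_osc_pos _ _ _ hn, fld_osc_neg _ _ _ hn]
  have e : exp (n * (ζ - ω - (κ + κ') * η)) =
      exp (n * (-ω - κ * η)) * exp (n * (ζ - κ' * η)) := by rw [← exp_add]; ring_nf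
  rw [e]
  push_cast
  field_simp

@[simp] lemma mul_contraction_fld_minus (h : (r.isB || s.isB) = true) (hn : 0 < n) :
    n * contraction η k (fld η r κ ω) (minus η s ζ) n =
      comm₀ k r s * (exp (n * (ζ - ω - κ * η + η)) - exp (n * (ζ - ω - κ * η - η))) := by
  have h0 : (n : ℤ) ≠ 0 := by omega
  have h1 : qnum η n ≠ 0 := by exact_mod_cast Generic.qnum_ne (η := η) k n h0
  have hn0 : (n : ℂ) ≠ 0 := by exact_mod_cast hn.ne'
  rw [contraction_eq_single r s (fun _ => fld_osc_of_ne _ _) (fun _ => minus_osc_of_ne _),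
    comm_eq_of_isB h, fld_osc_pos _ _ _ hn, minus_osc_neg _ _ hn]
  have e : exp (n * (ζ - ω - κ * η + η)) - exp (n * (ζ - ω - κ * η - η)) =
      (qpow η 1 - qpow η (-1)) * qnum η n * (exp (n * (-ω - κ * η)) * exp (n * ζ)) := by
    rw [sub_mul_qnum η k, ← exp_add, sub_mul, ← exp_add, ← exp_add]; ring_nf
  rw [e]
  push_cast
  field_simp

@[simp] lemma mul_contraction_plus_fld (h : (r.isB || s.isB) = true) (hn : 0 < n) :
    n * contraction η k (plus η r ω) (fld η s κ ζ) n =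
      comm₀ k r s * (exp (n * (ζ - ω - κ * η + η)) - exp (n * (ζ - ω - κ * η - η))) := by
  have h0 : (n : ℤ) ≠ 0 := by omega
  have h1 : qnum η n ≠ 0 := by exact_mod_cast Generic.qnum_ne (η := η) k n h0
  have hn0 : (n : ℂ) ≠ 0 := by exact_mod_cast hn.ne'
  rw [contraction_eq_single r s (fun _ => plus_osc_of_ne _) (fun _ => fld_osc_of_ne _ _),
    comm_eq_of_isB h, plus_osc_pos _ _ hn, fld_osc_neg _ _ _ hn]
  have e : exp (n * (ζ - ω - κ * η + η)) - exp (n * (ζ - ω - κ * η - η)) =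
      (qpow η 1 - qpow η (-1)) * qnum η n * (exp (n * -ω) * exp (n * (ζ - κ * η))) := by
    rw [sub_mul_qnum η k, ← exp_add, sub_mul, ← exp_add, ← exp_add]; ring_nf
  rw [e]
  push_cast
  field_simp

@[simp] lemma mul_contraction_plus_minus (h : (r.isB || s.isB) = true) (hn : 0 < n) :
    n * contraction η k (plus η r ω) (minus η s ζ) n =
      -comm₀ k r s * (exp (n * (ζ - ω + 2 * η)) - 2 * exp (n * (ζ - ω)) +
        exp (n * (ζ - ω - 2 * η))) := by
  have hn0 : (n : ℂ) ≠ 0 := by exact_mod_cast hn.ne'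
  rw [contraction_eq_single r s (fun _ => plus_osc_of_ne _) (fun _ => minus_osc_of_ne _),
    comm_eq_of_isB h, plus_osc_pos _ _ hn, minus_osc_neg _ _ hn]
  have e : exp (n * (ζ - ω + 2 * η)) - 2 * exp (n * (ζ - ω)) + exp (n * (ζ - ω - 2 * η)) =
      ((qpow η 1 - qpow η (-1)) * qnum η n) ^ 2 * (exp (n * -ω) * exp (n * ζ)) := by
    have e1 : exp (n * (ζ - ω + 2 * η)) = exp (η * n) * exp (η * n) * exp (n * (ζ - ω)) := by
      rw [← exp_add, ← exp_add]; ring_nf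
    have e2 : exp (n * (ζ - ω - 2 * η)) =
        exp (-(η * n)) * exp (-(η * n)) * exp (n * (ζ - ω)) := by
      rw [← exp_add, ← exp_add]; ring_nf
    have e3 : exp (n * -ω) * exp (n * ζ) = exp (n * (ζ - ω)) := by
      rw [← exp_add]; ring_nf
    have e4 : exp (η * n) * exp (-(η * n)) = 1 := by rw [← exp_add, add_neg_cancel, exp_zero]
    rw [sub_mul_qnum η k, e1, e2, e3]
    linear_combination 2 * exp (n * (ζ - ω)) * e4
  rw [e]
  push_cast
  field_simp

@[simp] lemma mul_contraction_plus_star (i j : Fin 2) (hn : 0 < n) :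
    n * contraction η k (plus η (.a i) ω) (starFld η k j κ ζ) n =
      exp (n * (ζ - ω - κ * η + cartan i j * η)) - exp (n * (ζ - ω - κ * η - cartan i j * η)) := by
  have h0 : (n : ℤ) ≠ 0 := by omega
  have h1 : qnum η (n * (k + 1)) ≠ 0 := by
    rw [mul_comm]; exact_mod_cast Generic.qnum_mul_ne (η := η) (k := k) n h0
  have hn0 : (n : ℂ) ≠ 0 := by exact_mod_cast hn.ne'
  rw [contraction_eq_single (.a i) (.a j) (fun _ => plus_osc_of_ne _)
    (fun _ => starFld_osc_of_ne _ _), plus_osc_pos _ _ hn, starFld_osc_neg _ _ _ hn, comm]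
  have e : exp (n * (ζ - ω - κ * η + cartan i j * η)) -
        exp (n * (ζ - ω - κ * η - cartan i j * η)) =
      (qpow η 1 - qpow η (-1)) * qnum η (cartan i j * n) *
        (exp (n * -ω) * exp (n * (ζ - κ * η))) := by
    rw [sub_mul_qnum η k, ← exp_add, sub_mul, ← exp_add, ← exp_add]; ring_nf
  rw [e]
  push_cast
  field_simp

@[simp] lemma mul_contraction_star_minus (i j : Fin 2) (hn : 0 < n) :
    n * contraction η k (starFld η k i κ ω) (minus η (.a j) ζ) n =
      exp (n * (ζ - ω - κ * η + cartan i j * η)) - exp (n * (ζ - ω - κ * η - cartan i j * η)) := by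
  have h0 : (n : ℤ) ≠ 0 := by omega
  have h1 : qnum η (n * (k + 1)) ≠ 0 := by
    rw [mul_comm]; exact_mod_cast Generic.qnum_mul_ne (η := η) (k := k) n h0
  have hn0 : (n : ℂ) ≠ 0 := by exact_mod_cast hn.ne'
  rw [contraction_eq_single (.a i) (.a j) (fun _ => starFld_osc_of_ne _ _)
    (fun _ => minus_osc_of_ne _), minus_osc_neg _ _ hn, starFld_osc_pos _ _ _ hn, comm]
  have e : exp (n * (ζ - ω - κ * η + cartan i j * η)) -
        exp (n * (ζ - ω - κ * η - cartan i j * η)) =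
      (qpow η 1 - qpow η (-1)) * qnum η (cartan i j * n) *
        (exp (n * (-ω - κ * η)) * exp (n * ζ)) := by
    rw [sub_mul_qnum η k, ← exp_add, sub_mul, ← exp_add, ← exp_add]; ring_nf
  rw [e]
  push_cast
  field_simp

end elementary

/-! ### Zero modes of the elementary fields -/

section zeroModes
variable (η k κ ω ε : ℂ) (r s : Osc) (i : Fin 2) (T : Finset Osc) (L M : Lin) (χ χ' : Osc → ℂ)

@[simp] lemma chg_sub : (L - M).chg = L.chg - M.chg := rfl
@[simp] lemma chg_neg : (-L).chg = -L.chg := rfl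
@[simp] lemma chg_plus : (plus η r ω).chg = 0 := rfl
@[simp] lemma chg_minus : (minus η r ω).chg = 0 := rfl
@[simp] lemma chg_phase : (phase ε T).chg = 0 := rfl

@[simp] lemma zeroEig_sub : zeroEig k (χ - χ') r = zeroEig k χ r - zeroEig k χ' r := by
  simp [zeroEig, mul_sub, Finset.sum_sub_distrib]
@[simp] lemma zeroEig_neg : zeroEig k (-χ) r = -zeroEig k χ r := by simp [zeroEig]
@[simp] lemma zeroEig_fld : zeroEig k (fld η s κ ω).chg r = comm₀ k r s := by
  simp [zeroEig, fld]
@[simp] lemma zeroEig_starFld_a (j : Fin 2) [h : Generic η k] :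
    zeroEig k (starFld η k j κ ω).chg (.a i) = cartan i j := by
  have h1 : k + 1 ≠ 0 := Generic.level_ne η
  simp only [zeroEig, starFld, fld]
  rw [Finset.sum_eq_single (.a j)]
  · simp only [comm₀, if_true]
    field_simp
  · intro s _ hs; rw [if_neg hs, zero_div, mul_zero]
  · simp
@[simp] lemma zeroEig_starFld_of_isB (h : r.isB = true) :
    zeroEig k (starFld η k i κ ω).chg r = 0 := by
  refine Finset.sum_eq_zero fun s _ => ?_
  by_cases hs : s = .a i
  · subst hs
    rcases r with _ | _ | _ | _ | _ <;> simp_all [comm₀, Osc.isB]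
  · simp [starFld, fld, hs]

@[simp] lemma zeroPair_sub_left :
    zeroPair k (L - M) χ = zeroPair k L χ - zeroPair k M χ := by
  simp [zeroPair, sub_mul, Finset.sum_sub_distrib]
@[simp] lemma zeroPair_neg_left : zeroPair k (-L) χ = -zeroPair k L χ := by simp [zeroPair]
@[simp] lemma zeroPair_fld : zeroPair k (fld η r κ ω) χ = ω * zeroEig k χ r := by
  simp [zeroPair, fld]
@[simp] lemma zeroPair_plus : zeroPair k (plus η r ω) χ = η * zeroEig k χ r := by
  simp [zeroPair, plus]
@[simp] lemma zeroPair_minus : zeroPair k (minus η r ω) χ = -η * zeroEig k χ r := by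
  simp [zeroPair, minus]
@[simp] lemma zeroPair_starFld :
    zeroPair k (starFld η k i κ ω) χ = ω / (k + 1) * zeroEig k χ (.a i) := by
  simp only [zeroPair, starFld, fld]
  rw [Finset.sum_eq_single (.a i) (fun s _ hs => by rw [if_neg hs]; ring) (by simp)]
  simp
  left; ring
@[simp] lemma zeroPair_phase :
    zeroPair k (phase ε T) χ = ε * (I * Real.pi) * ∑ r ∈ T, zeroEig k χ r := by
  simp [zeroPair, phase, Finset.mul_sum]

@[simp] lemma chgPair_add_left : chgPair k (L + M) χ = chgPair k L χ + chgPair k M χ := by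
  simp [chgPair, add_mul, Finset.sum_add_distrib]
@[simp] lemma chgPair_sub_left : chgPair k (L - M) χ = chgPair k L χ - chgPair k M χ := by
  simp [chgPair, sub_mul, Finset.sum_sub_distrib]
@[simp] lemma chgPair_neg_left : chgPair k (-L) χ = -chgPair k L χ := by simp [chgPair]
@[simp] lemma chgPair_fld : chgPair k (fld η r κ ω) χ = zeroEig k χ r := by simp [chgPair, fld]
@[simp] lemma chgPair_plus : chgPair k (plus η r ω) χ = 0 := by simp [chgPair, plus]
@[simp] lemma chgPair_minus : chgPair k (minus η r ω) χ = 0 := by simp [chgPair, minus]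
@[simp] lemma chgPair_phase : chgPair k (phase ε T) χ = 0 := by simp [chgPair, phase]

end zeroModes

attribute [simp] chg_add zeroEig_add zeroPair_add_left

/-! ### The exponents of the currents -/

/-- The exponents of `X^{+,1}`, with `c(exp δ z; 0)`. -/
def xPlus1 (η δ ω : ℂ) : Lin := -fld η .b12 (-1) ω - fld η .c 0 (ω + δ) + phase 1 {.c, .b12}

/-- The exponent of the first term of `X^{+,2}`. -/
def xPlus2A (η ω : ℂ) : Lin := -plus η .b12 (ω + η) - plus η .b13 (ω + η) + fld η .b23 0 (ω + η)
  + phase 1 {.c, .b12, .b13, .b23}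

/-- The exponent of the second term of `X^{+,2}`. -/
def xPlus2B (η ω : ℂ) : Lin := fld η .b12 0 ω + fld η .b13 0 ω + fld η .c 0 ω

/-- The exponent of the first term of `X^{-,1}`. -/
def xMinus1A (η k ω : ℂ) : Lin :=
  plus η (.a 0) (ω + (k + 1) / 2 * η) + fld η .b12 1 (ω + (k + 2) * η)
    + plus η .b13 (ω + (k + 2) * η) - plus η .b23 (ω + (k + 1) * η)
    + fld η .c 0 (ω + (k + 1) * η) + phase (-1) {.c, .b12}

/-- The exponent of the second term of `X^{-,1}`. -/
def xMinus1B (η k ω : ℂ) : Lin :=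
  minus η (.a 0) (ω - (k + 1) / 2 * η) + fld η .b12 1 (ω - (k + 2) * η)
    + minus η .b13 (ω - (k + 2) * η) - minus η .b23 (ω - (k + 1) * η)
    + fld η .c 0 (ω - (k + 1) * η) + phase (-1) {.c, .b12}

/-- The exponent of the third term of `X^{-,1}`. -/
def xMinus1C (η k ω : ℂ) : Lin :=
  plus η (.a 0) (ω + (k + 1) / 2 * η) - fld η .b13 0 (ω + (k + 1) * η)
    + fld η .b23 (-1) (ω + (k + 1) * η) + phase 1 {.b13, .b23}

/-- The exponent of the first term of `X^{-,2}`. -/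
def xMinus2A (η k ω : ℂ) : Lin :=
  plus η (.a 1) (ω + (k + 1) / 2 * η) - fld η .b23 0 (ω + (k + 1) * η)
    + phase (-1) {.c, .b12, .b13, .b23}

/-- The exponent of the second term of `X^{-,2}`. -/
def xMinus2B (η k ω : ℂ) : Lin :=
  minus η (.a 1) (ω - (k + 1) / 2 * η) - fld η .b23 0 (ω - (k + 1) * η)
    + phase (-1) {.c, .b12, .b13, .b23}

/-- The exponents of the last two terms of `X^{-,2}`, with `c(exp (-δ) z; 0)`. -/
def xMinus2C (η k δ ω : ℂ) : Lin :=
  minus η (.a 1) (ω - (k + 1) / 2 * η) - fld η .b12 1 (ω - (k + 1) * η)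
    - fld η .b13 1 (ω - (k + 1) * η) - fld η .c 0 (ω - δ)

/-- The exponents of the first two terms of `S^1`, with `c(exp (-δ) z; 0)`. -/
def screen1 (η k δ ζ : ℂ) : Lin :=
  -starFld η k 0 ((k + 1) / 2) ζ - fld η .b12 0 ζ - minus η .b12 (ζ - η)
    - minus η .b13 (ζ - η) + minus η .b23 ζ - fld η .c 0 (ζ - δ) + phase 1 {.c, .b12}

/-- The exponent of the third term of `S^1`. -/
def screen1C (η k ζ : ℂ) : Lin :=
  -starFld η k 0 ((k + 1) / 2) ζ + fld η .b13 0 ζ - fld η .b23 0 (ζ + η)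
    + plus η .b23 ζ + phase (-1) {.b13, .b23}

/-- The exponent of `S^2`. -/
def screen2 (η k ζ : ℂ) : Lin :=
  -starFld η k 1 ((k + 1) / 2) ζ + fld η .b23 0 ζ + phase (-1) {.c, .b12, .b13, .b23}

/-! ### Operator product expansions -/

section expansions
variable {η k : ℂ} [Generic η k]

/-- Here and below, the exponent of the Drinfeld current stands at `w = 1`, that of the screen
current at `z = exp ζ`. The sign is `-1` for two odd currents, otherwise `1`. -/
lemma hasOPE_xPlus1_screen1 (δ δ' ζ : ℂ) :
    HasOPE η k 1 (xPlus1 η δ 0) (screen1 η k δ' ζ) 0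
      [(exp δ * (1 - exp (ζ - δ' - δ - (ζ - η))), ζ - η)] := by
  refine HasOPE.of_quotient (ζ - η) (ζ - δ' - δ) δ (η - δ')
    (fun n hn => ?_) (fun n hn => ?_) ?_ ?_ ?_ ?_
  · simp [xPlus1, screen1, mul_add, mul_sub, comm₀, hn]
  · simp [xPlus1, screen1, mul_add, mul_sub, comm₀, hn]
    ring_nf
  · simp [xPlus1, screen1, comm₀]
  · simp [xPlus1, screen1, comm₀, cartan]
  · simp [xPlus1, screen1, comm₀, cartan]
    ring_nf
  · rw [one_mul, ← exp_add]
    ring_nf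

lemma hasOPE_xPlus1_screen1C (δ ζ : ℂ) :
    HasOPE η k 1 (xPlus1 η δ 0) (screen1C η k ζ) 0 [] := by
  refine HasOPE.of_trivial 0 0 (fun n hn => ?_) (fun n hn => ?_) ?_ ?_ ?_ ?_
  · simp [xPlus1, screen1C, mul_add, mul_sub, comm₀, hn]
  · simp [xPlus1, screen1C, mul_add, mul_sub, comm₀, hn]
  · simp [xPlus1, screen1C, comm₀]
  · simp [xPlus1, screen1C, comm₀, cartan]
  · simp [xPlus1, screen1C, comm₀, cartan]
  · simp

lemma hasOPE_xPlus1_screen2 (δ ζ : ℂ) :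
    HasOPE η k 1 (xPlus1 η δ 0) (screen2 η k ζ) 0 [] := by
  refine HasOPE.of_trivial 0 0 (fun n hn => ?_) (fun n hn => ?_) ?_ ?_ ?_ ?_
  · simp [xPlus1, screen2, mul_add, mul_sub, comm₀, hn]
  · simp [xPlus1, screen2, mul_add, mul_sub, comm₀, hn]
  · simp [xPlus1, screen2, comm₀]
  · simp [xPlus1, screen2, comm₀, cartan]
  · simp [xPlus1, screen2, comm₀, cartan]
  · simp

lemma hasOPE_xPlus2A_screen1 (δ' ζ : ℂ) :
    HasOPE η k 1 (xPlus2A η 0) (screen1 η k δ' ζ) 0 [] := by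
  refine HasOPE.of_trivial (-η) (-η) (fun n hn => ?_) (fun n hn => ?_) ?_ ?_ ?_ ?_
  · simp [xPlus2A, screen1, mul_add, mul_sub, comm₀, hn]
    ring_nf
  · simp [xPlus2A, screen1, mul_sub, comm₀, hn]
  · simp [xPlus2A, screen1, comm₀]
  · simp [xPlus2A, screen1, comm₀, cartan]
  · simp [xPlus2A, screen1, comm₀, cartan]
  · simp [exp_neg]

lemma hasOPE_xPlus2A_screen1C (ζ : ℂ) :
    HasOPE η k 1 (xPlus2A η 0) (screen1C η k ζ) (-1)
      [(exp (-2 * η), ζ - 2 * η)] := by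
  refine HasOPE.of_pole (ζ - 2 * η) (-2 * η) (-ζ - Real.pi * I)
    (fun n hn => ?_) (fun n hn => ?_) ?_ ?_ ?_ ?_
  · simp [xPlus2A, screen1C, mul_add, mul_sub, comm₀, hn]
    ring_nf
  · simp [xPlus2A, screen1C, mul_add, mul_sub, comm₀, hn]
    ring_nf
  · simp [xPlus2A, screen1C, comm₀]
  · simp [xPlus2A, screen1C, comm₀, cartan]
    ring_nf
  · simp [xPlus2A, screen1C, comm₀, cartan]
    ring_nf
  · simp [exp_sub, exp_neg]
    field_simp

lemma hasOPE_xPlus2A_screen2 (ζ : ℂ) :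
    HasOPE η k (-1) (xPlus2A η 0) (screen2 η k ζ) 1 [] := by
  refine HasOPE.of_zero (ζ - η) (η + Real.pi * I) (ζ - Real.pi * I)
    (fun n hn => ?_) (fun n hn => ?_) ?_ ?_ ?_ ?_
  · simp [xPlus2A, screen2, mul_add, mul_sub, comm₀, hn]
  · simp [xPlus2A, screen2, mul_sub, comm₀, hn]
  · simp [xPlus2A, screen2, comm₀]
  · simp [xPlus2A, screen2, comm₀, cartan]
    ring_nf
  · simp [xPlus2A, screen2, comm₀, cartan]
    ring_nf
  · simp [exp_add, exp_sub]
    field_simp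

lemma hasOPE_xPlus2B_screen1 (δ' ζ : ℂ) :
    HasOPE η k 1 (xPlus2B η 0) (screen1 η k δ' ζ) 0
      [(exp 0 * (1 - exp (ζ - (ζ - δ'))), ζ - δ')] := by
  refine HasOPE.of_quotient (ζ - δ') ζ 0 δ' (fun n hn => ?_) (fun n hn => ?_) ?_ ?_ ?_ ?_
  · simp [xPlus2B, screen1, mul_add, mul_sub, comm₀, hn]
    ring_nf
  · simp [xPlus2B, screen1, mul_add, mul_sub, comm₀, hn]
    ring_nf
  · simp [xPlus2B, screen1, comm₀]
  · simp [xPlus2B, screen1, comm₀]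
  · simp [xPlus2B, screen1, comm₀, cartan]
  · rw [one_mul, ← exp_add]
    ring_nf

lemma hasOPE_xPlus2B_screen1C (ζ : ℂ) :
    HasOPE η k 1 (xPlus2B η 0) (screen1C η k ζ) 1 [] := by
  refine HasOPE.of_zero ζ 0 (ζ - Real.pi * I) (fun n hn => ?_) (fun n hn => ?_) ?_ ?_ ?_ ?_
  · simp [xPlus2B, screen1C, mul_add, mul_sub, comm₀, hn]
  · simp [xPlus2B, screen1C, mul_add, mul_sub, comm₀, hn]
  · simp [xPlus2B, screen1C, comm₀]
  · simp [xPlus2B, screen1C, comm₀]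
  · simp [xPlus2B, screen1C, comm₀, cartan]
    ring_nf
  · simp [exp_sub]
    field_simp

lemma hasOPE_xPlus2B_screen2 (ζ : ℂ) :
    HasOPE η k (-1) (xPlus2B η 0) (screen2 η k ζ) 0 [] := by
  refine HasOPE.of_trivial 0 (-(Real.pi * I)) (fun n hn => ?_) (fun n hn => ?_) ?_ ?_ ?_ ?_
  · simp [xPlus2B, screen2, mul_add, comm₀, hn]
  · simp [xPlus2B, screen2, mul_add, comm₀, hn]
  · simp [xPlus2B, screen2, comm₀]
  · simp [xPlus2B, screen2, comm₀]
  · simp [xPlus2B, screen2, comm₀, cartan]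
    ring_nf
  · simp [exp_neg]

lemma hasOPE_xMinus1A_screen1 (δ' ζ : ℂ) :
    HasOPE η k 1 (xMinus1A η k 0) (screen1 η k δ' ζ) 0
      [(exp (-η) * (1 - exp (ζ - (k + 1) * η - (ζ - (k + 1) * η - δ'))),
        ζ - (k + 1) * η - δ')] := by
  refine HasOPE.of_quotient (ζ - (k + 1) * η - δ') (ζ - (k + 1) * η) (-η) (δ' - η)
    (fun n hn => ?_) (fun n hn => ?_) ?_ ?_ ?_ ?_
  · simp [xMinus1A, screen1, mul_add, mul_sub, comm₀, cartan, hn]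
    ring_nf
  · simp [xMinus1A, screen1, mul_add, mul_sub, comm₀, hn]
    ring_nf
  · simp [xMinus1A, screen1, comm₀]
  · simp [xMinus1A, screen1, comm₀, cartan]
    ring_nf
  · simp [xMinus1A, screen1, comm₀, cartan]
  · rw [one_mul, ← exp_add]
    ring_nf

lemma hasOPE_xMinus1A_screen1C (ζ : ℂ) :
    HasOPE η k 1 (xMinus1A η k 0) (screen1C η k ζ) 0 [] := by
  refine HasOPE.of_trivial 0 0 (fun n hn => ?_) (fun n hn => ?_) ?_ ?_ ?_ ?_
  · simp [xMinus1A, screen1C, mul_add, mul_sub, comm₀, cartan, hn]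
    ring_nf
  · simp [xMinus1A, screen1C, mul_add, mul_sub, comm₀, hn]
  · simp [xMinus1A, screen1C, comm₀]
  · simp [xMinus1A, screen1C, comm₀, cartan]
    ring_nf
  · simp [xMinus1A, screen1C, comm₀, cartan]
  · simp

lemma hasOPE_xMinus1A_screen2 (ζ : ℂ) :
    HasOPE η k 1 (xMinus1A η k 0) (screen2 η k ζ) 0 [] := by
  refine HasOPE.of_trivial 0 0 (fun n hn => ?_) (fun n hn => ?_) ?_ ?_ ?_ ?_
  · simp [xMinus1A, screen2, mul_add, mul_sub, comm₀, cartan, hn]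
    ring_nf
  · simp [xMinus1A, screen2, mul_add, mul_sub, comm₀, hn]
  · simp [xMinus1A, screen2, comm₀]
  · simp [xMinus1A, screen2, comm₀, cartan]
  · simp [xMinus1A, screen2, comm₀, cartan]
  · simp

lemma hasOPE_xMinus1B_screen1 (δ' ζ : ℂ) :
    HasOPE η k 1 (xMinus1B η k 0) (screen1 η k δ' ζ) 0
      [(exp η * (1 - exp (ζ + (k - 1) * η - (ζ + (k + 1) * η - δ'))), ζ + (k + 1) * η - δ')] := by
  refine HasOPE.of_quotient (ζ + (k + 1) * η - δ') (ζ + (k - 1) * η) η (δ' - η)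
    (fun n hn => ?_) (fun n hn => ?_) ?_ ?_ ?_ ?_
  · simp [xMinus1B, screen1, mul_add, mul_sub, comm₀, hn]
    ring_nf
  · simp [xMinus1B, screen1, mul_add, mul_sub, comm₀, cartan, hn]
    ring_nf
  · simp [xMinus1B, screen1, comm₀]
  · simp [xMinus1B, screen1, comm₀, cartan]
    ring_nf
  · simp [xMinus1B, screen1, comm₀, cartan]
  · rw [one_mul, ← exp_add]
    ring_nf

lemma hasOPE_xMinus1B_screen1C (ζ : ℂ) :
    HasOPE η k 1 (xMinus1B η k 0) (screen1C η k ζ) 0 [] := by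
  refine HasOPE.of_trivial 0 0 (fun n hn => ?_) (fun n hn => ?_) ?_ ?_ ?_ ?_
  · simp [xMinus1B, screen1C, mul_add, mul_sub, comm₀, hn]
  · simp [xMinus1B, screen1C, mul_add, mul_sub, comm₀, cartan, hn]
    ring_nf
  · simp [xMinus1B, screen1C, comm₀]
  · simp [xMinus1B, screen1C, comm₀, cartan]
    ring_nf
  · simp [xMinus1B, screen1C, comm₀, cartan]
  · simp

lemma hasOPE_xMinus1B_screen2 (ζ : ℂ) :
    HasOPE η k 1 (xMinus1B η k 0) (screen2 η k ζ) 0 [] := by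
  refine HasOPE.of_trivial 0 0 (fun n hn => ?_) (fun n hn => ?_) ?_ ?_ ?_ ?_
  · simp [xMinus1B, screen2, mul_add, mul_sub, comm₀, hn]
  · simp [xMinus1B, screen2, mul_add, mul_sub, comm₀, cartan, hn]
    ring_nf
  · simp [xMinus1B, screen2, comm₀]
  · simp [xMinus1B, screen2, comm₀, cartan]
  · simp [xMinus1B, screen2, comm₀, cartan]
  · simp

lemma hasOPE_xMinus1C_screen1 (δ' ζ : ℂ) :
    HasOPE η k 1 (xMinus1C η k 0) (screen1 η k δ' ζ) 0 [] := by
  refine HasOPE.of_trivial (-2 * η) (-2 * η) (fun n hn => ?_) (fun n hn => ?_) ?_ ?_ ?_ ?_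
  · simp [xMinus1C, screen1, mul_add, mul_sub, comm₀, cartan, hn]
    ring_nf
  · simp [xMinus1C, screen1, mul_add, mul_sub, comm₀, hn]
  · simp [xMinus1C, screen1, comm₀]
  · simp [xMinus1C, screen1, comm₀, cartan]
    ring_nf
  · simp [xMinus1C, screen1, comm₀, cartan]
    ring_nf
  · simp [exp_neg]

lemma hasOPE_xMinus1C_screen1C (ζ : ℂ)
    (h : exp (ζ - (k + 3) * η) ≠ exp (ζ - (k + 1) * η)) :
    HasOPE η k 1 (xMinus1C η k 0) (screen1C η k ζ) (-2)
    [(exp (-(2 * k + 4) * η) * (exp (ζ - (k + 3) * η) /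
        (exp (ζ - (k + 3) * η) - exp (ζ - (k + 1) * η))), ζ - (k + 3) * η),
     (-(exp (-(2 * k + 4) * η) * (exp (ζ - (k + 1) * η) /
        (exp (ζ - (k + 3) * η) - exp (ζ - (k + 1) * η)))), ζ - (k + 1) * η)] := by
  refine HasOPE.of_two_poles (ζ - (k + 3) * η) (ζ - (k + 1) * η) (-(2 * k + 4) * η) (-2 * ζ) h
    (fun n hn => ?_) (fun n hn => ?_) ?_ ?_ ?_ ?_
  · simp [xMinus1C, screen1C, mul_add, mul_sub, comm₀, cartan, hn]
    ring_nf
  · simp [xMinus1C, screen1C, mul_add, mul_sub, comm₀, hn]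
    ring_nf
  · simp [xMinus1C, screen1C, comm₀]
    ring_nf
  · simp [xMinus1C, screen1C, comm₀, cartan]
    ring_nf
  · simp [xMinus1C, screen1C, comm₀, cartan]
    ring_nf
  · rw [one_mul, ← exp_add]
    ring_nf

lemma hasOPE_xMinus1C_screen2 (ζ : ℂ) :
    HasOPE η k 1 (xMinus1C η k 0) (screen2 η k ζ) 1 [] := by
  refine HasOPE.of_zero (ζ - (k + 2) * η) ((k + 2) * η + Real.pi * I) ζ
    (fun n hn => ?_) (fun n hn => ?_) ?_ ?_ ?_ ?_
  · simp [xMinus1C, screen2, mul_add, mul_sub, comm₀, cartan, hn]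
    ring_nf
  · simp [xMinus1C, screen2, mul_add, mul_sub, comm₀, hn]
    ring_nf
  · simp [xMinus1C, screen2, comm₀]
  · simp [xMinus1C, screen2, comm₀, cartan]
    ring_nf
  · simp [xMinus1C, screen2, comm₀, cartan]
  · simp [exp_add, exp_sub]
    field_simp

lemma hasOPE_xMinus2A_screen1 (δ' ζ : ℂ) :
    HasOPE η k 1 (xMinus2A η k 0) (screen1 η k δ' ζ) 0 [] := by
  refine HasOPE.of_trivial η η (fun n hn => ?_) (fun n hn => ?_) ?_ ?_ ?_ ?_
  · simp [xMinus2A, screen1, mul_add, mul_sub, comm₀, cartan, hn]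
    ring_nf
  · simp [xMinus2A, screen1, mul_add, mul_sub, comm₀, hn]
  · simp [xMinus2A, screen1, comm₀]
  · simp [xMinus2A, screen1, comm₀, cartan]
  · simp [xMinus2A, screen1, comm₀, cartan]
  · simp

lemma hasOPE_xMinus2A_screen1C (ζ : ℂ) :
    HasOPE η k 1 (xMinus2A η k 0) (screen1C η k ζ) 1 [] := by
  refine HasOPE.of_zero (ζ - (k + 2) * η) ((k + 2) * η) (ζ + Real.pi * I)
    (fun n hn => ?_) (fun n hn => ?_) ?_ ?_ ?_ ?_
  · simp [xMinus2A, screen1C, mul_add, mul_sub, comm₀, cartan, hn]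
    ring_nf
  · simp [xMinus2A, screen1C, mul_add, mul_sub, comm₀, hn]
    ring_nf
  · simp [xMinus2A, screen1C, comm₀]
  · simp [xMinus2A, screen1C, comm₀, cartan]
    ring_nf
  · simp [xMinus2A, screen1C, comm₀, cartan]
    ring_nf
  · simp [exp_add, exp_sub]
    field_simp

lemma hasOPE_xMinus2A_screen2 (ζ : ℂ) :
    HasOPE η k (-1) (xMinus2A η k 0) (screen2 η k ζ) (-1)
      [(exp (-(k + 1) * η - Real.pi * I), ζ - (k + 1) * η)] := by
  refine HasOPE.of_pole (ζ - (k + 1) * η) (-(k + 1) * η - Real.pi * I) (-ζ + Real.pi * I)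
    (fun n hn => ?_) (fun n hn => ?_) ?_ ?_ ?_ ?_
  · simp [xMinus2A, screen2, mul_add, mul_sub, comm₀, cartan, hn]
  · simp [xMinus2A, screen2, mul_sub, comm₀, hn]
  · simp [xMinus2A, screen2, comm₀]
  · simp [xMinus2A, screen2, comm₀, cartan]
    ring_nf
  · simp [xMinus2A, screen2, comm₀, cartan]
    ring_nf
  · rw [show -ζ + Real.pi * I = (-(k + 1) * η - Real.pi * I) + -(ζ - (k + 1) * η) + Real.pi * I +
      Real.pi * I by ring, exp_add, exp_add, exp_add, exp_pi_mul_I]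
    ring

lemma hasOPE_xMinus2B_screen1 (δ' ζ : ℂ) :
    HasOPE η k 1 (xMinus2B η k 0) (screen1 η k δ' ζ) 0
      [(exp (-η) * (1 - exp (ζ + (k + 2) * η - (ζ + k * η))), ζ + k * η)] := by
  refine HasOPE.of_quotient (ζ + k * η) (ζ + (k + 2) * η) (-η) η
    (fun n hn => ?_) (fun n hn => ?_) ?_ ?_ ?_ ?_
  · simp [xMinus2B, screen1, mul_add, mul_sub, comm₀, hn]
    ring_nf
  · simp [xMinus2B, screen1, mul_add, mul_sub, comm₀, cartan, hn]
    ring_nf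
  · simp [xMinus2B, screen1, comm₀]
  · simp [xMinus2B, screen1, comm₀, cartan]
  · simp [xMinus2B, screen1, comm₀, cartan]
  · rw [one_mul, ← exp_add]
    ring_nf

lemma hasOPE_xMinus2B_screen1C (ζ : ℂ) :
    HasOPE η k 1 (xMinus2B η k 0) (screen1C η k ζ) 1 [] := by
  refine HasOPE.of_zero (ζ + (k + 2) * η) (-(k + 2) * η) (ζ + Real.pi * I)
    (fun n hn => ?_) (fun n hn => ?_) ?_ ?_ ?_ ?_
  · simp [xMinus2B, screen1C, mul_add, comm₀, hn]
    ring_nf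
  · simp [xMinus2B, screen1C, mul_add, mul_sub, comm₀, cartan, hn]
    ring_nf
  · simp [xMinus2B, screen1C, comm₀]
  · simp [xMinus2B, screen1C, comm₀, cartan]
    ring_nf
  · simp [xMinus2B, screen1C, comm₀, cartan]
    ring_nf
  · rw [show ζ + Real.pi * I = -(k + 2) * η + (ζ + (k + 2) * η) + Real.pi * I by ring, exp_add,
      exp_add, exp_pi_mul_I]
    ring

lemma hasOPE_xMinus2B_screen2 (ζ : ℂ) :
    HasOPE η k (-1) (xMinus2B η k 0) (screen2 η k ζ) (-1)
      [(exp ((k + 1) * η - Real.pi * I), ζ + (k + 1) * η)] := by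
  refine HasOPE.of_pole (ζ + (k + 1) * η) ((k + 1) * η - Real.pi * I) (-ζ + Real.pi * I)
    (fun n hn => ?_) (fun n hn => ?_) ?_ ?_ ?_ ?_
  · simp [xMinus2B, screen2, mul_add, comm₀, hn]
  · simp [xMinus2B, screen2, mul_add, mul_sub, comm₀, cartan, hn]
    ring_nf
  · simp [xMinus2B, screen2, comm₀]
  · simp [xMinus2B, screen2, comm₀, cartan]
    ring_nf
  · simp [xMinus2B, screen2, comm₀, cartan]
    ring_nf
  · simp [exp_add, exp_sub, exp_neg]
    field_simp

lemma hasOPE_xMinus2C_screen1 (δ δ' ζ : ℂ) :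
    HasOPE η k 1 (xMinus2C η k δ 0) (screen1 η k δ' ζ) 0
      [(exp (k * η - δ) * (1 - exp (ζ - δ' + δ - (ζ + k * η))), ζ + k * η)] := by
  refine HasOPE.of_quotient (ζ + k * η) (ζ - δ' + δ) (k * η - δ) (-δ')
    (fun n hn => ?_) (fun n hn => ?_) ?_ ?_ ?_ ?_
  · simp [xMinus2C, screen1, mul_add, mul_sub, comm₀, hn]
    ring_nf
  · simp [xMinus2C, screen1, mul_add, mul_sub, comm₀, cartan, hn]
    ring_nf
  · simp [xMinus2C, screen1, comm₀]
  · simp [xMinus2C, screen1, comm₀, cartan]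
    ring_nf
  · simp [xMinus2C, screen1, comm₀, cartan]
    ring_nf
  · rw [one_mul, ← exp_add]
    ring_nf

lemma hasOPE_xMinus2C_screen1C (δ ζ : ℂ) :
    HasOPE η k 1 (xMinus2C η k δ 0) (screen1C η k ζ) (-1)
      [(exp (k * η), ζ + k * η)] := by
  refine HasOPE.of_pole (ζ + k * η) (k * η) (-ζ + Real.pi * I)
    (fun n hn => ?_) (fun n hn => ?_) ?_ ?_ ?_ ?_
  · simp [xMinus2C, screen1C, mul_add, mul_sub, comm₀, hn]
    ring_nf
  · simp [xMinus2C, screen1C, mul_add, mul_sub, comm₀, cartan, hn]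
    ring_nf
  · simp [xMinus2C, screen1C, comm₀]
  · simp [xMinus2C, screen1C, comm₀, cartan]
    ring_nf
  · simp [xMinus2C, screen1C, comm₀, cartan]
    ring_nf
  · simp [exp_add, exp_neg]

lemma hasOPE_xMinus2C_screen2 (δ ζ : ℂ) :
    HasOPE η k (-1) (xMinus2C η k δ 0) (screen2 η k ζ) 0 [] := by
  refine HasOPE.of_trivial 0 (Real.pi * I) (fun n hn => ?_) (fun n hn => ?_) ?_ ?_ ?_ ?_
  · simp [xMinus2C, screen2, mul_add, mul_sub, comm₀, hn]
  · simp [xMinus2C, screen2, mul_add, mul_sub, comm₀, cartan, hn]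
  · simp [xMinus2C, screen2, comm₀]
  · simp [xMinus2C, screen2, comm₀, cartan]
  · simp [xMinus2C, screen2, comm₀, cartan]
    ring_nf
  · simp

end expansions

/-! ### Moving the exponents -/

section shift
variable (η k κ ω ζ ε : ℂ) (r : Osc) (T : Finset Osc) (L M : Lin)

lemma Lin.shift_add : (L + M).shift ω = L.shift ω + M.shift ω := by
  ext s n
  · simp only [Lin.shift, Lin.add_osc, Lin.add_chg]
    split_ifs <;> ring
  · rfl

lemma Lin.shift_neg : (-L).shift ω = -L.shift ω := by
  ext s n
  · simp only [Lin.shift, Lin.neg_osc, Lin.neg_chg]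
    split_ifs <;> ring
  · rfl

lemma Lin.shift_sub : (L - M).shift ω = L.shift ω - M.shift ω := by
  ext s n
  · simp only [Lin.shift, Lin.sub_osc, Lin.sub_chg]
    split_ifs <;> ring
  · rfl

lemma shift_fld : (fld η r κ ζ).shift ω = fld η r κ (ζ + ω) := by
  ext s n
  · simp only [Lin.shift, fld]
    split_ifs with h1 h2
    · simp
    · simp
    · rw [mul_add, exp_add]; ring
    · simp
  · rfl

lemma shift_plus : (plus η r ζ).shift ω = plus η r (ζ + ω) := by
  ext s n
  · simp only [Lin.shift, plus]
    split_ifs with h1 h2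
    · simp
    · simp
    · rw [mul_add, exp_add]; ring
    · simp
    · simp
  · rfl

lemma shift_minus : (minus η r ζ).shift ω = minus η r (ζ + ω) := by
  ext s n
  · simp only [Lin.shift, minus]
    split_ifs with h1 h2
    · simp
    · simp
    · rw [mul_add, exp_add]; ring
    · simp
    · simp
  · rfl

lemma shift_phase : (phase ε T).shift ω = phase ε T := by
  ext s n
  · simp only [Lin.shift, phase]
    split_ifs <;> simp_all
  · rfl

lemma shift_starFld (i : Fin 2) : (starFld η k i κ ζ).shift ω = starFld η k i κ (ζ + ω) := by
  rw [starFld, starFld, ← shift_fld η κ ω ζ]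
  ext s n
  · simp only [Lin.shift]
    split_ifs <;> ring
  · rfl

lemma shift_xPlus1 (δ : ℂ) : (xPlus1 η δ 0).shift ω = xPlus1 η δ ω := by
  simp only [xPlus1, Lin.shift_add, Lin.shift_neg, Lin.shift_sub, shift_fld, shift_phase]
  ring_nf

lemma shift_xPlus2A : (xPlus2A η 0).shift ω = xPlus2A η ω := by
  simp only [xPlus2A, Lin.shift_add, Lin.shift_neg, Lin.shift_sub, shift_fld, shift_plus,
    shift_phase]
  ring_nf

lemma shift_xPlus2B : (xPlus2B η 0).shift ω = xPlus2B η ω := by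
  simp only [xPlus2B, Lin.shift_add, shift_fld]
  ring_nf

lemma shift_xMinus1A : (xMinus1A η k 0).shift ω = xMinus1A η k ω := by
  simp only [xMinus1A, Lin.shift_add, Lin.shift_sub, shift_fld, shift_plus, shift_phase]
  ring_nf

lemma shift_xMinus1B : (xMinus1B η k 0).shift ω = xMinus1B η k ω := by
  simp only [xMinus1B, Lin.shift_add, Lin.shift_sub, shift_fld, shift_minus, shift_phase]
  ring_nf

lemma shift_xMinus1C : (xMinus1C η k 0).shift ω = xMinus1C η k ω := by
  simp only [xMinus1C, Lin.shift_add, Lin.shift_sub, shift_fld, shift_plus, shift_phase]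
  ring_nf

lemma shift_xMinus2A : (xMinus2A η k 0).shift ω = xMinus2A η k ω := by
  simp only [xMinus2A, Lin.shift_add, Lin.shift_sub, shift_fld, shift_plus, shift_phase]
  ring_nf

lemma shift_xMinus2B : (xMinus2B η k 0).shift ω = xMinus2B η k ω := by
  simp only [xMinus2B, Lin.shift_add, Lin.shift_sub, shift_fld, shift_minus, shift_phase]
  ring_nf

lemma shift_xMinus2C (δ : ℂ) : (xMinus2C η k δ 0).shift ω = xMinus2C η k δ ω := by
  simp only [xMinus2C, Lin.shift_sub, shift_fld, shift_minus]
  ring_nf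

end shift

/-! ### Coincidences of the exponents at the poles -/

instance : Zero Lin := ⟨⟨0, 0⟩⟩
instance : SMul ℕ Lin := ⟨fun n L => ⟨n • L.osc, n • L.chg⟩⟩
instance : SMul ℤ Lin := ⟨fun n L => ⟨n • L.osc, n • L.chg⟩⟩

instance : AddCommGroup Lin :=
  Function.Injective.addCommGroup (fun L : Lin => (L.osc, L.chg))
    (fun _ _ h => Lin.ext (congrArg Prod.fst h) (congrArg Prod.snd h)) rfl (fun _ _ => rfl)
    (fun _ => rfl) (fun _ _ => rfl) (fun _ _ => rfl) (fun _ _ => rfl)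

/-- Extensionality, with the zero modes, annihilation operators and creation operators apart. -/
lemma Lin.ext_signs {L M : Lin} (h0 : ∀ r, L.osc r 0 = M.osc r 0)
    (hpos : ∀ r (n : ℕ), 0 < n → L.osc r n = M.osc r n)
    (hneg : ∀ r (n : ℕ), 0 < n → L.osc r (-n) = M.osc r (-n))
    (hchg : L.chg = M.chg) : L = M := by
  refine Lin.ext (funext fun r => funext fun n => ?_) hchg
  rcases lt_trichotomy n 0 with h | rfl | h
  · obtain ⟨m, rfl⟩ : ∃ m : ℕ, n = -m := ⟨(-n).toNat, by omega⟩
    exact hneg r m (by omega)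
  · exact h0 r
  · obtain ⟨m, rfl⟩ : ∃ m : ℕ, n = m := ⟨n.toNat, by omega⟩
    exact hpos r m (by omega)

lemma starFld_osc_zero (η k : ℂ) (i : Fin 2) (s : Osc) (κ ω : ℂ) :
    (starFld η k i κ ω).osc s 0 = if s = .a i then ω / (k + 1) else 0 := by
  by_cases h : s = .a i <;> simp [starFld, fld, h, div_eq_inv_mul]

/-- Lemmas of this kind say that the products of two pairs of terms agree at a common pole of their
contraction factors. -/
lemma xPlus1_add_screen1 (η k ζ : ℂ) : xPlus1 η η (ζ - η) + screen1 η k (2 * η) ζ =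
    xPlus1 η (-η) (ζ - η) + screen1 η k 0 ζ := by
  simp only [xPlus1, screen1]
  rw [show ζ - η + η = ζ - 0 by ring, show ζ - η + -η = ζ - 2 * η by ring]
  abel

lemma xMinus2C_add_screen1 (η k ζ : ℂ) : xMinus2C η k (k * η) (ζ + k * η) + screen1 η k (2 * η) ζ =
    xMinus2C η k ((k + 2) * η) (ζ + k * η) + screen1 η k 0 ζ := by
  simp only [xMinus2C, screen1]
  rw [show ζ + k * η - k * η = ζ - 0 by ring, show ζ + k * η - (k + 2) * η = ζ - 2 * η by ring]
  abel

section fusionShift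
variable {η k : ℂ} [Generic η k]

lemma sub_mul_exp (k ω x : ℂ) [Generic η k] (h : qnum η x ≠ 0) :
    (qpow η 1 - qpow η (-1)) * exp ω =
      (exp (ω + η * x) - exp (ω - η * x)) / qnum η x := by
  rw [eq_div_iff h, mul_right_comm, sub_mul_qnum η k, sub_mul, ← exp_add, ← exp_add]
  ring_nf

/-- Multiplying by `r_+` moves the annihilation part of a field by `q ^ 2`. -/
lemma fld_add_plus (η k : ℂ) [Generic η k] (r : Osc) {κ κ' x x' y : ℂ} (hκ : κ' = κ + 1)
    (hx : x' = x + η) (hy : y = x + (κ + 1) * η) :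
    fld η r κ x + plus η r y = fld η r κ' x' := by
  subst hκ hx hy
  refine Lin.ext_signs (fun s => ?_) (fun s n hn => ?_) (fun s n hn => ?_) ?_
  · by_cases hs : s = r <;> simp [fld, plus, hs]
  · by_cases hs : s = r
    · subst hs
      have h1 : qnum η n ≠ 0 := by exact_mod_cast Generic.qnum_ne (η := η) k n (by omega)
      rw [Lin.add_osc, fld_osc_pos _ _ _ hn, plus_osc_pos _ _ hn, fld_osc_pos _ _ _ hn,
        sub_mul_exp k _ _ h1]
      ring_nf
    · simp [fld_osc_of_ne _ _ hs, plus_osc_of_ne _ hs]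
  · by_cases hs : s = r
    · subst hs
      rw [Lin.add_osc, fld_osc_neg _ _ _ hn, plus_osc_neg _ _ _ hn, fld_osc_neg _ _ _ hn]
      ring_nf
    · simp [fld_osc_of_ne _ _ hs, plus_osc_of_ne _ hs]
  · simp only [chg_add, chg_plus, add_zero]
    rfl

/-- Multiplying by `r_-` moves the creation part of a field by `q ^ (-2)`. -/
lemma fld_add_minus (η k : ℂ) [Generic η k] (r : Osc) {κ κ' x x' y : ℂ} (hκ : κ' = κ + 1)
    (hx : x' = x - η) (hy : y = x - (κ + 1) * η) :
    fld η r κ x + minus η r y = fld η r κ' x' := by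
  subst hκ hx hy
  refine Lin.ext_signs (fun s => ?_) (fun s n hn => ?_) (fun s n hn => ?_) ?_
  · by_cases hs : s = r <;> simp [fld, minus, hs, sub_eq_add_neg]
  · by_cases hs : s = r
    · subst hs
      rw [Lin.add_osc, fld_osc_pos _ _ _ hn, minus_osc_pos _ _ _ hn, fld_osc_pos _ _ _ hn]
      ring_nf
    · simp [fld_osc_of_ne _ _ hs, minus_osc_of_ne _ hs]
  · by_cases hs : s = r
    · subst hs
      have h1 : qnum η n ≠ 0 := by exact_mod_cast Generic.qnum_ne (η := η) k n (by omega)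
      rw [Lin.add_osc, fld_osc_neg _ _ _ hn, minus_osc_neg _ _ hn, fld_osc_neg _ _ _ hn,
        sub_mul_exp k _ _ h1]
      ring_nf
    · simp [fld_osc_of_ne _ _ hs, minus_osc_of_ne _ hs]
  · simp only [chg_add, chg_minus, add_zero]
    rfl

/-- Multiplying by `a_+` moves the annihilation part of `a^*` by `q ^ (2 (k + 1))`. -/
lemma starFld_add_plus (i : Fin 2) {κ κ' x x' y : ℂ} (hκ : κ' = κ + (k + 1))
    (hx : x' = x + (k + 1) * η) (hy : y = x + (κ + (k + 1)) * η) :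
    starFld η k i κ x + plus η (.a i) y = starFld η k i κ' x' := by
  have hk : k + 1 ≠ 0 := Generic.level_ne η
  subst hκ hx hy
  refine Lin.ext_signs (fun s => ?_) (fun s n hn => ?_) (fun s n hn => ?_) ?_
  · by_cases hs : s = .a i
    · simp only [Lin.add_osc, starFld_osc_zero, plus_osc, hs, if_true]
      field_simp
    · simp [starFld_osc_of_ne _ _ hs, plus_osc_of_ne _ hs]
  · by_cases hs : s = .a i
    · subst hs
      have h1 : qnum η ((k + 1) * n) ≠ 0 := by
        exact_mod_cast Generic.qnum_mul_ne (η := η) (k := k) n (by omega)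
      rw [Lin.add_osc, starFld_osc_pos _ _ _ hn, plus_osc_pos _ _ hn, starFld_osc_pos _ _ _ hn,
        sub_mul_exp k _ _ h1]
      ring_nf
    · simp [starFld_osc_of_ne _ _ hs, plus_osc_of_ne _ hs]
  · by_cases hs : s = .a i
    · subst hs
      rw [Lin.add_osc, starFld_osc_neg _ _ _ hn, plus_osc_neg _ _ _ hn, starFld_osc_neg _ _ _ hn]
      ring_nf
    · simp [starFld_osc_of_ne _ _ hs, plus_osc_of_ne _ hs]
  · simp only [chg_add, chg_plus, add_zero]
    rfl

/-- Multiplying by `a_-` moves the creation part of `a^*` by `q ^ (-2 (k + 1))`. -/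
lemma starFld_add_minus (i : Fin 2) {κ κ' x x' y : ℂ} (hκ : κ' = κ + (k + 1))
    (hx : x' = x - (k + 1) * η) (hy : y = x - (κ + (k + 1)) * η) :
    starFld η k i κ x + minus η (.a i) y = starFld η k i κ' x' := by
  have hk : k + 1 ≠ 0 := Generic.level_ne η
  subst hκ hx hy
  refine Lin.ext_signs (fun s => ?_) (fun s n hn => ?_) (fun s n hn => ?_) ?_
  · by_cases hs : s = .a i
    · simp only [Lin.add_osc, starFld_osc_zero, minus_osc, hs, if_true]
      field_simp
      ring
    · simp [starFld_osc_of_ne _ _ hs, minus_osc_of_ne _ hs]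
  · by_cases hs : s = .a i
    · subst hs
      rw [Lin.add_osc, starFld_osc_pos _ _ _ hn, minus_osc_pos _ _ _ hn, starFld_osc_pos _ _ _ hn]
      ring_nf
    · simp [starFld_osc_of_ne _ _ hs, minus_osc_of_ne _ hs]
  · by_cases hs : s = .a i
    · subst hs
      have h1 : qnum η ((k + 1) * n) ≠ 0 := by
        exact_mod_cast Generic.qnum_mul_ne (η := η) (k := k) n (by omega)
      rw [Lin.add_osc, starFld_osc_neg _ _ _ hn, minus_osc_neg _ _ hn, starFld_osc_neg _ _ _ hn,
        sub_mul_exp k _ _ h1]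
      ring_nf
    · simp [starFld_osc_of_ne _ _ hs, minus_osc_of_ne _ hs]
  · simp only [chg_add, chg_minus, add_zero]
    rfl

lemma phase_neg_one (T : Finset Osc) : phase (-1) T = -phase 1 T := by
  ext r n
  · simp only [phase, Lin.neg_osc]; split_ifs <;> simp
  · simp [phase]

lemma phase_union {ε : ℂ} {T T' : Finset Osc} (h : Disjoint T T') :
    phase ε (T ∪ T') = phase ε T + phase ε T' := by
  ext r n
  · have := @Finset.disjoint_left _ T T'
    by_cases h1 : r ∈ T <;> by_cases h2 : r ∈ T' <;> simp_all [phase]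
  · simp [phase]

lemma phase_all (ε : ℂ) :
    phase ε {.c, .b12, .b13, .b23} = phase ε {.c, .b12} + phase ε {.b13, .b23} :=
  phase_union (T := {.c, .b12}) (T' := {.b13, .b23}) (by decide)

/-- The exponent `-a^{*,i}(z; -(k+1)/2)`, for `i = 1` with a phase that is trivial on integral
charges and that comes from the two factors `τ⁻¹` of `X^{-,2}` and `S^2`. The
commutators of the modes of `X^{-,i}` with `S^i` are total differences of its vertex operators. -/
def boundaryExp (η k : ℂ) (i : Fin 2) (ζ : ℂ) : Lin :=
  -starFld η k i (-((k + 1) / 2)) ζ +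
    if i = 0 then 0 else phase (-1) {.c, .b12, .b13, .b23} + phase (-1) {.c, .b12, .b13, .b23}

section fusion
variable (ζ δ : ℂ)

lemma xPlus2A_add_screen1C : xPlus2A η (ζ - 2 * η) + screen1C η k ζ =
    xPlus2B η (ζ - 2 * η) + screen1 η k (2 * η) ζ := by
  have e1 := fld_add_plus η k .b12 (κ := 0) (κ' := 1) (x := ζ - 2 * η) (x' := ζ - η) (y := ζ - η)
    (by ring) (by ring) (by ring)
  have e2 := fld_add_minus η k .b12 (κ := 0) (κ' := 1) (x := ζ) (x' := ζ - η) (y := ζ - η)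
    (by ring) (by ring) (by ring)
  have e3 := fld_add_plus η k .b13 (κ := 0) (κ' := 1) (x := ζ - 2 * η) (x' := ζ - η) (y := ζ - η)
    (by ring) (by ring) (by ring)
  have e4 := fld_add_minus η k .b13 (κ := 0) (κ' := 1) (x := ζ) (x' := ζ - η) (y := ζ - η)
    (by ring) (by ring) (by ring)
  have e5 := fld_add_plus η k .b23 (κ := -1) (κ' := 0) (x := ζ) (x' := ζ + η) (y := ζ)
    (by ring) (by ring) (by ring)
  have e6 := fld_add_minus η k .b23 (κ := -1) (κ' := 0) (x := ζ) (x' := ζ - η) (y := ζ)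
    (by ring) (by ring) (by ring)
  simp only [xPlus2A, xPlus2B, screen1, screen1C, phase_all, phase_neg_one]
  rw [show ζ - 2 * η + η = ζ - η by ring]
  linear_combination (norm := abel) e2 - e1 + e4 - e3 + e5 - e6

lemma xMinus1A_add_screen1 : xMinus1A η k (ζ - (k + 3) * η) + screen1 η k (2 * η) ζ =
    xMinus1C η k (ζ - (k + 3) * η) + screen1C η k ζ := by
  have e2 := fld_add_minus η k .b12 (κ := 0) (κ' := 1) (x := ζ) (x' := ζ - η) (y := ζ - η)
    (by ring) (by ring) (by ring)
  have e3 := fld_add_plus η k .b13 (κ := 0) (κ' := 1) (x := ζ - 2 * η) (x' := ζ - η) (y := ζ - η)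
    (by ring) (by ring) (by ring)
  have e4 := fld_add_minus η k .b13 (κ := 0) (κ' := 1) (x := ζ) (x' := ζ - η) (y := ζ - η)
    (by ring) (by ring) (by ring)
  have e5 := fld_add_plus η k .b23 (κ := -1) (κ' := 0) (x := ζ) (x' := ζ + η) (y := ζ)
    (by ring) (by ring) (by ring)
  have e6 := fld_add_minus η k .b23 (κ := -1) (κ' := 0) (x := ζ) (x' := ζ - η) (y := ζ)
    (by ring) (by ring) (by ring)
  have e7 := fld_add_plus η k .b23 (κ := -1) (κ' := 0) (x := ζ - 2 * η) (x' := ζ - η)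
    (y := ζ - 2 * η) (by ring) (by ring) (by ring)
  simp only [xMinus1A, xMinus1C, screen1, screen1C, phase_neg_one]
  rw [show ζ - (k + 3) * η + (k + 2) * η = ζ - η by ring,
    show ζ - (k + 3) * η + (k + 1) * η = ζ - 2 * η by ring]
  linear_combination (norm := abel) e3 - e2 - e4 - e5 + e6 - e7

lemma xMinus1B_add_screen1 : xMinus1B η k (ζ + (k + 1) * η) + screen1 η k 0 ζ =
    boundaryExp η k 0 (ζ + (k + 1) * η) := by
  have e1 := starFld_add_minus (η := η) (k := k) 0 (κ := -((k + 1) / 2)) (κ' := (k + 1) / 2)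
    (x := ζ + (k + 1) * η) (x' := ζ) (y := ζ + (k + 1) / 2 * η) (by ring) (by ring) (by ring)
  have e2 := fld_add_minus η k .b12 (κ := 0) (κ' := 1) (x := ζ) (x' := ζ - η) (y := ζ - η)
    (by ring) (by ring) (by ring)
  simp only [xMinus1B, screen1, boundaryExp, phase_neg_one, if_true]
  rw [show ζ + (k + 1) * η - (k + 2) * η = ζ - η by ring,
    show ζ + (k + 1) * η - (k + 1) * η = ζ by ring,
    show ζ + (k + 1) * η - (k + 1) / 2 * η = ζ + (k + 1) / 2 * η by ring, sub_zero]
  linear_combination (norm := abel) e1 - e2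

lemma xMinus1C_add_screen1C : xMinus1C η k (ζ - (k + 1) * η) + screen1C η k ζ =
    boundaryExp η k 0 (ζ - (k + 1) * η) := by
  have e1 := starFld_add_plus (η := η) (k := k) 0 (κ := -((k + 1) / 2)) (κ' := (k + 1) / 2)
    (x := ζ - (k + 1) * η) (x' := ζ) (y := ζ - (k + 1) / 2 * η) (by ring) (by ring) (by ring)
  have e5 := fld_add_plus η k .b23 (κ := -1) (κ' := 0) (x := ζ) (x' := ζ + η) (y := ζ)
    (by ring) (by ring) (by ring)
  simp only [xMinus1C, screen1C, boundaryExp, phase_neg_one, if_true]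
  rw [show ζ - (k + 1) * η + (k + 1) * η = ζ by ring,
    show ζ - (k + 1) * η + (k + 1) / 2 * η = ζ - (k + 1) / 2 * η by ring]
  linear_combination (norm := abel) e1 + e5

lemma xMinus2B_add_screen1 : xMinus2B η k (ζ + k * η) + screen1 η k δ ζ =
    xMinus2C η k (k * η + δ) (ζ + k * η) + screen1C η k ζ := by
  have e2 := fld_add_minus η k .b12 (κ := 0) (κ' := 1) (x := ζ) (x' := ζ - η) (y := ζ - η)
    (by ring) (by ring) (by ring)
  have e4 := fld_add_minus η k .b13 (κ := 0) (κ' := 1) (x := ζ) (x' := ζ - η) (y := ζ - η)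
    (by ring) (by ring) (by ring)
  have e5 := fld_add_plus η k .b23 (κ := -1) (κ' := 0) (x := ζ) (x' := ζ + η) (y := ζ)
    (by ring) (by ring) (by ring)
  have e6 := fld_add_minus η k .b23 (κ := -1) (κ' := 0) (x := ζ) (x' := ζ - η) (y := ζ)
    (by ring) (by ring) (by ring)
  simp only [xMinus2B, xMinus2C, screen1, screen1C, phase_all, phase_neg_one]
  rw [show ζ + k * η - (k + 1) * η = ζ - η by ring,
    show ζ + k * η - (k * η + δ) = ζ - δ by ring]
  linear_combination (norm := abel) e6 - e2 - e4 - e5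

lemma xMinus2A_add_screen2 : xMinus2A η k (ζ - (k + 1) * η) + screen2 η k ζ =
    boundaryExp η k 1 (ζ - (k + 1) * η) := by
  have e1 := starFld_add_plus (η := η) (k := k) 1 (κ := -((k + 1) / 2)) (κ' := (k + 1) / 2)
    (x := ζ - (k + 1) * η) (x' := ζ) (y := ζ - (k + 1) / 2 * η) (by ring) (by ring) (by ring)
  simp only [xMinus2A, screen2, boundaryExp, one_ne_zero, if_false]
  rw [show ζ - (k + 1) * η + (k + 1) * η = ζ by ring,
    show ζ - (k + 1) * η + (k + 1) / 2 * η = ζ - (k + 1) / 2 * η by ring]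
  linear_combination (norm := abel) e1

lemma xMinus2B_add_screen2 : xMinus2B η k (ζ + (k + 1) * η) + screen2 η k ζ =
    boundaryExp η k 1 (ζ + (k + 1) * η) := by
  have e1 := starFld_add_minus (η := η) (k := k) 1 (κ := -((k + 1) / 2)) (κ' := (k + 1) / 2)
    (x := ζ + (k + 1) * η) (x' := ζ) (y := ζ + (k + 1) / 2 * η) (by ring) (by ring) (by ring)
  simp only [xMinus2B, screen2, boundaryExp, one_ne_zero, if_false]
  rw [show ζ + (k + 1) * η - (k + 1) * η = ζ by ring,
    show ζ + (k + 1) * η - (k + 1) / 2 * η = ζ + (k + 1) / 2 * η by ring]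
  linear_combination (norm := abel) e1

end fusion

end fusionShift

/-! ### Modes of currents -/

/-- The charges on which the currents are single-valued: the exponents of `z` that their zero modes
produce are integers. -/
def IntegralCharge (k : ℂ) (χ : Osc → ℂ) : Prop :=
  (∃ n : ℤ, zeroEig k χ .b12 + zeroEig k χ .c = n) ∧ (∃ n : ℤ, zeroEig k χ .b13 = n) ∧
    ∃ n : ℤ, zeroEig k χ .b23 = n

lemma IntegralCharge.add {k : ℂ} {χ χ' : Osc → ℂ} (h : IntegralCharge k χ)
    (h' : IntegralCharge k χ') : IntegralCharge k (χ + χ') := by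
  obtain ⟨⟨a, ha⟩, ⟨b, hb⟩, ⟨c, hc⟩⟩ := h
  obtain ⟨⟨a', ha'⟩, ⟨b', hb'⟩, ⟨c', hc'⟩⟩ := h'
  refine ⟨⟨a + a', ?_⟩, ⟨b + b', ?_⟩, ⟨c + c', ?_⟩⟩ <;> simp only [zeroEig_add] <;> push_cast
  · linear_combination ha + ha'
  · linear_combination hb + hb'
  · linear_combination hc + hc'

/-- On integral charges, the mode `X_n` of the current is the operator `A`. Integrability is part of
the notion, because `mode` is a contour integral. -/
def IsMode (k : ℂ) (X : ℂ → FockOp) (n : ℤ) (A : FockOp) : Prop :=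
  ∀ out inn : FockState, IntegralCharge k inn.1 →
    IntervalIntegrable (fun θ : ℝ => exp ((n + 1) * (2 * Real.pi * I * θ)) *
      X (2 * Real.pi * I * θ) out inn) MeasureTheory.volume 0 1 ∧ mode X n out inn = A out inn

section IsMode
variable {k : ℂ} {X Y : ℂ → FockOp} {n : ℤ} {A B : FockOp}

lemma IsMode.add (hX : IsMode k X n A) (hY : IsMode k Y n B) :
    IsMode k (fun ω => X ω + Y ω) n (A + B) := by
  intro out inn h
  obtain ⟨h1, h2⟩ := hX out inn h
  obtain ⟨h3, h4⟩ := hY out inn h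
  have e : (fun θ : ℝ => exp ((n + 1) * (2 * Real.pi * I * θ)) *
      (X (2 * Real.pi * I * θ) + Y (2 * Real.pi * I * θ)) out inn) = fun θ : ℝ =>
      exp ((n + 1) * (2 * Real.pi * I * θ)) * X (2 * Real.pi * I * θ) out inn +
      exp ((n + 1) * (2 * Real.pi * I * θ)) * Y (2 * Real.pi * I * θ) out inn := by
    funext θ; simp only [Pi.add_apply, mul_add]
  refine ⟨by rw [e]; exact h1.add h3, ?_⟩
  rw [mode, e, intervalIntegral.integral_add h1 h3]
  exact congrArg₂ (· + ·) h2 h4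

lemma IsMode.smul (a : ℂ) (hX : IsMode k X n A) : IsMode k (fun ω => a • X ω) n (a • A) := by
  intro out inn h
  obtain ⟨h1, h2⟩ := hX out inn h
  have e : (fun θ : ℝ => exp ((n + 1) * (2 * Real.pi * I * θ)) *
      (a • X (2 * Real.pi * I * θ)) out inn) = fun θ : ℝ =>
      a * (exp ((n + 1) * (2 * Real.pi * I * θ)) * X (2 * Real.pi * I * θ) out inn) := by
    funext θ; simp only [Pi.smul_apply, smul_eq_mul]; ring
  refine ⟨by rw [e]; exact h1.const_mul a, ?_⟩
  rw [mode, e, intervalIntegral.integral_const_mul]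
  exact congrArg (a * ·) h2

lemma IsMode.neg (hX : IsMode k X n A) : IsMode k (fun ω => -X ω) n (-A) := by
  simpa using hX.smul (-1)

lemma IsMode.sub (hX : IsMode k X n A) (hY : IsMode k Y n B) :
    IsMode k (fun ω => X ω - Y ω) n (A - B) := by
  simpa [sub_eq_add_neg] using hX.add hY.neg

/-- The factor `1 / ((q - q⁻¹) z)` shifts the number of the mode. -/
lemma IsMode.diffFactor_smul (η : ℂ) (hX : IsMode k X (n - 1) A) :
    IsMode k (fun ω => diffFactor η ω • X ω) n ((qpow η 1 - qpow η (-1))⁻¹ • A) := by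
  intro out inn h
  obtain ⟨h1, h2⟩ := hX.smul (qpow η 1 - qpow η (-1))⁻¹ out inn h
  have e : (fun θ : ℝ => exp ((n + 1) * (2 * Real.pi * I * θ)) *
      (diffFactor η (2 * Real.pi * I * θ) • X (2 * Real.pi * I * θ)) out inn) = fun θ : ℝ =>
      exp (((n - 1 : ℤ) + 1) * (2 * Real.pi * I * θ)) *
        ((qpow η 1 - qpow η (-1))⁻¹ • X (2 * Real.pi * I * θ)) out inn := by
    funext θ
    have : exp ((n + 1) * (2 * Real.pi * I * θ)) =
        exp (((n - 1 : ℤ) + 1) * (2 * Real.pi * I * θ)) * exp (2 * Real.pi * I * θ) := by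
      rw [← exp_add]; push_cast; ring_nf
    simp only [Pi.smul_apply, smul_eq_mul]
    rw [this, diffFactor, one_div, mul_inv]
    field_simp [exp_ne_zero]
  refine ⟨by rw [e]; exact h1, ?_⟩
  rw [mode, e]
  exact h2

lemma integral_exp_int (N : ℤ) :
    ∫ θ in (0 : ℝ)..1, exp (2 * Real.pi * I * N * θ) = if N = 0 then 1 else 0 := by
  split_ifs with h
  · simp [h]
  · have h1 : 2 * Real.pi * I * N ≠ 0 := by
      simp [Real.pi_ne_zero, I_ne_zero, h]
    have h2 : exp (2 * Real.pi * I * N) = 1 := by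
      rw [mul_comm]; exact exp_int_mul_two_pi_mul_I N
    rw [integral_exp_mul_complex h1]
    simp [h2]

/-- The modes of a vertex operator select the powers of its argument. -/
lemma isMode_vertex (η : ℂ) {L : ℂ → Lin} {L₀ : Lin} (hL : ∀ ω, L₀.shift ω = L ω)
    (hint : ∀ χ, IntegralCharge k χ → ∃ ℓ : ℤ, chgPair k L₀ χ = ℓ) (n : ℤ) :
    IsMode k (fun ω => vertex η k (L ω)) n (vmode η k L₀ (n + 1)) := by
  intro out inn h
  obtain ⟨ℓ, hℓ⟩ := hint _ h
  have e : (fun θ : ℝ => exp ((n + 1) * (2 * Real.pi * I * θ)) *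
      vertex η k (L (2 * Real.pi * I * θ)) out inn) = fun θ : ℝ =>
      exp (2 * Real.pi * I * (n + 1 + (level out.2 - level inn.2 + ℓ) : ℤ) * θ) *
        vertex η k L₀ out inn := by
    funext θ
    rw [← hL, vertex_shift, hℓ, ← mul_assoc, ← exp_add]
    push_cast
    ring_nf
  refine ⟨?_, ?_⟩
  · rw [e]
    exact Continuous.intervalIntegrable (by fun_prop) 0 1
  · rw [mode, e, intervalIntegral.integral_mul_const, integral_exp_int, vmode, hℓ]
    have : ((n + 1 : ℤ) : ℂ) + (level out.2 - level inn.2 + ℓ) = 0 ↔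
        n + 1 + (level out.2 - level inn.2 + ℓ) = 0 := by
      rw [← Int.cast_eq_zero (α := ℂ)]; push_cast; rfl
    simp only [this, ite_mul, one_mul, zero_mul]

end IsMode

/-! ### Commutators of operators -/

/-- The products `AB` and `BA` are defined on integral charges, and `AB - s BA = C`. -/
def HasComm (k s : ℂ) (A B C : FockOp) : Prop :=
  ∀ out inn : FockState, IntegralCharge k inn.1 →
    Summable (fun mid => A out mid * B mid inn) ∧ Summable (fun mid => B out mid * A mid inn) ∧
      opMul A B out inn - s * opMul B A out inn = C out inn

section HasComm
variable {k s : ℂ} {A A' B B' C C' : FockOp}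

lemma HasComm.add_left (h : HasComm k s A B C) (h' : HasComm k s A' B C') :
    HasComm k s (A + A') B (C + C') := by
  intro out inn hi
  obtain ⟨h1, h2, h3⟩ := h out inn hi
  obtain ⟨h1', h2', h3'⟩ := h' out inn hi
  simp only [opMul, Pi.add_apply, add_mul, mul_add] at *
  refine ⟨h1.add h1', h2.add h2', ?_⟩
  rw [h1.tsum_add h1', h2.tsum_add h2', ← h3, ← h3']
  ring

lemma HasComm.smul_left (a : ℂ) (h : HasComm k s A B C) : HasComm k s (a • A) B (a • C) := by
  intro out inn hi
  obtain ⟨h1, h2, h3⟩ := h out inn hi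
  simp only [opMul, Pi.smul_apply, smul_eq_mul, mul_assoc, mul_left_comm _ a] at *
  refine ⟨h1.mul_left a, h2.mul_left a, ?_⟩
  rw [tsum_mul_left, tsum_mul_left, ← h3]
  ring

lemma HasComm.neg_left (h : HasComm k s A B C) : HasComm k s (-A) B (-C) := by
  simpa using h.smul_left (-1)

lemma HasComm.sub_left (h : HasComm k s A B C) (h' : HasComm k s A' B C') :
    HasComm k s (A - A') B (C - C') := by
  simpa [sub_eq_add_neg] using h.add_left h'.neg_left

lemma HasComm.add_right (h : HasComm k s A B C) (h' : HasComm k s A B' C') :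
    HasComm k s A (B + B') (C + C') := by
  intro out inn hi
  obtain ⟨h1, h2, h3⟩ := h out inn hi
  obtain ⟨h1', h2', h3'⟩ := h' out inn hi
  simp only [opMul, Pi.add_apply, add_mul, mul_add] at *
  refine ⟨h1.add h1', h2.add h2', ?_⟩
  rw [h1.tsum_add h1', h2.tsum_add h2', ← h3, ← h3']
  ring

lemma HasComm.smul_right (a : ℂ) (h : HasComm k s A B C) : HasComm k s A (a • B) (a • C) := by
  intro out inn hi
  obtain ⟨h1, h2, h3⟩ := h out inn hi
  simp only [opMul, Pi.smul_apply, smul_eq_mul, mul_assoc, mul_left_comm _ a] at *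
  refine ⟨h1.mul_left a, h2.mul_left a, ?_⟩
  rw [tsum_mul_left, tsum_mul_left, ← h3]
  ring

lemma HasComm.neg_right (h : HasComm k s A B C) : HasComm k s A (-B) (-C) := by
  simpa using h.smul_right (-1)

lemma HasComm.sub_right (h : HasComm k s A B C) (h' : HasComm k s A B' C') :
    HasComm k s A (B - B') (C - C') := by
  simpa [sub_eq_add_neg] using h.add_right h'.neg_right

/-- `A` matters only on integral charges, if `B` preserves these. -/
lemma HasComm.congr_left (h : HasComm k s A B C)
    (hA : ∀ out inn : FockState, IntegralCharge k inn.1 → A' out inn = A out inn)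
    (hB : ∀ out inn : FockState, IntegralCharge k inn.1 → B out inn ≠ 0 →
      IntegralCharge k out.1) : HasComm k s A' B C := by
  intro out inn hi
  have e1 : (fun mid => A' out mid * B mid inn) = fun mid => A out mid * B mid inn := by
    funext mid
    by_cases h0 : B mid inn = 0
    · rw [h0, mul_zero, mul_zero]
    · rw [hA _ _ (hB _ _ hi h0)]
  have e2 : (fun mid => B out mid * A' mid inn) = fun mid => B out mid * A mid inn := by
    funext mid
    rw [hA _ _ hi]
  have := h out inn hi
  simpa only [opMul, e1, e2] using this

/-- The commutation relation of a mode of a vertex operator with a vertex operator. -/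
lemma HasOPE.hasComm {η : ℂ} {L M : Lin} {κ : ℤ} {poles : List (ℂ × ℂ)}
    (h : HasOPE η k s L M κ poles)
    (hint : ∀ χ, IntegralCharge k χ → ∃ ℓ : ℤ, chgPair k L χ = ℓ) (m : ℤ) :
    HasComm k s (vmode η k L m) (vertex η k M)
      (poles.map fun p => (p.1 * exp (p.2 * (m + κ))) • vertex η k (L.shift p.2 + M)).sum := by
  intro out inn hi
  obtain ⟨ℓ, hℓ⟩ := hint _ hi
  refine ⟨(hasSum_vmode_mul_vertex η k L M m (ℓ + κ) out inn ?_).summable,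
    (hasSum_vertex_mul_vmode η k L M m ℓ out inn hℓ).summable, ?_⟩
  · rw [chgPair_add_right, hℓ, h.chg]; push_cast; rfl
  · rw [h.commutator m out inn ⟨ℓ, hℓ⟩]
    have : ∀ l : List FockOp, l.sum out inn = (l.map fun A => A out inn).sum := by
      intro l
      induction l with
      | nil => rfl
      | cons A l ih => simp [ih]
    rw [this, List.map_map]
    rfl

end HasComm

/-! ### Modes of the Drinfeld currents -/

section integrality
variable {k : ℂ} {χ : Osc → ℂ} (η δ : ℂ)

lemma exists_chgPair_xPlus1 (h : IntegralCharge k χ) :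
    ∃ ℓ : ℤ, chgPair k (xPlus1 η δ 0) χ = ℓ := by
  obtain ⟨⟨a, ha⟩, -, -⟩ := h
  exact ⟨-a, by simp [xPlus1]; linear_combination -ha⟩

lemma exists_chgPair_xPlus2A (h : IntegralCharge k χ) :
    ∃ ℓ : ℤ, chgPair k (xPlus2A η 0) χ = ℓ := by
  obtain ⟨-, -, ⟨c, hc⟩⟩ := h
  exact ⟨c, by simp [xPlus2A, hc]⟩

lemma exists_chgPair_xPlus2B (h : IntegralCharge k χ) :
    ∃ ℓ : ℤ, chgPair k (xPlus2B η 0) χ = ℓ := by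
  obtain ⟨⟨a, ha⟩, ⟨b, hb⟩, -⟩ := h
  exact ⟨a + b, by simp [xPlus2B]; linear_combination ha + hb⟩

lemma exists_chgPair_xMinus1A (h : IntegralCharge k χ) :
    ∃ ℓ : ℤ, chgPair k (xMinus1A η k 0) χ = ℓ := by
  obtain ⟨⟨a, ha⟩, -, -⟩ := h
  exact ⟨a, by simp [xMinus1A]; linear_combination ha⟩

lemma exists_chgPair_xMinus1B (h : IntegralCharge k χ) :
    ∃ ℓ : ℤ, chgPair k (xMinus1B η k 0) χ = ℓ := by
  obtain ⟨⟨a, ha⟩, -, -⟩ := h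
  exact ⟨a, by simp [xMinus1B]; linear_combination ha⟩

lemma exists_chgPair_xMinus1C (h : IntegralCharge k χ) :
    ∃ ℓ : ℤ, chgPair k (xMinus1C η k 0) χ = ℓ := by
  obtain ⟨-, ⟨b, hb⟩, ⟨c, hc⟩⟩ := h
  exact ⟨c - b, by simp [xMinus1C]; linear_combination hc - hb⟩

lemma exists_chgPair_xMinus2A (h : IntegralCharge k χ) :
    ∃ ℓ : ℤ, chgPair k (xMinus2A η k 0) χ = ℓ := by
  obtain ⟨-, -, ⟨c, hc⟩⟩ := h
  exact ⟨-c, by simp [xMinus2A, hc]⟩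

lemma exists_chgPair_xMinus2B (h : IntegralCharge k χ) :
    ∃ ℓ : ℤ, chgPair k (xMinus2B η k 0) χ = ℓ := by
  obtain ⟨-, -, ⟨c, hc⟩⟩ := h
  exact ⟨-c, by simp [xMinus2B, hc]⟩

lemma exists_chgPair_xMinus2C (h : IntegralCharge k χ) :
    ∃ ℓ : ℤ, chgPair k (xMinus2C η k δ 0) χ = ℓ := by
  obtain ⟨⟨a, ha⟩, ⟨b, hb⟩, -⟩ := h
  exact ⟨-a - b, by simp [xMinus2C]; linear_combination -ha - hb⟩

end integrality

/-- The mode `X^{+,i}_n`. -/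
def xPlusMode (η k : ℂ) (i : Fin 2) (n : ℤ) : FockOp :=
  match i with
  | 0 => -((qpow η 1 - qpow η (-1))⁻¹ •
      (vmode η k (xPlus1 η η 0) n - vmode η k (xPlus1 η (-η) 0) n))
  | 1 => -vmode η k (xPlus2A η 0) (n + 1) + vmode η k (xPlus2B η 0) (n + 1)

/-- The mode `X^{-,i}_n`. -/
def xMinusMode (η k : ℂ) (i : Fin 2) (n : ℤ) : FockOp :=
  match i with
  | 0 => (qpow η 1 - qpow η (-1))⁻¹ •
        (vmode η k (xMinus1A η k 0) n - vmode η k (xMinus1B η k 0) n)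
      + qpow η (k + 1) • vmode η k (xMinus1C η k 0) (n + 1)
  | 1 => (qpow η 1 - qpow η (-1))⁻¹ •
      (qpow η 1 • (vmode η k (xMinus2A η k 0) n - vmode η k (xMinus2B η k 0) n)
        - (vmode η k (xMinus2C η k (k * η) 0) n - vmode η k (xMinus2C η k ((k + 2) * η) 0) n))

lemma isMode_xPlus (η k : ℂ) (i : Fin 2) (n : ℤ) :
    IsMode k (XPlus η k i) n (xPlusMode η k i n) := by
  have e : n = n - 1 + 1 := by ring
  fin_cases i
  · have h1 := isMode_vertex (k := k) η (fun ω => shift_xPlus1 η ω η)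
      (fun χ h => exists_chgPair_xPlus1 η η h) (n - 1)
    have h2 := isMode_vertex (k := k) η (fun ω => shift_xPlus1 η ω (-η))
      (fun χ h => exists_chgPair_xPlus1 η (-η) h) (n - 1)
    rw [← e] at h1 h2
    have h3 : XPlus η k 0 = fun ω => -(diffFactor η ω •
        (vertex η k (xPlus1 η η ω) - vertex η k (xPlus1 η (-η) ω))) := by
      funext ω
      simp only [XPlus, xPlus1, neg_smul, sub_eq_add_neg]
    exact h3 ▸ ((h1.sub h2).diffFactor_smul η).neg
  · have h1 := isMode_vertex (k := k) η (fun ω => shift_xPlus2A η ω)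
      (fun χ h => exists_chgPair_xPlus2A η h) n
    have h2 := isMode_vertex (k := k) η (fun ω => shift_xPlus2B η ω)
      (fun χ h => exists_chgPair_xPlus2B η h) n
    exact h1.neg.add h2

lemma isMode_xMinus (η k : ℂ) (i : Fin 2) (n : ℤ) :
    IsMode k (XMinus η k i) n (xMinusMode η k i n) := by
  have e : n = n - 1 + 1 := by ring
  fin_cases i
  · have h1 := isMode_vertex (k := k) η (fun ω => shift_xMinus1A η k ω)
      (fun χ h => exists_chgPair_xMinus1A η h) (n - 1)
    have h2 := isMode_vertex (k := k) η (fun ω => shift_xMinus1B η k ω)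
      (fun χ h => exists_chgPair_xMinus1B η h) (n - 1)
    have h3 := isMode_vertex (k := k) η (fun ω => shift_xMinus1C η k ω)
      (fun χ h => exists_chgPair_xMinus1C η h) n
    rw [← e] at h1 h2
    exact ((h1.sub h2).diffFactor_smul η).add (h3.smul _)
  · have h1 := isMode_vertex (k := k) η (fun ω => shift_xMinus2A η k ω)
      (fun χ h => exists_chgPair_xMinus2A η h) (n - 1)
    have h2 := isMode_vertex (k := k) η (fun ω => shift_xMinus2B η k ω)
      (fun χ h => exists_chgPair_xMinus2B η h) (n - 1)
    have h3 := isMode_vertex (k := k) η (fun ω => shift_xMinus2C η k ω (k * η))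
      (fun χ h => exists_chgPair_xMinus2C η (k * η) h) (n - 1)
    have h4 := isMode_vertex (k := k) η (fun ω => shift_xMinus2C η k ω ((k + 2) * η))
      (fun χ h => exists_chgPair_xMinus2C η ((k + 2) * η) h) (n - 1)
    rw [← e] at h1 h2 h3 h4
    exact (((h1.sub h2).smul _).sub (h3.sub h4)).diffFactor_smul η

section drinfeld
variable {η k : ℂ}

lemma screen_zero (ζ : ℂ) : screen η k 0 ζ = diffFactor η ζ •
    (vertex η k (screen1 η k 0 ζ) - vertex η k (screen1 η k (2 * η) ζ)) +
      qpow η 1 • vertex η k (screen1C η k ζ) := by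
  simp only [screen, screen1, screen1C, sub_zero]

lemma screen_one (ζ : ℂ) : screen η k 1 ζ = -qpow η (-1) • vertex η k (screen2 η k ζ) := rfl

/-- The screen currents preserve the integrality of the charges. -/
lemma integralCharge_of_screen (i : Fin 2) (ζ : ℂ) (out inn : FockState)
    (hi : IntegralCharge k inn.1) (h : screen η k i ζ out inn ≠ 0) : IntegralCharge k out.1 := by
  have key : ∀ L : Lin, IntegralCharge k L.chg → vertex η k L out inn ≠ 0 →
      IntegralCharge k out.1 := by
    intro L hL h0
    rw [vertex_apply] at h0
    have : out.1 = inn.1 + L.chg := by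
      by_contra h1; rw [if_neg h1] at h0; exact h0 rfl
    exact this ▸ hi.add hL
  contrapose! h
  fin_cases i
  · have e1 : ∀ δ, vertex η k (screen1 η k δ ζ) out inn = 0 := fun δ => by
      contrapose! h
      refine key _ ⟨⟨0, ?_⟩, ⟨0, ?_⟩, ⟨0, ?_⟩⟩ h <;> simp [screen1, comm₀]
    have e2 : vertex η k (screen1C η k ζ) out inn = 0 := by
      contrapose! h
      refine key _ ⟨⟨0, ?_⟩, ⟨1, ?_⟩, ⟨-1, ?_⟩⟩ h <;> simp [screen1C, comm₀]
    show screen η k 0 ζ out inn = 0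
    rw [screen_zero]
    simp [e1, e2]
  · have e1 : vertex η k (screen2 η k ζ) out inn = 0 := by
      contrapose! h
      refine key _ ⟨⟨0, ?_⟩, ⟨0, ?_⟩, ⟨1, ?_⟩⟩ h <;> simp [screen2, comm₀]
    show screen η k 1 ζ out inn = 0
    rw [screen_one]
    simp [e1]

/-- The mode of a current may be replaced by its explicit form in a commutator with a screen
current, since the latter preserves the integrality of the charges. -/
lemma hasComm_mode {s : ℂ} {i : Fin 2} {ζ : ℂ} {X : ℂ → FockOp} {n : ℤ} {A C C' : FockOp}
    (hX : IsMode k X n A) (h : HasComm k s A (screen η k i ζ) C') (hC : C' = C) :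
    HasComm k s (mode X n) (screen η k i ζ) C :=
  hC ▸ h.congr_left (fun out inn hi => (hX out inn hi).2) (integralCharge_of_screen i ζ)

end drinfeld

/-! ### Commutators of the Drinfeld currents with the screen currents -/

section commutators
variable {η k : ℂ} [Generic η k] (n : ℤ) (ζ : ℂ)

/-- The vertex operator of `boundaryExp` at `z`, times `z ^ n`. -/
def boundaryOp (η k : ℂ) (i : Fin 2) (n : ℤ) (ζ : ℂ) : FockOp :=
  exp (n * ζ) • vertex η k (boundaryExp η k i ζ)

lemma diffFactor_eq (η ζ : ℂ) :
    diffFactor η ζ = (qpow η 1 - qpow η (-1))⁻¹ * exp (-ζ) := by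
  rw [diffFactor, one_div, mul_inv, exp_neg]

/-- The residues at `q⁻¹ z` of the pairs of terms with `c(q z)`, `c(z)` and with `c(q⁻¹ z)`,
`c(q⁻² z)` vanish; the two others cancel. -/
lemma hasComm_xPlus_zero_screen_zero :
    HasComm k 1 (mode (XPlus η k 0) n) (screen η k 0 ζ) 0 := by
  have key := fun δ δ' => (hasOPE_xPlus1_screen1 (η := η) (k := k) δ δ' ζ).hasComm
    (fun χ h => exists_chgPair_xPlus1 η δ h) n
  have key' := fun δ => (hasOPE_xPlus1_screen1C (η := η) (k := k) δ ζ).hasComm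
    (fun χ h => exists_chgPair_xPlus1 η δ h) n
  simp only [shift_xPlus1, List.map_cons, List.map_nil, List.sum_cons, List.sum_nil] at key key'
  have h := fun δ => (((key δ 0).sub_right (key δ (2 * η))).smul_right (diffFactor η ζ)).add_right
    ((key' δ).smul_right (qpow η 1))
  simp only [← screen_zero] at h
  refine hasComm_mode (isMode_xPlus η k 0 n)
    ((((h η).sub_left (h (-η))).smul_left (qpow η 1 - qpow η (-1))⁻¹).neg_left) ?_
  rw [xPlus1_add_screen1]
  have e1 : exp (ζ - 0 - η - (ζ - η)) = 1 := by ring_nf; exact exp_zero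
  have e2 : exp (ζ - 2 * η - -η - (ζ - η)) = 1 := by ring_nf; exact exp_zero
  have e3 : exp (-η) * (1 - exp (ζ - 0 - -η - (ζ - η))) =
      -(exp η * (1 - exp (ζ - 2 * η - η - (ζ - η)))) := by
    simp only [mul_sub, ← exp_add]
    ring_nf
  rw [e1, e2, e3]
  simp

lemma hasComm_xPlus_zero_screen_one :
    HasComm k 1 (mode (XPlus η k 0) n) (screen η k 1 ζ) 0 := by
  have h := fun δ => ((hasOPE_xPlus1_screen2 (η := η) (k := k) δ ζ).hasComm
    (fun χ h => exists_chgPair_xPlus1 η δ h) n).smul_right (-qpow η (-1))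
  simp only [← screen_one] at h
  refine hasComm_mode (isMode_xPlus η k 0 n)
    ((((h η).sub_left (h (-η))).smul_left (qpow η 1 - qpow η (-1))⁻¹).neg_left) ?_
  simp

/-- The first term of `X^{+,2}` with the third term of `S^1` and the second term of `X^{+,2}` with
the second term of `S^1` both have a pole at `q⁻² z`, and their residues cancel. -/
lemma hasComm_xPlus_one_screen_zero :
    HasComm k 1 (mode (XPlus η k 1) n) (screen η k 0 ζ) 0 := by
  have hA := fun δ' => (hasOPE_xPlus2A_screen1 (η := η) (k := k) δ' ζ).hasComm
    (fun χ h => exists_chgPair_xPlus2A η h) (n + 1)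
  have hA' := (hasOPE_xPlus2A_screen1C (η := η) (k := k) ζ).hasComm
    (fun χ h => exists_chgPair_xPlus2A η h) (n + 1)
  have hB := fun δ' => (hasOPE_xPlus2B_screen1 (η := η) (k := k) δ' ζ).hasComm
    (fun χ h => exists_chgPair_xPlus2B η h) (n + 1)
  have hB' := (hasOPE_xPlus2B_screen1C (η := η) (k := k) ζ).hasComm
    (fun χ h => exists_chgPair_xPlus2B η h) (n + 1)
  simp only [shift_xPlus2A, shift_xPlus2B, List.map_cons, List.map_nil, List.sum_cons,
    List.sum_nil] at hA hA' hB hB'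
  have h1 := (((hA 0).sub_right (hA (2 * η))).smul_right (diffFactor η ζ)).add_right
    (hA'.smul_right (qpow η 1))
  have h2 := (((hB 0).sub_right (hB (2 * η))).smul_right (diffFactor η ζ)).add_right
    (hB'.smul_right (qpow η 1))
  rw [← screen_zero] at h1 h2
  refine hasComm_mode (isMode_xPlus η k 1 n) (h1.neg_left.add_left h2) ?_
  rw [xPlus2A_add_screen1C]
  have e1 : exp (ζ - (ζ - 0)) = 1 := by ring_nf; exact exp_zero
  rw [e1]
  have hq := qpow_sub_ne η k
  have e2 : qpow η 1 * (exp (-2 * η) * exp ((ζ - 2 * η) * ((n + 1 : ℤ) + (-1 : ℤ)))) =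
      -(diffFactor η ζ * (exp 0 * (1 - exp (ζ - (ζ - 2 * η))) *
        exp ((ζ - 2 * η) * ((n + 1 : ℤ) + (0 : ℤ))))) := by
    rw [diffFactor]
    field_simp
    simp only [qpow, mul_sub, sub_mul, ← exp_add, neg_sub]
    push_cast
    rw [exp_zero]
    ring_nf
  ext out inn
  simp only [← mul_smul, smul_sub, smul_add, e2]
  simp

lemma hasComm_xPlus_one_screen_one :
    HasComm k (-1) (mode (XPlus η k 1) n) (screen η k 1 ζ) 0 := by
  have hA := ((hasOPE_xPlus2A_screen2 (η := η) (k := k) ζ).hasComm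
    (fun χ h => exists_chgPair_xPlus2A η h) (n + 1)).smul_right (-qpow η (-1))
  have hB := ((hasOPE_xPlus2B_screen2 (η := η) (k := k) ζ).hasComm
    (fun χ h => exists_chgPair_xPlus2B η h) (n + 1)).smul_right (-qpow η (-1))
  rw [← screen_one] at hA hB
  refine hasComm_mode (isMode_xPlus η k 1 n) (hA.neg_left.add_left hB) ?_
  simp

lemma hasComm_xMinus_zero_screen_one :
    HasComm k 1 (mode (XMinus η k 0) n) (screen η k 1 ζ) 0 := by
  have hA := ((hasOPE_xMinus1A_screen2 (η := η) (k := k) ζ).hasComm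
    (fun χ h => exists_chgPair_xMinus1A η h) n).smul_right (-qpow η (-1))
  have hB := ((hasOPE_xMinus1B_screen2 (η := η) (k := k) ζ).hasComm
    (fun χ h => exists_chgPair_xMinus1B η h) n).smul_right (-qpow η (-1))
  have hC := ((hasOPE_xMinus1C_screen2 (η := η) (k := k) ζ).hasComm
    (fun χ h => exists_chgPair_xMinus1C η h) (n + 1)).smul_right (-qpow η (-1))
  rw [← screen_one] at hA hB hC
  refine hasComm_mode (isMode_xMinus η k 0 n)
    (((hA.sub_left hB).smul_left _).add_left (hC.smul_left _)) ?_
  simp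

/-- All the poles lie at `q^k z`. The residues of the second term of `X^{-,2}` with the terms of
`S^1` that contain `c` cancel those of the last two terms of `X^{-,2}` with the third term of
`S^1`; the remaining residues vanish or cancel, as for `X^{+,1}` and `S^1`. -/
lemma hasComm_xMinus_one_screen_zero :
    HasComm k 1 (mode (XMinus η k 1) n) (screen η k 0 ζ) 0 := by
  have hA := fun δ' => (hasOPE_xMinus2A_screen1 (η := η) (k := k) δ' ζ).hasComm
    (fun χ h => exists_chgPair_xMinus2A η h) n
  have hA' := (hasOPE_xMinus2A_screen1C (η := η) (k := k) ζ).hasComm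
    (fun χ h => exists_chgPair_xMinus2A η h) n
  have hB := fun δ' => (hasOPE_xMinus2B_screen1 (η := η) (k := k) δ' ζ).hasComm
    (fun χ h => exists_chgPair_xMinus2B η h) n
  have hB' := (hasOPE_xMinus2B_screen1C (η := η) (k := k) ζ).hasComm
    (fun χ h => exists_chgPair_xMinus2B η h) n
  have hC := fun δ δ' => (hasOPE_xMinus2C_screen1 (η := η) (k := k) δ δ' ζ).hasComm
    (fun χ h => exists_chgPair_xMinus2C η δ h) n
  have hC' := fun δ => (hasOPE_xMinus2C_screen1C (η := η) (k := k) δ ζ).hasComm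
    (fun χ h => exists_chgPair_xMinus2C η δ h) n
  simp only [shift_xMinus2B, shift_xMinus2C, List.map_cons, List.map_nil, List.sum_cons,
    List.sum_nil] at hA hA' hB hB' hC hC'
  have h1 := (((hA 0).sub_right (hA (2 * η))).smul_right (diffFactor η ζ)).add_right
    (hA'.smul_right (qpow η 1))
  have h2 := (((hB 0).sub_right (hB (2 * η))).smul_right (diffFactor η ζ)).add_right
    (hB'.smul_right (qpow η 1))
  have h3 := fun δ => (((hC δ 0).sub_right (hC δ (2 * η))).smul_right (diffFactor η ζ)).add_right
    ((hC' δ).smul_right (qpow η 1))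
  simp only [← screen_zero] at h1 h2 h3
  refine hasComm_mode (isMode_xMinus η k 1 n)
    ((((h1.sub_left h2).smul_left _).sub_left
      ((h3 (k * η)).sub_left (h3 ((k + 2) * η)))).smul_left _) ?_
  rw [xMinus2B_add_screen1, xMinus2B_add_screen1, xMinus2C_add_screen1]
  rw [show k * η + 0 = k * η by ring, show k * η + 2 * η = (k + 2) * η by ring]
  have hq := qpow_sub_ne η k
  ext out inn
  simp only [Pi.smul_apply, Pi.sub_apply, Pi.add_apply, Pi.zero_apply, smul_eq_mul]
  have e0 : exp (ζ - 2 * η + (k + 2) * η - (ζ + k * η)) = 1 := by ring_nf; exact exp_zero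
  have e0' : exp (ζ - 0 + k * η - (ζ + k * η)) = 1 := by ring_nf; exact exp_zero
  have e1 : qpow η 1 * (diffFactor η ζ * (exp (-η) * (1 - exp (ζ + (k + 2) * η - (ζ + k * η))) *
      exp ((ζ + k * η) * (n + (0 : ℤ))))) =
      -(qpow η 1 * (exp (k * η) * exp ((ζ + k * η) * (n + (-1 : ℤ))))) := by
    rw [diffFactor]
    field_simp
    simp only [qpow, mul_sub, sub_mul, ← exp_add, neg_sub]
    push_cast
    ring_nf
    simp
  have e2 : exp (k * η - (k + 2) * η) * (1 - exp (ζ - 0 + (k + 2) * η - (ζ + k * η))) =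
      -(exp (k * η - k * η) * (1 - exp (ζ - 2 * η + k * η - (ζ + k * η)))) := by
    simp only [mul_sub, ← exp_add]
    ring_nf
  rw [e0, e0']
  generalize vertex η k (xMinus2C η k (k * η) (ζ + k * η) + screen1C η k ζ) out inn = V at *
  generalize vertex η k (xMinus2C η k ((k + 2) * η) (ζ + k * η) + screen1C η k ζ) out inn = V' at *
  linear_combination (qpow η 1 - qpow η (-1))⁻¹ * (-(V - V') * e1 + diffFactor η ζ *
    exp ((ζ + k * η) * (n + (0 : ℤ))) *
      vertex η k (xMinus2C η k ((k + 2) * η) (ζ + k * η) + screen1 η k 0 ζ) out inn * e2)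

/-- The residues at `q^{-(k+3)} z` cancel. Those at `q^{-(k+1)} z`, from the third terms of both
currents, and at `q^{k+1} z`, from the second term of `X^{-,1}` and the first of `S^1`, remain. -/
lemma hasComm_xMinus_zero_screen_zero :
    HasComm k 1 (mode (XMinus η k 0) n) (screen η k 0 ζ)
      (diffFactor η ζ • (boundaryOp η k 0 n (ζ - (k + 1) * η) -
        boundaryOp η k 0 n (ζ + (k + 1) * η))) := by
  have hq := qpow_sub_ne η k
  have hD : exp (ζ - (k + 3) * η) - exp (ζ - (k + 1) * η) =
      -(exp (ζ - (k + 2) * η) * (qpow η 1 - qpow η (-1))) := by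
    simp only [mul_sub, ← exp_add, qpow]
    ring_nf
  have hne : exp (ζ - (k + 3) * η) - exp (ζ - (k + 1) * η) ≠ 0 := by
    rw [hD]
    exact neg_ne_zero.2 (mul_ne_zero (exp_ne_zero _) hq)
  have hA := fun δ' => (hasOPE_xMinus1A_screen1 (η := η) (k := k) δ' ζ).hasComm
    (fun χ h => exists_chgPair_xMinus1A η h) n
  have hA' := (hasOPE_xMinus1A_screen1C (η := η) (k := k) ζ).hasComm
    (fun χ h => exists_chgPair_xMinus1A η h) n
  have hB := fun δ' => (hasOPE_xMinus1B_screen1 (η := η) (k := k) δ' ζ).hasComm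
    (fun χ h => exists_chgPair_xMinus1B η h) n
  have hB' := (hasOPE_xMinus1B_screen1C (η := η) (k := k) ζ).hasComm
    (fun χ h => exists_chgPair_xMinus1B η h) n
  have hC := fun δ' => (hasOPE_xMinus1C_screen1 (η := η) (k := k) δ' ζ).hasComm
    (fun χ h => exists_chgPair_xMinus1C η h) (n + 1)
  have hC' := (hasOPE_xMinus1C_screen1C (η := η) (k := k) ζ (sub_ne_zero.1 hne)).hasComm
    (fun χ h => exists_chgPair_xMinus1C η h) (n + 1)
  simp only [shift_xMinus1A, shift_xMinus1B, shift_xMinus1C, List.map_cons, List.map_nil,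
    List.sum_cons, List.sum_nil] at hA hA' hB hB' hC hC'
  have h1 := (((hA 0).sub_right (hA (2 * η))).smul_right (diffFactor η ζ)).add_right
    (hA'.smul_right (qpow η 1))
  have h2 := (((hB 0).sub_right (hB (2 * η))).smul_right (diffFactor η ζ)).add_right
    (hB'.smul_right (qpow η 1))
  have h3 := (((hC 0).sub_right (hC (2 * η))).smul_right (diffFactor η ζ)).add_right
    (hC'.smul_right (qpow η 1))
  simp only [← screen_zero] at h1 h2 h3
  refine hasComm_mode (isMode_xMinus η k 0 n)
    (((h1.sub_left h2).smul_left _).add_left (h3.smul_left _)) ?_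
  rw [xMinus1C_add_screen1C, show ζ - (k + 1) * η - 2 * η = ζ - (k + 3) * η by ring,
    xMinus1A_add_screen1, sub_zero, sub_zero, xMinus1B_add_screen1]
  ext out inn
  simp only [boundaryOp, Pi.smul_apply, Pi.sub_apply, Pi.add_apply, smul_eq_mul]
  have e0 : exp (ζ - (k + 1) * η - (ζ - (k + 1) * η)) = 1 := by rw [sub_self, exp_zero]
  have e0' : exp (ζ + (k - 1) * η - (ζ + (k + 1) * η - 2 * η)) = 1 := by ring_nf; exact exp_zero
  have e1 : exp (-η) * (1 - exp (ζ - (k + 1) * η - (ζ - (k + 3) * η))) =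
      -(qpow η 1 - qpow η (-1)) := by
    simp only [mul_sub, ← exp_add, qpow]
    ring_nf
  have e2 : exp η * (1 - exp (ζ + (k - 1) * η - (ζ + (k + 1) * η))) =
      qpow η 1 - qpow η (-1) := by
    simp only [mul_sub, ← exp_add, qpow]
    ring_nf
  have e3 : (exp (ζ - (k + 3) * η) - exp (ζ - (k + 1) * η))⁻¹ =
      -(diffFactor η ζ * exp ((k + 2) * η)) := by
    rw [hD, diffFactor]
    field_simp
    rw [← exp_add]
    ring_nf
  have e4 : qpow η (k + 1) * (qpow η 1 * (exp (-(2 * k + 4) * η) * exp ((k + 2) * η))) = 1 := by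
    simp only [qpow, ← exp_add]
    ring_nf
    simp
  have e5 : exp (ζ - (k + 3) * η) * exp ((ζ - (k + 3) * η) * ((n + 1 : ℤ) + (-2 : ℤ))) =
      exp ((ζ - (k + 3) * η) * (n + (0 : ℤ))) := by
    rw [← exp_add]; push_cast; ring_nf
  have e6 : exp (ζ - (k + 1) * η) * exp ((ζ - (k + 1) * η) * ((n + 1 : ℤ) + (-2 : ℤ))) =
      exp (n * (ζ - (k + 1) * η)) := by
    rw [← exp_add]; push_cast; ring_nf
  have e7 : exp ((ζ + (k + 1) * η) * (n + (0 : ℤ))) = exp (n * (ζ + (k + 1) * η)) := by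
    push_cast; ring_nf
  rw [e0, e0', e1, e2, div_eq_mul_inv, div_eq_mul_inv, e3, e7]
  have hc := inv_mul_cancel₀ hq
  have hz : (0 : FockOp) out inn = 0 := rfl
  generalize vertex η k (xMinus1C η k (ζ - (k + 3) * η) + screen1C η k ζ) out inn = V at *
  generalize vertex η k (boundaryExp η k 0 (ζ + (k + 1) * η)) out inn = V₁ at *
  generalize vertex η k (boundaryExp η k 0 (ζ - (k + 1) * η)) out inn = V₂ at *
  linear_combination diffFactor η ζ * (exp ((ζ - (k + 3) * η) * (n + (0 : ℤ))) * V -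
      exp (n * (ζ + (k + 1) * η)) * V₁) * hc +
    diffFactor η ζ * (exp (ζ - (k + 1) * η) * exp ((ζ - (k + 1) * η) * ((n + 1 : ℤ) + (-2 : ℤ))) *
      V₂ - exp (ζ - (k + 3) * η) * exp ((ζ - (k + 3) * η) * ((n + 1 : ℤ) + (-2 : ℤ))) * V) * e4 +
    diffFactor η ζ * (V₂ * e6 - V * e5) + qpow η 1 * qpow η (k + 1) * hz

/-- The two remaining residues come from the first two terms of `X^{-,2}`, at `q^{∓(k+1)} z`. -/
lemma hasComm_xMinus_one_screen_one :
    HasComm k (-1) (mode (XMinus η k 1) n) (screen η k 1 ζ)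
      (diffFactor η ζ • (boundaryOp η k 1 n (ζ - (k + 1) * η) -
        boundaryOp η k 1 n (ζ + (k + 1) * η))) := by
  have hA := (hasOPE_xMinus2A_screen2 (η := η) (k := k) ζ).hasComm
    (fun χ h => exists_chgPair_xMinus2A η h) n
  have hB := (hasOPE_xMinus2B_screen2 (η := η) (k := k) ζ).hasComm
    (fun χ h => exists_chgPair_xMinus2B η h) n
  have hC := fun δ => (hasOPE_xMinus2C_screen2 (η := η) (k := k) δ ζ).hasComm
    (fun χ h => exists_chgPair_xMinus2C η δ h) n
  simp only [shift_xMinus2A, shift_xMinus2B, List.map_cons, List.map_nil,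
    List.sum_cons, List.sum_nil] at hA hB hC
  have h1 := hA.smul_right (-qpow η (-1))
  have h2 := hB.smul_right (-qpow η (-1))
  have h3 := fun δ => (hC δ).smul_right (-qpow η (-1))
  simp only [← screen_one] at h1 h2 h3
  refine hasComm_mode (isMode_xMinus η k 1 n)
    ((((h1.sub_left h2).smul_left _).sub_left
      ((h3 (k * η)).sub_left (h3 ((k + 2) * η)))).smul_left _) ?_
  rw [xMinus2A_add_screen2, xMinus2B_add_screen2]
  ext out inn
  simp [boundaryOp]
  rw [diffFactor_eq]
  have e1 : qpow η 1 * (qpow η (-1) * (exp ((-1 + -k) * η) * exp ((ζ - (k + 1) * η) * (n + -1)))) =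
      exp (-ζ) * exp (n * (ζ - (k + 1) * η)) := by
    simp only [qpow, ← exp_add]
    ring_nf
  have e2 : qpow η 1 * (qpow η (-1) * (exp ((k + 1) * η) * exp ((ζ + (k + 1) * η) * (n + -1)))) =
      exp (-ζ) * exp (n * (ζ + (k + 1) * η)) := by
    simp only [qpow, ← exp_add]
    ring_nf
  linear_combination (qpow η 1 - qpow η (-1))⁻¹ *
    (vertex η k (boundaryExp η k 1 (ζ - (k + 1) * η)) out inn * e1 -
      vertex η k (boundaryExp η k 1 (ζ + (k + 1) * η)) out inn * e2)

end commutators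

/-! ### The Cartan generators -/

lemma pderiv_translate (β : CrIdx → ℂ) (x : CrIdx) (p : MvPolynomial CrIdx ℂ) :
    MvPolynomial.pderiv x (translate β p) = translate β (MvPolynomial.pderiv x p) := by
  classical
  induction p using MvPolynomial.induction_on with
  | C a => simp [translate, MvPolynomial.algebraMap_eq]
  | add p q hp hq => simp [hp, hq]
  | mul_X p y hp =>
    have : MvPolynomial.pderiv x (translate β (MvPolynomial.X y)) =
        translate β (MvPolynomial.pderiv x (MvPolynomial.X y)) := by
      rw [translate, MvPolynomial.aeval_X, map_add, MvPolynomial.pderiv_C, add_zero,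
        MvPolynomial.pderiv_X]
      by_cases h : x = y
      · subst h; simp
      · simp [h]
    rw [map_mul, Derivation.leibniz, hp, this, Derivation.leibniz, map_add]
    simp only [smul_eq_mul, map_mul]

/-- The commutator of the derivative `∂_x` with an exponential, in matrix elements. -/
lemma add_one_mul_matElem_add_single (c β : CrIdx → ℂ) (out inn : Occ) (x : CrIdx) :
    (out x + 1) * matElem c β (out + Finsupp.single x 1) inn =
      c x * matElem c β out inn + inn x * matElem c β out (inn - Finsupp.single x 1) := by
  classical
  have h1 : MvPowerSeries.pderiv ℂ x (creationExp c) = MvPowerSeries.C (c x) * creationExp c := by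
    ext ν
    rw [MvPowerSeries.coeff_pderiv, MvPowerSeries.coeff_C_mul, ← pderiv_creationExp]
    ring
  have h2 : MvPolynomial.pderiv x (translate β (MvPolynomial.monomial inn 1)) =
      MvPolynomial.C (inn x : ℂ) *
        translate β (MvPolynomial.monomial (inn - Finsupp.single x 1) 1) := by
    rw [pderiv_translate, MvPolynomial.pderiv_monomial, one_mul,
      ← mul_one (inn x : ℂ), ← MvPolynomial.C_mul_monomial, map_mul]
    simp [translate]
  have h3 := congrArg (MvPowerSeries.coeff out) (Derivation.leibniz (MvPowerSeries.pderiv ℂ x)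
    (creationExp c) (translate β (MvPolynomial.monomial inn 1) : MvPowerSeries CrIdx ℂ))
  rw [MvPowerSeries.coeff_pderiv, h1, MvPowerSeries.pderiv_coe, h2] at h3
  simp only [matElem_eq_translate]
  rw [mul_comm, h3]
  simp only [smul_eq_mul, map_add, MvPolynomial.coe_mul, MvPolynomial.coe_C]
  rw [mul_left_comm, MvPowerSeries.coeff_C_mul, mul_left_comm, MvPowerSeries.coeff_C_mul,
    mul_comm (creationExp c)]
  ring_nf

/-- The commutator of the multiplication by `x` with an exponential, in matrix elements. -/
lemma matElem_add_single (c β : CrIdx → ℂ) (out inn : Occ) (x : CrIdx) :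
    matElem c β out (inn + Finsupp.single x 1) =
      (if out x = 0 then 0 else matElem c β (out - Finsupp.single x 1) inn) +
        β x * matElem c β out inn := by
  classical
  have h1 : translate β (MvPolynomial.monomial (inn + Finsupp.single x 1) 1) =
      (MvPolynomial.X x + MvPolynomial.C (β x)) * translate β (MvPolynomial.monomial inn 1) := by
    have : MvPolynomial.monomial (inn + Finsupp.single x 1) (1 : ℂ) =
        MvPolynomial.X x * MvPolynomial.monomial inn 1 := by
      rw [MvPolynomial.X, MvPolynomial.monomial_mul, add_comm, one_mul]
    rw [this, map_mul, translate, MvPolynomial.aeval_X]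
  have h2 : ∀ F : MvPowerSeries CrIdx ℂ, MvPowerSeries.coeff out (MvPowerSeries.X x * F) =
      if out x = 0 then 0 else MvPowerSeries.coeff (out - Finsupp.single x 1) F := by
    intro F
    rw [MvPowerSeries.X, MvPowerSeries.coeff_monomial_mul, one_mul]
    have : Finsupp.single x 1 ≤ out ↔ ¬out x = 0 := by
      rw [Finsupp.single_le_iff, Nat.one_le_iff_ne_zero]
    by_cases h : out x = 0
    · rw [if_neg (fun h' => this.1 h' h), if_pos h]
    · rw [if_pos (this.2 h), if_neg h]
  rw [matElem_eq_translate, matElem_eq_translate, matElem_eq_translate, h1, MvPolynomial.coe_mul,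
    MvPolynomial.coe_add, MvPolynomial.coe_X, MvPolynomial.coe_C, add_mul, mul_add, map_add,
    mul_left_comm, mul_left_comm _ (MvPowerSeries.C (β x)), h2, MvPowerSeries.coeff_C_mul]

/-- The derivation `∂ / ∂x` with respect to a creation operator. -/
def lower (x : CrIdx) : FockOp :=
  open Classical in fun out inn =>
    if out.1 = inn.1 ∧ inn.2 = out.2 + Finsupp.single x 1 then (out.2 x : ℂ) + 1 else 0

/-- The multiplication by a creation operator. -/
def raise (x : CrIdx) : FockOp :=
  open Classical in fun out inn =>
    if out.1 = inn.1 ∧ out.2 = inn.2 + Finsupp.single x 1 then 1 else 0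

lemma hasComm_lower (η k : ℂ) (x : CrIdx) (M : Lin) :
    HasComm k 1 (lower x) (vertex η k M) (M.cre x • vertex η k M) := by
  classical
  intro out inn _
  have h1 := hasSum_single (f := fun mid => lower x out mid * vertex η k M mid inn)
    (out.1, out.2 + Finsupp.single x 1) (fun mid h => by
      rw [lower, if_neg, zero_mul]
      rintro ⟨h1, h2⟩
      exact h (Prod.ext h1.symm h2))
  have h2 := hasSum_single (f := fun mid => vertex η k M out mid * lower x mid inn)
    (inn.1, inn.2 - Finsupp.single x 1) (fun mid h => by
      rw [lower, if_neg, mul_zero]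
      rintro ⟨h1, h2⟩
      exact h (Prod.ext h1 (by rw [h2, add_tsub_cancel_right])))
  refine ⟨h1.summable, h2.summable, ?_⟩
  rw [opMul, opMul, h1.tsum_eq, h2.tsum_eq, lower, if_pos ⟨rfl, rfl⟩, Pi.smul_apply, Pi.smul_apply,
    smul_eq_mul, lower]
  simp only [vertex_apply]
  split_ifs with h3 h4 h4
  · have h5 := add_one_mul_matElem_add_single M.cre (M.ann η k) out.2 inn.2 x
    have h6 : (((inn.2 - Finsupp.single x 1 : Occ) x : ℕ) : ℂ) + 1 = inn.2 x := by
      have := congrArg (fun f => ((f x : ℕ) : ℂ)) h4.2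
      simpa using this.symm
    rw [h6]
    linear_combination exp (zeroPair k M inn.1) * h5
  · have h5 := add_one_mul_matElem_add_single M.cre (M.ann η k) out.2 inn.2 x
    have h6 : inn.2 x = 0 := by
      by_contra h0
      exact h4 ⟨trivial, (Finsupp.sub_add_single_one_cancel h0).symm⟩
    rw [h6] at h5
    linear_combination exp (zeroPair k M inn.1) * h5
  all_goals simp

lemma hasComm_raise (η k : ℂ) (x : CrIdx) (M : Lin) :
    HasComm k 1 (raise x) (vertex η k M) (-M.ann η k x • vertex η k M) := by
  classical
  intro out inn _
  have h1 := hasSum_single (f := fun mid => raise x out mid * vertex η k M mid inn)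
    (out.1, out.2 - Finsupp.single x 1) (fun mid h => by
      rw [raise, if_neg, zero_mul]
      rintro ⟨h1, h2⟩
      exact h (Prod.ext h1.symm (by rw [h2, add_tsub_cancel_right])))
  have h2 := hasSum_single (f := fun mid => vertex η k M out mid * raise x mid inn)
    (inn.1, inn.2 + Finsupp.single x 1) (fun mid h => by
      rw [raise, if_neg, mul_zero]
      rintro ⟨h1, h2⟩
      exact h (Prod.ext h1 h2))
  refine ⟨h1.summable, h2.summable, ?_⟩
  have h5 := matElem_add_single M.cre (M.ann η k) out.2 inn.2 x
  rw [opMul, opMul, h1.tsum_eq, h2.tsum_eq, raise, raise,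
    if_pos (c := inn.1 = inn.1 ∧ _) ⟨rfl, rfl⟩,
    Pi.smul_apply, Pi.smul_apply, smul_eq_mul]
  simp only [vertex_apply]
  by_cases h0 : out.2 x = 0
  · rw [if_pos h0] at h5
    rw [if_neg]
    · split_ifs with h3
      · linear_combination -exp (zeroPair k M inn.1) * h5
      · simp
    · rintro ⟨-, h⟩
      have := congrArg (fun f => f x) h
      simp [h0] at this
  · rw [if_neg h0] at h5
    rw [if_pos ⟨trivial, (Finsupp.sub_add_single_one_cancel h0).symm⟩]
    split_ifs with h3
    · linear_combination -exp (zeroPair k M inn.1) * h5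
    · simp

lemma hasComm_diagOp (η k : ℂ) (f : (Osc → ℂ) → ℂ) (M : Lin) (hf : ∀ χ, f (χ + M.chg) = f χ) :
    HasComm k 1 (diagOp f) (vertex η k M) 0 := by
  classical
  intro out inn _
  have h1 := hasSum_single (f := fun mid => diagOp f out mid * vertex η k M mid inn) out
    (fun mid h => by rw [diagOp, if_neg (Ne.symm h), zero_mul])
  have h2 := hasSum_single (f := fun mid => vertex η k M out mid * diagOp f mid inn) inn
    (fun mid h => by rw [diagOp, if_neg h, mul_zero])
  refine ⟨h1.summable, h2.summable, ?_⟩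
  rw [opMul, opMul, h1.tsum_eq, h2.tsum_eq, diagOp, diagOp, if_pos rfl, if_pos rfl]
  simp only [vertex_apply]
  split_ifs with h3
  · rw [h3, hf]
    simp [mul_comm]
  · simp

lemma oscMode_zero (η k : ℂ) (L : Osc → ℂ) :
    oscMode η k L 0 = diagOp fun χ => ∑ r, L r * zeroEig k χ r := by
  classical
  ext out inn
  by_cases h1 : out.1 = inn.1 <;> by_cases h2 : out.2 = inn.2 <;>
    simp [oscMode, diagOp, Prod.ext_iff, h1, h2]

lemma sum_fockOp_apply {ι : Type*} (t : Finset ι) (f : ι → FockOp) (out inn : FockState) :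
    (∑ s ∈ t, f s) out inn = ∑ s ∈ t, f s out inn := by
  rw [Finset.sum_apply, Finset.sum_apply]

lemma oscMode_pos (η k : ℂ) (L : Osc → ℂ) (m : ℕ) :
    oscMode η k L (m + 1 : ℕ) =
      ∑ s, (∑ r, L r * comm η k (m + 1 : ℕ) r s) • lower (s, m.succPNat) := by
  classical
  ext out inn
  have h : ∀ x : CrIdx, lower x out inn = if out.1 = inn.1 then
      MvPolynomial.coeff out.2 (MvPolynomial.pderiv x (MvPolynomial.monomial inn.2 (1 : ℂ)))
        else 0 := by
    intro x
    rw [MvPolynomial.pderiv_monomial, MvPolynomial.coeff_monomial, one_mul, lower]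
    by_cases h1 : out.1 = inn.1
    · rw [if_pos h1]
      by_cases h2 : inn.2 = out.2 + Finsupp.single x 1
      · rw [if_pos ⟨h1, h2⟩, h2, if_pos (add_tsub_cancel_right _ _)]
        simp
      · rw [if_neg (fun h => h2 h.2)]
        by_cases h0 : inn.2 x = 0
        · simp [h0]
        · rw [if_neg]
          intro h3
          rw [← h3] at h2
          exact h2 (Finsupp.sub_add_single_one_cancel h0).symm
    · rw [if_neg h1, if_neg (fun h => h1 h.1)]
  simp only [sum_fockOp_apply, Pi.smul_apply, smul_eq_mul, h]
  show (if out.1 = inn.1 then MvPolynomial.coeff out.2 (∑ r, ∑ s, MvPolynomial.C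
          (L r * comm η k (m + 1 : ℕ) r s) *
            MvPolynomial.pderiv (s, m.succPNat) (MvPolynomial.monomial inn.2 (1 : ℂ))) else 0) = _
  split_ifs with h1
  · rw [Finset.sum_comm, MvPolynomial.coeff_sum]
    refine Finset.sum_congr rfl fun s _ => ?_
    rw [MvPolynomial.coeff_sum, Finset.sum_mul]
    exact Finset.sum_congr rfl fun r _ => MvPolynomial.coeff_C_mul _ _ _
  · simp

lemma oscMode_neg (η k : ℂ) (L : Osc → ℂ) (m : ℕ) :
    oscMode η k L (-(m + 1 : ℕ)) = ∑ r, L r • raise (r, m.succPNat) := by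
  classical
  ext out inn
  have h : ∀ x : CrIdx, raise x out inn = if out.1 = inn.1 then
      MvPolynomial.coeff out.2 (MvPolynomial.X x * MvPolynomial.monomial inn.2 (1 : ℂ))
        else 0 := by
    intro x
    rw [MvPolynomial.X, MvPolynomial.monomial_mul, MvPolynomial.coeff_monomial, one_mul, raise,
      add_comm (Finsupp.single x 1), ite_and]
    simp only [eq_comm]
  simp only [sum_fockOp_apply, Pi.smul_apply, smul_eq_mul, h]
  show (if out.1 = inn.1 then MvPolynomial.coeff out.2 (∑ r, MvPolynomial.C (L r) *
          (MvPolynomial.X (r, m.succPNat) * MvPolynomial.monomial inn.2 (1 : ℂ))) else 0) = _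
  split_ifs with h1
  · rw [MvPolynomial.coeff_sum]
    exact Finset.sum_congr rfl fun r _ => MvPolynomial.coeff_C_mul _ _ _
  · simp

lemma HasComm.sum_left {k s : ℂ} {ι : Type*} (t : Finset ι) {A C : ι → FockOp} {B : FockOp}
    (h : ∀ r ∈ t, HasComm k s (A r) B (C r)) : HasComm k s (∑ r ∈ t, A r) B (∑ r ∈ t, C r) := by
  classical
  induction t using Finset.induction_on with
  | empty =>
    intro out inn _
    simp [opMul]
  | insert r t hr ih =>
    rw [Finset.sum_insert hr, Finset.sum_insert hr]
    exact (h r (Finset.mem_insert_self _ _)).add_left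
      (ih fun r' hr' => h r' (Finset.mem_insert_of_mem hr'))

/-- The exponent `(q - q⁻¹) ∑_{n > 0} h^i_n + h^i_0 ln q`. In this form its contractions are
those of the elementary fields. -/
def hPlus (η k : ℂ) (i : Fin 2) : Lin :=
  match i with
  | 0 => plus η (.a 0) (η / 2) + plus η .b12 (k / 2 * η) + plus η .b12 ((k / 2 + 2) * η)
      + plus η .b13 ((k / 2 + 2) * η) - plus η .b23 ((k / 2 + 1) * η)
  | 1 => plus η (.a 1) (η / 2) - plus η .b12 ((k / 2 + 1) * η) - plus η .b13 ((k / 2 + 1) * η)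

/-- The exponent `-(q - q⁻¹) ∑_{n > 0} h^i_{-n} - h^i_0 ln q`. -/
def hMinus (η k : ℂ) (i : Fin 2) : Lin :=
  match i with
  | 0 => minus η (.a 0) (-(η / 2)) + minus η .b12 (-(k / 2 * η))
      + minus η .b12 (-((k / 2 + 2) * η)) + minus η .b13 (-((k / 2 + 2) * η))
      - minus η .b23 (-((k / 2 + 1) * η))
  | 1 => minus η (.a 1) (-(η / 2)) - minus η .b12 (-((k / 2 + 1) * η))
      - minus η .b13 (-((k / 2 + 1) * η))

lemma hPlus_osc_zero (η k : ℂ) (i : Fin 2) (r : Osc) :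
    (hPlus η k i).osc r 0 = η * hCoeff η k i 0 r := by
  fin_cases i <;> rcases r with j | _ | _ | _ | _ <;> (try fin_cases j) <;>
    simp [hPlus, plus_osc, hCoeff, qpow]
  ring_nf

lemma hPlus_osc (η k : ℂ) (i : Fin 2) (r : Osc) {n : ℕ} (hn : 0 < n) :
    (hPlus η k i).osc r n = (qpow η 1 - qpow η (-1)) * hCoeff η k i n r := by
  have h1 : n ≠ 0 := hn.ne'
  fin_cases i <;> rcases r with j | _ | _ | _ | _ <;> (try fin_cases j) <;>
    simp [hPlus, plus_osc, hCoeff, h1, hn]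
  all_goals simp only [qpow, mul_add, ← exp_add]; ring_nf
  all_goals exact Or.inl trivial

lemma hMinus_osc (η k : ℂ) (i : Fin 2) (r : Osc) {n : ℕ} (hn : 0 < n) :
    (hMinus η k i).osc r (-n) = -((qpow η 1 - qpow η (-1)) * hCoeff η k i (-n) r) := by
  have h1 : n ≠ 0 := hn.ne'
  fin_cases i <;> rcases r with j | _ | _ | _ | _ <;> (try fin_cases j) <;>
    simp [hMinus, minus_osc, hCoeff, h1, hn]
  all_goals simp only [qpow, mul_add, ← exp_add]; ring_nf
  all_goals exact Or.inl trivial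

/-- The exponent `M` commutes with the modes `h^i_n`: its contractions with `hPlus` and `hMinus`
vanish, and it does not change the eigenvalue of `h^i_0`. -/
structure CartanInvariant (η k : ℂ) (i : Fin 2) (M : Lin) : Prop where
  pos : ∀ n : ℕ, 0 < n → n * contraction η k (hPlus η k i) M n = 0
  neg : ∀ n : ℕ, 0 < n → n * contraction η k M (hMinus η k i) n = 0
  zero : zeroPair k (hPlus η k i) M.chg = 0

section cartanModes
variable {η k : ℂ} [Generic η k]

lemma cartanInvariant_screen1 (i : Fin 2) (δ ζ : ℂ) :
    CartanInvariant η k i (screen1 η k δ ζ) := by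
  fin_cases i
  all_goals
    refine ⟨fun n hn => ?_, fun n hn => ?_, ?_⟩
    · simp [hPlus, screen1, mul_add, mul_sub, comm₀, cartan, hn]
      ring_nf
    · simp [hMinus, screen1, mul_add, mul_sub, comm₀, cartan, hn]
      ring_nf
    · simp [hPlus, screen1, comm₀, cartan] <;> ring_nf

lemma cartanInvariant_screen1C (i : Fin 2) (ζ : ℂ) :
    CartanInvariant η k i (screen1C η k ζ) := by
  fin_cases i
  all_goals
    refine ⟨fun n hn => ?_, fun n hn => ?_, ?_⟩
    · simp [hPlus, screen1C, mul_add, mul_sub, comm₀, cartan, hn]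
      ring_nf
    · simp [hMinus, screen1C, mul_add, mul_sub, comm₀, cartan, hn]
      ring_nf
    · simp [hPlus, screen1C, comm₀, cartan] <;> ring_nf

lemma cartanInvariant_screen2 (i : Fin 2) (ζ : ℂ) :
    CartanInvariant η k i (screen2 η k ζ) := by
  fin_cases i
  all_goals
    refine ⟨fun n hn => ?_, fun n hn => ?_, ?_⟩
    · simp [hPlus, screen2, mul_add, mul_sub, comm₀, cartan, hn] <;> ring_nf
    · simp [hMinus, screen2, mul_add, mul_sub, comm₀, cartan, hn] <;> ring_nf
    · simp [hPlus, screen2, comm₀, cartan]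

lemma HasComm.zero_of_smul {k s a : ℂ} {A B C : FockOp} (h : HasComm k s A B (a • C))
    (ha : a = 0) : HasComm k s A B 0 := by
  rwa [ha, zero_smul] at h

lemma CartanInvariant.sum_eq_zero {i : Fin 2} {M : Lin} (hM : CartanInvariant η k i M) :
    ∑ r, hCoeff η k i 0 r * zeroEig k M.chg r = 0 := by
  have hη : η ≠ 0 := by
    rintro rfl
    exact qpow_sub_ne 0 k (by simp [qpow])
  have h := hM.zero
  simp only [zeroPair, hPlus_osc_zero, mul_assoc, ← Finset.mul_sum] at h
  exact (mul_eq_zero.1 h).resolve_left hη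

lemma CartanInvariant.hasComm_h {i : Fin 2} {M : Lin} (hM : CartanInvariant η k i M) (n : ℤ) :
    HasComm k 1 (oscMode η k (hCoeff η k i n) n) (vertex η k M) 0 := by
  have hq := qpow_sub_ne η k
  have cast : ∀ m : ℕ, ((m + 1 : ℕ) : ℂ) ≠ 0 := fun m => Nat.cast_ne_zero.2 m.succ_ne_zero
  rcases lt_trichotomy n 0 with hn | rfl | hn
  · obtain ⟨m, rfl⟩ : ∃ m : ℕ, n = -(m + 1 : ℕ) := ⟨(-n - 1).toNat, by omega⟩
    rw [oscMode_neg]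
    have h1 := HasComm.sum_left (k := k) (s := 1) Finset.univ (fun r _ =>
      (hasComm_raise η k (r, m.succPNat) M).smul_left (hCoeff η k i (-(m + 1 : ℕ)) r))
    simp only [← mul_smul, ← Finset.sum_smul] at h1
    refine h1.zero_of_smul (mul_left_cancel₀ hq ?_)
    have h2 := (mul_eq_zero.1 (hM.neg (m + 1) m.succ_pos)).resolve_left (cast m)
    rw [contraction] at h2
    rw [mul_zero, ← h2, Finset.mul_sum]
    refine Finset.sum_congr rfl fun r _ => ?_
    simp only [hMinus_osc _ _ _ _ m.succ_pos]
    rw [← Finset.sum_mul]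
    show _ = Lin.ann η k M (r, m.succPNat) * _
    ring
  · rw [oscMode_zero]
    refine hasComm_diagOp η k _ M fun χ => ?_
    simp only [zeroEig_add, mul_add, Finset.sum_add_distrib, hM.sum_eq_zero, add_zero]
  · obtain ⟨m, rfl⟩ : ∃ m : ℕ, n = (m + 1 : ℕ) := ⟨(n - 1).toNat, by omega⟩
    rw [oscMode_pos]
    have h1 := HasComm.sum_left (k := k) (s := 1) Finset.univ (fun s _ =>
      (hasComm_lower η k (s, m.succPNat) M).smul_left
        (∑ r, hCoeff η k i (m + 1 : ℕ) r * comm η k (m + 1 : ℕ) r s))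
    simp only [← mul_smul, ← Finset.sum_smul] at h1
    refine h1.zero_of_smul (mul_left_cancel₀ hq ?_)
    have h2 := (mul_eq_zero.1 (hM.pos (m + 1) m.succ_pos)).resolve_left (cast m)
    rw [contraction] at h2
    rw [mul_zero, ← h2, Finset.mul_sum]
    refine Finset.sum_congr rfl fun s _ => ?_
    rw [Finset.sum_mul, Finset.mul_sum]
    refine Finset.sum_congr rfl fun r _ => ?_
    rw [hPlus_osc _ _ _ _ m.succ_pos]
    show _ = _ * M.cre (s, m.succPNat)
    ring

/-- An operator that commutes with all vertex operators of Cartan invariant exponents commutes with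
the screen currents. -/
lemma HasComm.screen {s : ℂ} {A : FockOp} (h : ∀ M : Lin, (∀ j, CartanInvariant η k j M) →
    HasComm k s A (vertex η k M) 0) (i : Fin 2) (ζ : ℂ) :
    HasComm k s A (screen η k i ζ) 0 := by
  have h1 := fun δ => h _ fun j => cartanInvariant_screen1 (η := η) (k := k) j δ ζ
  have h2 := h _ fun j => cartanInvariant_screen1C (η := η) (k := k) j ζ
  have h3 := h _ fun j => cartanInvariant_screen2 (η := η) (k := k) j ζ
  match i with
  | 0 =>
    rw [screen_zero]
    simpa using (((h1 0).sub_right (h1 (2 * η))).smul_right (diffFactor η ζ)).add_right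
      (h2.smul_right (qpow η 1))
  | 1 =>
    rw [screen_one]
    simpa using h3.smul_right (-qpow η (-1))

/-- The total difference to which a generator and a screen current commute, as a function of `z`:
`Ψ (q ^ (-(k + 1)) z) - Ψ (q ^ (k + 1) z)` for `Ψ = defectOp`. -/
def defectOp (η k : ℂ) (i : Fin 2) (ζ : ℂ) : Gen → FockOp
  | .xMinus j n => if i = j then boundaryOp η k i n ζ else 0
  | _ => 0

/-- The generators commute with the screen currents, up to signs and total differences. -/
lemma hasComm_op (g : Gen) (i : Fin 2) (ζ : ℂ) :
    HasComm k (sign i g) (g.op η k) (screen η k i ζ) (diffFactor η ζ •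
      (defectOp η k i (ζ - (k + 1) * η) g - defectOp η k i (ζ + (k + 1) * η) g)) := by
  have h0 : diffFactor η ζ • ((0 : FockOp) - 0) = 0 := by rw [sub_zero, smul_zero]
  cases g with
  | xPlus j n =>
    simp only [defectOp, h0]
    fin_cases i <;> fin_cases j
    · exact hasComm_xPlus_zero_screen_zero n ζ
    · exact hasComm_xPlus_one_screen_zero n ζ
    · exact hasComm_xPlus_zero_screen_one n ζ
    · exact hasComm_xPlus_one_screen_one n ζ
  | xMinus j n =>
    fin_cases i <;> fin_cases j
    · exact hasComm_xMinus_zero_screen_zero n ζ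
    · simpa [defectOp, sign, Gen.op] using hasComm_xMinus_one_screen_zero n ζ
    · simpa [defectOp, sign, Gen.op] using hasComm_xMinus_zero_screen_one n ζ
    · exact hasComm_xMinus_one_screen_one n ζ
  | h j n =>
    simp only [defectOp, h0]
    exact HasComm.screen (fun M hM => (hM j).hasComm_h n) i ζ
  | qh j =>
    simp only [defectOp, h0]
    refine HasComm.screen (fun M hM => hasComm_diagOp η k _ M fun χ => ?_) i ζ
    simp only [zeroEig_add, mul_add, Finset.sum_add_distrib, (hM j).sum_eq_zero, add_zero]
  | qhInv j =>
    simp only [defectOp, h0]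
    refine HasComm.screen (fun M hM => hasComm_diagOp η k _ M fun χ => ?_) i ζ
    simp only [zeroEig_add, mul_add, Finset.sum_add_distrib, (hM j).sum_eq_zero, add_zero]
  | c =>
    simp only [defectOp, h0]
    exact HasComm.screen (fun M _ => hasComm_diagOp η k _ M fun _ => rfl) i ζ

end cartanModes

/-! ### Matrix elements and Jackson integrals -/

/-- The regrouping of the terms of `⟨u| A B |v⟩` by their initial and final states. -/
lemma hasSum_opMul {u v : FockState → ℂ} {A B : FockOp} (h : Summable (elemTerm u A B v)) :
    HasSum (fun p : FockState × FockState => u p.1 * opMul A B p.1 p.2 * v p.2)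
      (∑' x, elemTerm u A B v x) := by
  let e : (FockState × FockState) × FockState ≃ FockState × FockState × FockState :=
    { toFun := fun x => (x.1.1, x.2, x.1.2)
      invFun := fun x => ((x.1, x.2.2), x.2.1)
      left_inv := fun _ => rfl
      right_inv := fun _ => rfl }
  have h1 : HasSum (elemTerm u A B v ∘ e) (∑' x, elemTerm u A B v x) :=
    e.hasSum_iff.2 h.hasSum
  have h2 : ∀ p : FockState × FockState,
      HasSum (fun mid => elemTerm u A B v (e (p, mid))) (u p.1 * opMul A B p.1 p.2 * v p.2) := by
    intro p
    have h3 : u p.1 * opMul A B p.1 p.2 * v p.2 = ∑' mid, elemTerm u A B v (e (p, mid)) := by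
      simp only [opMul]
      rw [← tsum_mul_left, ← tsum_mul_right]
      exact tsum_congr fun mid => by simp only [elemTerm, e, Equiv.coe_fn_mk]; ring
    rw [h3]
    exact (h1.summable.prod_factor p).hasSum
  exact h1.prod_fiberwise h2

lemma HasComm.hasSum {k s : ℂ} {A B C : FockOp} (h : HasComm k s A B C) {u v : FockState → ℂ}
    (hv : ∀ x, v x ≠ 0 → IntegralCharge k x.1) (h1 : Summable (elemTerm u A B v))
    (h2 : Summable (elemTerm u B A v)) :
    HasSum (fun p : FockState × FockState => u p.1 * C p.1 p.2 * v p.2)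
      (∑' x, elemTerm u A B v x - s * ∑' x, elemTerm u B A v x) := by
  have h3 := (hasSum_opMul h1).sub ((hasSum_opMul h2).mul_left s)
  refine h3.congr_fun ?_
  intro p
  by_cases h0 : v p.2 = 0
  · simp [h0]
  · rw [← (h p.1 p.2 (hv _ h0)).2.2]
    ring

lemma sum_Ico_sub_add_one (f : ℤ → ℂ) {a b : ℤ} (h : a ≤ b) :
    ∑ m ∈ Finset.Ico a b, (f m - f (m + 1)) = f a - f b := by
  induction b, h using Int.leInduction with
  | base => simp
  | succ b hb ih =>
    have : Finset.Ico a (b + 1) = insert b (Finset.Ico a b) := by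
      ext x; simp only [Finset.mem_insert, Finset.mem_Ico]; omega
    rw [this, Finset.sum_insert (by simp), ih]
    ring

/-- A double sequence `F a - H b` converges only if `F` and `H` are bounded. -/
lemma isBigO_of_tendsto_sub {F H : ℕ → ℂ} {J : ℂ}
    (h : Tendsto (fun N : ℕ × ℕ => F N.1 - H N.2) atTop (𝓝 J)) :
    F =O[atTop] (fun _ => (1 : ℝ)) ∧ H =O[atTop] (fun _ => (1 : ℝ)) := by
  have h1 := h.norm.eventually (eventually_lt_nhds (show ‖J‖ < ‖J‖ + 1 by linarith))
  rw [← prod_atTop_atTop_eq, eventually_prod_iff] at h1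
  obtain ⟨pa, ha, pb, hb, hab⟩ := h1
  obtain ⟨a, ha'⟩ := ha.exists
  obtain ⟨b, hb'⟩ := hb.exists
  constructor
  · refine Asymptotics.IsBigO.of_bound (‖J‖ + 1 + ‖H b‖) ?_
    filter_upwards [ha] with n hn
    have h2 := hab hn hb'
    have h3 := norm_sub_norm_le (F n) (H b)
    simp only [norm_one, mul_one]
    linarith
  · refine Asymptotics.IsBigO.of_bound (‖J‖ + 1 + ‖F a‖) ?_
    filter_upwards [hb] with n hn
    have h2 := hab ha' hn
    have h3 := norm_sub_norm_le (H n) (F a)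
    rw [norm_sub_rev] at h3
    simp only [norm_one, mul_one]
    linarith

lemma tendsto_exp_add_nat_mul {P : ℂ} (hP : ‖exp P‖ < 1) (w : ℂ) :
    Tendsto (fun N : ℕ => exp (w + N * P)) atTop (𝓝 0) := by
  have h1 := (tendsto_pow_atTop_nhds_zero_of_norm_lt_one hP).const_mul (exp w)
  rw [mul_zero] at h1
  refine h1.congr fun N => ?_
  rw [exp_add, exp_nat_mul]

/-- If the differences of `z ^ n G(z)` at both ends of the lattice `z = exp (w + l P)` converge for
all `n`, they converge to zero: `z ^ n G(z)` is `z` times a bounded function where `z → 0`, and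
`z⁻¹` times a bounded function where `z → ∞`. -/
lemma tendsto_sub_zero {P w : ℂ} (hP : ‖exp P‖ < 1) {G : ℤ → ℤ → ℂ}
    (hG : ∀ n l, G (n + 1) l = exp (w + l * P) * G n l)
    (hJ : ∀ n, ∃ J, Tendsto (fun N : ℕ × ℕ => G n (-(N.1 : ℤ)) - G n N.2) atTop (𝓝 J)) (n : ℤ) :
    Tendsto (fun N : ℕ × ℕ => G n (-(N.1 : ℤ)) - G n N.2) atTop (𝓝 0) := by
  have hO := fun n => isBigO_of_tendsto_sub (F := fun N : ℕ => G n (-(N : ℤ)))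
    (H := fun N : ℕ => G n N) (hJ n).choose_spec
  have h1 : Tendsto (fun N : ℕ => G n N) atTop (𝓝 0) := by
    have e : (fun N : ℕ => G n N) = fun N : ℕ => exp (w + N * P) * G (n - 1) N := by
      funext N
      have := hG (n - 1) N
      rw [sub_add_cancel] at this
      rw [this]
      norm_cast
    have h2 := (Asymptotics.isLittleO_one_iff ℝ).2 (tendsto_exp_add_nat_mul hP w)
    have h3 := h2.mul_isBigO (hO (n - 1)).2
    simp only [mul_one] at h3
    rw [e]
    exact (Asymptotics.isLittleO_one_iff ℝ).1 h3
  have h2 : Tendsto (fun N : ℕ => G n (-(N : ℤ))) atTop (𝓝 0) := by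
    have e : (fun N : ℕ => G n (-(N : ℤ))) =
        fun N : ℕ => exp (-w + N * P) * G (n + 1) (-(N : ℤ)) := by
      funext N
      rw [hG, ← mul_assoc, ← exp_add]
      push_cast
      ring_nf
      simp
    have h2 := (Asymptotics.isLittleO_one_iff ℝ).2 (tendsto_exp_add_nat_mul hP (-w))
    have h3 := h2.mul_isBigO (hO (n + 1)).1
    simp only [mul_one] at h3
    rw [e]
    exact (Asymptotics.isLittleO_one_iff ℝ).1 h3
  rw [← prod_atTop_atTop_eq]
  simpa using (h2.comp tendsto_fst).sub (h1.comp tendsto_snd)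

lemma boundaryExp_add (η k : ℂ) (i : Fin 2) (ζ ω : ℂ) :
    boundaryExp η k i (ζ + ω) = (boundaryExp η k i ζ).shift ω := by
  have h0 : (0 : Lin).shift ω = 0 := by
    ext r n
    · simp only [Lin.shift]
      show (if n = 0 then (0 : ℂ) + ω * 0 else _ * (0 : ℂ)) = 0
      simp
    · rfl
  rw [boundaryExp, boundaryExp, Lin.shift_add, Lin.shift_neg, shift_starFld]
  split_ifs
  · rw [h0]
  · rw [Lin.shift_add, shift_phase]

/-- The matrix elements of `defectOp` are powers of `z`, whose exponents grow with the mode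
number. -/
lemma exists_defectOp_add (η k : ℂ) (i : Fin 2) (g : Gen) :
    ∃ e : FockState → FockState → ℂ, ∀ (m : ℤ) (ζ ω : ℂ) (out inn : FockState),
      defectOp η k i (ζ + ω) (g.shift m) out inn =
        exp (ω * (m + e out inn)) * defectOp η k i ζ (g.shift m) out inn := by
  have h0 : ∀ (out inn : FockState), (0 : FockOp) out inn = 0 := fun _ _ => rfl
  cases g with
  | xMinus j n =>
    refine ⟨fun out inn => n + (level out.2 - level inn.2 +
      chgPair k (boundaryExp η k i 0) inn.1), fun m ζ ω out inn => ?_⟩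
    simp only [Gen.shift, defectOp]
    split_ifs
    · have : chgPair k (boundaryExp η k i ζ) inn.1 = chgPair k (boundaryExp η k i 0) inn.1 := by
        have h := boundaryExp_add η k i 0 ζ
        rw [zero_add] at h
        rw [h]
        rfl
      simp only [boundaryOp, Pi.smul_apply, smul_eq_mul]
      rw [boundaryExp_add, vertex_shift, this, ← mul_assoc, ← mul_assoc, ← exp_add, ← exp_add]
      push_cast
      ring_nf
    · rw [h0, mul_zero]
  | _ => exact ⟨fun _ _ => 0, fun m ζ ω out inn => by simp only [Gen.shift, defectOp, h0, mul_zero]⟩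

lemma defectOp_shift_succ (η k : ℂ) (i : Fin 2) (g : Gen) (m : ℤ) (ζ : ℂ) :
    defectOp η k i ζ (g.shift (m + 1)) = exp ζ • defectOp η k i ζ (g.shift m) := by
  cases g with
  | xMinus j n =>
    simp only [Gen.shift, defectOp]
    split_ifs
    · rw [boundaryOp, boundaryOp, ← mul_smul, ← exp_add]
      push_cast
      ring_nf
    · rw [smul_zero]
  | _ => simp only [Gen.shift, defectOp, smul_zero]

/-! ### The screen charges -/

lemma qnum_ne_zero {η x : ℂ} (h1 : exp (2 * η) ≠ 1) (hx : exp (2 * (η * x)) ≠ 1) :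
    qnum η x ≠ 0 := by
  have key : ∀ y : ℂ, exp (2 * y) ≠ 1 → exp y - exp (-y) ≠ 0 := by
    intro y hy h
    refine hy ?_
    have h2 := sub_eq_zero.1 h
    rw [two_mul, exp_add]
    nth_rewrite 2 [h2]
    rw [← exp_add, add_neg_cancel, exp_zero]
  rw [qnum, qpow, qpow, qpow, qpow, mul_one, mul_neg, mul_neg, mul_one]
  exact div_ne_zero (key _ hx) (key _ h1)

lemma exp_int_mul_ne_one {z : ℂ} (h : ∀ n : ℕ, 0 < n → exp z ^ n ≠ 1) {n : ℤ} (hn : n ≠ 0) :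
    exp (n * z) ≠ 1 := by
  intro h1
  obtain ⟨m, rfl | rfl⟩ := n.eq_nat_or_neg
  · refine h m (by omega) ?_
    rw [← exp_nat_mul]
    exact_mod_cast h1
  · refine h m (by omega) ?_
    rw [← exp_nat_mul, ← inv_inj, ← exp_neg, inv_one, ← h1]
    push_cast
    ring_nf

lemma Generic.of_norm_lt_one {η k : ℂ} (hq : ∀ n : ℕ, 0 < n → exp η ^ n ≠ 1) (hk : k ≠ -1)
    (hp : ‖exp (2 * (k + 1) * η)‖ < 1) : Generic η k := by
  have h2 : ∀ n : ℤ, n ≠ 0 → exp (2 * (η * n)) ≠ 1 := by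
    intro n hn
    have := exp_int_mul_ne_one hq (n := 2 * n) (by omega)
    push_cast at this
    rwa [show 2 * (η * n) = 2 * n * η by ring]
  have h1 : exp (2 * η) ≠ 1 := by simpa using h2 1 one_ne_zero
  refine ⟨fun n hn => qnum_ne_zero h1 (h2 n hn), fun n hn => qnum_ne_zero h1 ?_, ?_⟩
  · have h3 : ∀ n : ℕ, 0 < n → exp (2 * (k + 1) * η) ^ n ≠ 1 := by
      intro n hn h
      have h4 := pow_lt_one₀ (norm_nonneg _) hp hn.ne'
      rw [← norm_pow, h, norm_one] at h4
      exact lt_irrefl _ h4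
    have h5 := exp_int_mul_ne_one h3 hn
    rwa [show 2 * (η * ((k + 1) * n)) = n * (2 * (k + 1) * η) by ring]
  · intro h
    exact hk (eq_neg_of_add_eq_zero_left h)

lemma integralCharge_of_mem_fockSpace {k : ℂ} {lam : Osc → ℂ}
    (h13 : ∃ n : ℤ, lam .b13 = n) (h23 : ∃ n : ℤ, lam .b23 = n)
    (hc : ∃ n : ℤ, lam .c - lam .b12 = n) {x : FockState} (hx : x ∈ fockSpace k lam) :
    IntegralCharge k x.1 := by
  obtain ⟨i, j, l, -, -, e1, e2, e3, e4⟩ := hx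
  obtain ⟨n13, h13⟩ := h13
  obtain ⟨n23, h23⟩ := h23
  obtain ⟨nc, hc⟩ := hc
  have key : ∀ r, r ≠ .a 0 → r ≠ .a 1 → zeroEig k x.1 r = comm₀ k r r * x.1 r := by
    intro r h0 h1
    refine Finset.sum_eq_single r (fun s _ hs => ?_) (by simp)
    rcases r with a | _ | _ | _ | _
    · fin_cases a <;> simp_all
    all_goals rcases s with b | _ | _ | _ | _ <;> simp_all [comm₀]
  refine ⟨⟨nc, ?_⟩, ⟨n13 + j, ?_⟩, ⟨n23 + l, ?_⟩⟩
  · rw [key _ (by decide) (by decide), key _ (by decide) (by decide), e1, e4]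
    simp only [comm₀]
    linear_combination hc
  · rw [key _ (by decide) (by decide), e2, h13]
    simp [comm₀]
  · rw [key _ (by decide) (by decide), e3, h23]
    simp [comm₀]

lemma sign_shift (i : Fin 2) (g : Gen) (m : ℤ) : sign i (g.shift m) = sign i g := by
  cases g <;> rfl

lemma sign_mul_self (i : Fin 2) (g : Gen) : sign i g * sign i g = 1 := by
  cases g <;> simp only [sign] <;> (try split_ifs) <;> norm_num

lemma Gen.shift_zero (g : Gen) : g.shift 0 = g := by
  cases g <;> simp [Gen.shift]

section charge
variable {η k t : ℂ} {i : Fin 2} {u v : FockState → ℂ} {g : Gen}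

/-- The terms of the matrix element of `defectOp` at the `l`-th point of the Jackson integral. -/
def defectTerm (η k t : ℂ) (i : Fin 2) (u v : FockState → ℂ) (g : Gen) (m l : ℤ)
    (p : FockState × FockState) : ℂ :=
  u p.1 * defectOp η k i (t - (k + 1) * η + l * (2 * (k + 1) * η)) (g.shift m) p.1 p.2 * v p.2

lemma hasSum_defectTerm_sub [Generic η k] (hv : ∀ x, v x ≠ 0 → IntegralCharge k x.1)
    {m : ℤ} (l : ℤ)
    (h1 : Summable (elemTerm u ((g.shift m).op η k)
      (screen η k i (t + l * (2 * (k + 1) * η))) v))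
    (h2 : Summable (elemTerm u (screen η k i (t + l * (2 * (k + 1) * η)))
      ((g.shift m).op η k) v)) :
    HasSum (fun p => diffFactor η (t + l * (2 * (k + 1) * η)) *
      (defectTerm η k t i u v g m l p - defectTerm η k t i u v g m (l + 1) p))
      (∑' x, elemTerm u ((g.shift m).op η k) (screen η k i (t + l * (2 * (k + 1) * η))) v x -
        sign i g * ∑' x, elemTerm u (screen η k i (t + l * (2 * (k + 1) * η)))
          ((g.shift m).op η k) v x) := by
  have h := (hasComm_op (k := k) (g.shift m) i (t + l * (2 * (k + 1) * η))).hasSum hv h1 h2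
  rw [sign_shift] at h
  refine h.congr_fun fun p => ?_
  have e1 : t + l * (2 * (k + 1) * η) - (k + 1) * η =
      t - (k + 1) * η + l * (2 * (k + 1) * η) := by ring
  have e2 : t + l * (2 * (k + 1) * η) + (k + 1) * η =
      t - (k + 1) * η + (l + 1 : ℤ) * (2 * (k + 1) * η) := by push_cast; ring
  simp only [defectTerm, Pi.smul_apply, Pi.sub_apply, smul_eq_mul, e1, e2]
  ring

lemma diffFactor_ne_zero [Generic η k] (ζ : ℂ) : diffFactor η ζ ≠ 0 :=
  one_div_ne_zero (mul_ne_zero (qpow_sub_ne η k) (exp_ne_zero ζ))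

/-- The matrix elements of `defectOp` converge, although only differences occur in the
commutator: the differences for two consecutive modes determine them. -/
lemma summable_defectTerm [Generic η k] (hp : exp (2 * (k + 1) * η) ≠ 1) {m l : ℤ} {d : ℂ}
    (hd : d ≠ 0)
    (h1 : Summable fun p => d *
      (defectTerm η k t i u v g m l p - defectTerm η k t i u v g m (l + 1) p))
    (h2 : Summable fun p => d *
      (defectTerm η k t i u v g (m + 1) l p - defectTerm η k t i u v g (m + 1) (l + 1) p)) :
    Summable (defectTerm η k t i u v g m l) := by
  obtain ⟨e, he⟩ := exists_defectOp_add η k i g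
  -- With `T` the term at the point `w`, `P = exp (2 (k + 1) η)` and `x T` the term at `P w`, the
  -- two series are `d (1 - x) T` and `d w (1 - P x) T`; the combination below eliminates `x`.
  have hp' := sub_ne_zero.2 hp
  have hw := exp_ne_zero (t - (k + 1) * η + l * (2 * (k + 1) * η))
  have h3 := (h1.mul_left (exp (2 * (k + 1) * η) / (d * (exp (2 * (k + 1) * η) - 1)))).sub
    (h2.mul_left (1 / (d * exp (t - (k + 1) * η + l * (2 * (k + 1) * η)) *
      (exp (2 * (k + 1) * η) - 1))))
  refine h3.congr fun p => ?_
  have e0 : t - (k + 1) * η + (l + 1 : ℤ) * (2 * (k + 1) * η) =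
      t - (k + 1) * η + l * (2 * (k + 1) * η) + 2 * (k + 1) * η := by push_cast; ring
  have e1 : exp (2 * (k + 1) * η * ((m + 1 : ℤ) + e p.1 p.2)) =
      exp (2 * (k + 1) * η) * exp (2 * (k + 1) * η * (m + e p.1 p.2)) := by
    rw [← exp_add]; push_cast; ring_nf
  simp only [defectTerm, e0]
  generalize t - (k + 1) * η + l * (2 * (k + 1) * η) = w at *
  simp only [he, e1, defectOp_shift_succ, Pi.smul_apply, smul_eq_mul]
  field_simp
  ring

/-- The screen charges commute with the generators, up to signs, on integral charges. -/
theorem exists_hasOpCharge_hasChargeOp [Generic η k] (hp : ‖exp (2 * (k + 1) * η)‖ < 1)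
    (hv : ∀ x, v x ≠ 0 → IntegralCharge k x.1)
    (hconv : ∀ m : ℤ, (∃ J, HasOpCharge η k t i u ((g.shift m).op η k) v J) ∧
      (∃ J, HasChargeOp η k t i u ((g.shift m).op η k) v J)) :
    ∃ J, HasOpCharge η k t i u (g.op η k) v J ∧
      HasChargeOp η k t i u (g.op η k) v (sign i g * J) := by
  have hp1 : exp (2 * (k + 1) * η) ≠ 1 := by
    intro h; rw [h, norm_one] at hp; exact lt_irrefl _ hp
  choose J₁ hJ₁ J₂ hJ₂ using fun m =>
    (⟨(hconv m).1.choose, (hconv m).1.choose_spec, (hconv m).2.choose, (hconv m).2.choose_spec⟩ :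
      ∃ J, HasOpCharge η k t i u ((g.shift m).op η k) v J ∧
        ∃ J', HasChargeOp η k t i u ((g.shift m).op η k) v J')
  have hD := fun m l => hasSum_defectTerm_sub (i := i) (u := u) (g := g) hv l ((hJ₁ m).1 l)
    ((hJ₂ m).1 l)
  have hS : ∀ m l, Summable (defectTerm η k t i u v g m l) := fun m l =>
    summable_defectTerm hp1 (diffFactor_ne_zero (k := k) _) (hD m l).summable
      (hD (m + 1) l).summable
  -- The function whose total difference is the (anti-)commutator, at the points of the lattice.
  set G : ℤ → ℤ → ℂ := fun m l => ∑' p, defectTerm η k t i u v g m l p with hGdef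
  have hG : ∀ m l, G (m + 1) l = exp (t - (k + 1) * η + l * (2 * (k + 1) * η)) * G m l := by
    intro m l
    simp only [hGdef]
    rw [← tsum_mul_left]
    refine tsum_congr fun p => ?_
    rw [defectTerm, defectTerm, defectOp_shift_succ]
    simp only [Pi.smul_apply, smul_eq_mul]
    ring
  -- The Jackson sums telescope: the weight `p ^ l` of a point cancels the factor `1 / z` of
  -- `diffFactor`.
  have hT : ∀ m, Tendsto (fun N : ℕ × ℕ => G m (-(N.1 : ℤ)) - G m N.2) atTop
      (𝓝 ((qpow η 1 - qpow η (-1)) / (1 - exp (2 * (k + 1) * η)) *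
        (J₁ m - sign i g * J₂ m))) := by
    intro m
    have h1 := (((hJ₁ m).2.sub ((hJ₂ m).2.const_mul (sign i g))).const_mul
      ((qpow η 1 - qpow η (-1)) / (1 - exp (2 * (k + 1) * η))))
    have hq1 := qpow_sub_ne η k
    have hp2 := sub_ne_zero.2 (Ne.symm hp1)
    refine h1.congr fun N => ?_
    rw [← sum_Ico_sub_add_one (G m) (show -(N.1 : ℤ) ≤ N.2 by omega), mul_left_comm (sign i g),
      ← mul_sub, Finset.mul_sum (a := sign i g), ← Finset.sum_sub_distrib, Finset.mul_sum,
      Finset.mul_sum]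
    refine Finset.sum_congr rfl fun l _ => ?_
    have h2 := (hD m l).tsum_eq
    rw [tsum_mul_left, (hS m l).tsum_sub (hS m (l + 1))] at h2
    have h3 : diffFactor η (t + l * (2 * (k + 1) * η)) * (G m l - G m (l + 1)) = _ := h2
    dsimp only
    rw [← mul_assoc (sign i g), ← sub_mul, ← h3, diffFactor_eq, neg_add, exp_add, exp_neg, exp_neg]
    field_simp
  have h0 := tendsto_nhds_unique (hT 0) (tendsto_sub_zero hp hG (fun m => ⟨_, hT m⟩) 0)
  have hJ : J₂ 0 = sign i g * J₁ 0 := by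
    have h1 := (mul_eq_zero.1 h0).resolve_left (div_ne_zero (qpow_sub_ne η k)
      (sub_ne_zero.2 (Ne.symm hp1)))
    linear_combination -sign i g * h1 - J₂ 0 * sign_mul_self i g
  have h1 := hJ₁ 0
  have h2 := hJ₂ 0
  rw [Gen.shift_zero] at h1 h2
  exact ⟨J₁ 0, h1, hJ ▸ h2⟩

end charge

end SL21

theorem corollary1 (η k t : ℂ)
    (hq : ∀ n : ℕ, 0 < n → Complex.exp η ^ n ≠ 1)
    (hk₀ : k ≠ 0) (hk₁ : k ≠ -1)
    (hp : ‖Complex.exp (2 * (k + 1) * η)‖ < 1)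
    (lam : SL21.Osc → ℂ)
    (h13 : ∃ n : ℤ, lam .b13 = n) (h23 : ∃ n : ℤ, lam .b23 = n)
    (hc : ∃ n : ℤ, lam .c - lam .b12 = n)
    (i : Fin 2) (u v : SL21.FockState → ℂ)
    (hv : ∀ x, v x ≠ 0 → x ∈ SL21.fockSpace k lam)
    (g : SL21.Gen)
    (hconv : ∀ m : ℤ,
      (∃ J, SL21.HasOpCharge η k t i u ((g.shift m).op η k) v J) ∧
      (∃ J, SL21.HasChargeOp η k t i u ((g.shift m).op η k) v J)) :
    ∃ J, SL21.HasOpCharge η k t i u (g.op η k) v J ∧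
      SL21.HasChargeOp η k t i u (g.op η k) v (SL21.sign i g * J) := by
  have := SL21.Generic.of_norm_lt_one hq hk₁ hp
  exact SL21.exists_hasOpCharge_hasChargeOp hp
    (fun x hx => SL21.integralCharge_of_mem_fockSpace h13 h23 hc (hv x hx)) hconv

end
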